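/- Let $k$ be a field, $n\ge 1$ and $m\ge 3$. For $p\ge 1$ let $e_1,\dots,e_p$ be the unit vectors of $\mathbb Z^p$, $e_0=0$. All algebras are over $k$; products of paths are written from right to left and modules are left modules. For a bound quiver $(Q,\rho)$ put $\Lambda=kQ/(\rho)$, graded by path length ($\Lambda$ is non-unital if $Q_0$ is infinite); a path is *bound* if its image in $\Lambda$ is nonzero. **Cubic pyramid algebras.** For $N\ge1$ let $Q(N)$ be the quiver with vertices $Q(N)_0=\{i\in\mathbb Z^N : i_t\ge 1,\ \sum_{t\le s} i_t\le m+s-1 \text{ for } 1\le s\le N\}$ and one arrow $\gamma^t_i : i\to i(t):=i-e_{t-1}+e_t$ ($1\le t\le N$) whenever $i,i(t)\in Q(N)_0$. Given scalars $d_{s,t,i}\in k$ ($t<s$), let $\Lambda(N)$ be the algebra of $Q(N)$ with the relations $d_{s,t,i}\gamma^t_{i(s)}\gamma^s_i=\gamma^s_{i(t)}\gamma^t_i$ for $t<s$ whenever $i,i(t),i(s),i(t)(s)$ are vertices, and $\gamma^t_{i(t)}\gamma^t_i=0$ whenever $i,i(t),i(t)(t)$ are vertices. The *stable quiver* $\widetilde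 Q(n)$ has the vertices and arrows of $Q(n)$ and in addition the arrows $\gamma^{n+1}_i:i\to i(n+1):=i-e_n$ whenever both ends are in $Q(n)_0$. Let $d_{s,t,i}\in k$ ($1\le t<s\le n+1$, $i\in Q(n)_0$) be scalars such that 1. $d_{s,t,i}\neq0$ whenever $i,i(t),i(s),i(t)(s)\in Q(n)_0$; 2. $d_{r,s,i(t)}\,d_{r,t,i}\,d_{s,t,i(r)}=d_{s,t,i}\,d_{r,t,i(s)}\,d_{r,s,i}$ for $t<s<r$ whenever all eight corners of the cube at $i$ spanned by the steps of types $t,s,r$ are in $Q(n)_0$ (that is, $\gamma^t_i\mapsto d_{r,t,i}\gamma^t_{i(r)}$ respects the commutation relations between types below $r$). Let $\widetilde\Lambda(n)$ (the twisted trivial extension of $\Lambda(n)$) be the algebra of $\widetilde Q(n)$ with the above two kinds of relations for all types $1\le t<s\le n+1$, respectively $1\le t\le n+1$. Grade $\widetilde\Lambda(n)$ by $\mathbb Z$ with the vertices and the arrows of $Q(n)$ in degree $0$ and the arrows of type $n+1$ in degree $1$, and let $\overline\Lambda(n)=\widetilde\Lambda(n)\#\mathbb Z^*=\bigoplus_{v\in\mathbb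 Z}\widetilde\Lambda(n)p_v$ be the smash product, $(a p_u)(b p_v)=a\,b_{u-v}\,p_v$. Its bound quiver $(\overline Q(n),\bar\rho)$ has the vertices $(i,v)\in Q(n)_0\times\mathbb Z\subset\mathbb Z^{n+1}$ (with idempotents $e_ip_v$), arrows of type $t\le n+1$ from $j$ to $j-e_{t-1}+e_t$ whenever both are vertices, and the relations above with scalars $d_{s,t,i}$ at $(i,v)$. Let $\Lambda(n+1)$ be the $(n+1)$-cubic pyramid algebra with the scalars $d_{s,t,(i,v)}:=d_{s,t,i}$. **Cuboid truncations.** For $i\in Q(n)_0$ let $C(i)=\{a\in\mathbb Z^{n+1}: 0\le a_t\le b_t\}$ with $b_1=m+n-1-\sum_t i_t$ and $b_t=i_{t-1}-1$ for $2\le t\le n+1$. For $t\in\mathbb Z$ let $Q(n+1)(t)$ be the full subquiver of $\overline Q(n)$ on the vertices $(i_1+a_1-a_2,\dots,i_n+a_n-a_{n+1},\,t+a_{n+1})$ with $i\in Q(n)_0$, $a\in C(i)$, and let $\Lambda(n+1)(t)$ be its algebra with the restricted relations $\{e_y r e_x : r\in\bar\rho,\ x,y\in Q(n+1)(t)_0\}$.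 **Translation and almost Koszul algebras.** Let $Q$ be finite. $\Lambda=\bigoplus_l\Lambda_l$ is *almost Koszul of type $(p,q)$*, $q\in\mathbb N\cup\{\infty\}$, if $\Lambda_l=0$ for $l>p$ and, in a minimal graded projective resolution $\cdots\to P^1\xrightarrow{f_1} P^0\xrightarrow{f_0} S\to0$ of each simple module $S=\Lambda_0e_i$, $P^t$ is generated in degree $t$ for all $t\le q$, and (if $q<\infty$) $\ker f_q$ is concentrated in degree $p+q$ (it may be $0$). $(Q,\rho)$ is an *$N$-translation quiver* if there are $\mathcal P,\mathcal I\subseteq Q_0$ and a bijection $\tau:Q_0\setminus\mathcal P\to Q_0\setminus\mathcal I$ such that: every maximal bound path has length $N+1$ and goes from $\tau i$ to $i$ for some $i\notin\mathcal P$; any two bound paths of length $N+1$ from $\tau i$ to $i$ are linearly dependent in $\Lambda$; for $i\notin\mathcal P$, $t\le N+1$ and every $0\ne u\in e_i\Lambda_te_j$ there is a path $q$ of length $N+1-t$ from $\tau i$ to $j$ with $uq\ne0$; and for $i\notin\mathcal I$, $t\le N+1$ and every $0\neq u\in e_j\Lambda_te_i$ there is a path $q$ of length $N+1-t$ from $j$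 to $\tau^{-1}i$ with $qu\ne0$. $\Lambda$ is an *$N$-translation algebra* if $(Q,\rho)$ is an $N$-translation quiver and $\Lambda$ is almost Koszul of type $(N+1,q)$ for some $q\in\mathbb N\cup\{\infty\}$. **Theorem.** (a) For every $t\in\mathbb Z$ the algebra $\Lambda(n+1)(t)$ is isomorphic to $\Lambda(n+1)$, by an isomorphism that is the translation $j\mapsto j-(t-1)e_{n+1}$ on idempotents and arrows; in particular $\Lambda(n+1)(1)=\Lambda(n+1)$. (b) For every $t\in\mathbb Z$ let $I(t)$ be the ideal of $\overline\Lambda(n)$ generated by the idempotents $e_j$, $j\in\overline Q(n)_0\setminus Q(n+1)(t)_0$. Then $\Lambda(n+1)\cong\overline\Lambda(n)/I(t)$, by an isomorphism sending $e_{(i,v)}$ and $\gamma^s_{(i,v)}$ to the classes of $e_i\,p_{v+t-1}$ and $\gamma^s_i\,p_{v+t-1}$. (c) $\Lambda(n+1)$ is an $n$-translation algebra, and it is almost Koszul of type $(n+1,m-1)$. -/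

import Mathlib

universe u

set_option linter.unusedSectionVars false

namespace CubicPyramid

noncomputable section

/-! ### Ideals and quotients of (not necessarily unital) associative algebras -/

section IdealQuotient

variable (k : Type u) [Field k] {A : Type u} [NonUnitalRing A] [Module k A]
  [IsScalarTower k A A] [SMulCommClass k A A]

/-- The two-sided ideal generated by a subset `S` of a `k`-algebra `A`: the smallest `k`-subspace
that contains `S` and is stable under left and right multiplication. -/
def idealSpan (S : Set A) : Submodule k A :=
  sInf {J : Submodule k A | S ⊆ J ∧ ∀ a, ∀ x ∈ J, a * x ∈ J ∧ x * a ∈ J}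

variable {k}

theorem subset_idealSpan (S : Set A) : S ⊆ idealSpan k S := by
  intro x hx
  simp only [idealSpan, SetLike.mem_coe, Submodule.mem_sInf]
  exact fun J hJ => hJ.1 hx

theorem idealSpan_le {S : Set A} {J : Submodule k A} (h : S ⊆ J)
    (hJ : ∀ a, ∀ x ∈ J, a * x ∈ J ∧ x * a ∈ J) : idealSpan k S ≤ J :=
  sInf_le ⟨h, hJ⟩

theorem idealSpan_mul_left {S : Set A} (a : A) {x : A} (hx : x ∈ idealSpan k S) :
    a * x ∈ idealSpan k S := by
  simp only [idealSpan, Submodule.mem_sInf] at hx ⊢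
  exact fun J hJ => (hJ.2 a x (hx J hJ)).1

theorem idealSpan_mul_right {S : Set A} (a : A) {x : A} (hx : x ∈ idealSpan k S) :
    x * a ∈ idealSpan k S := by
  simp only [idealSpan, Submodule.mem_sInf] at hx ⊢
  exact fun J hJ => (hJ.2 a x (hx J hJ)).2

variable (k)

/-- The quotient of the `k`-algebra `A` by the two-sided ideal generated by `S`. -/
def IdealQuot (S : Set A) : Type u := A ⧸ idealSpan k S

instance (S : Set A) : AddCommGroup (IdealQuot k S) :=
  inferInstanceAs (AddCommGroup (A ⧸ idealSpan k S))

instance (S : Set A) : Module k (IdealQuot k S) :=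
  inferInstanceAs (Module k (A ⧸ idealSpan k S))

/-- The quotient map `A → A/(S)`. -/
def IdealQuot.mk (S : Set A) : A →ₗ[k] IdealQuot k S := (idealSpan k S).mkQ

theorem IdealQuot.mk_surjective (S : Set A) : Function.Surjective (IdealQuot.mk k S) :=
  Submodule.mkQ_surjective _

/-- Multiplication of `A/(S)`, induced by that of `A`. -/
def IdealQuot.mulHom (S : Set A) : IdealQuot k S →ₗ[k] IdealQuot k S →ₗ[k] IdealQuot k S :=
  (idealSpan k S).liftQ
    { toFun := fun a => (idealSpan k S).mapQ (idealSpan k S) (LinearMap.mulLeft k a)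
        (fun _ hx => idealSpan_mul_left a hx)
      map_add' := by
        intro a b
        refine Submodule.linearMap_qext _ (LinearMap.ext fun x => ?_)
        exact congrArg (idealSpan k S).mkQ (add_mul a b x)
      map_smul' := by
        intro c a
        refine Submodule.linearMap_qext _ (LinearMap.ext fun x => ?_)
        exact congrArg (idealSpan k S).mkQ (smul_mul_assoc c a x) }
    (by
      intro a ha
      refine LinearMap.mem_ker.2 (Submodule.linearMap_qext _ (LinearMap.ext fun x => ?_))
      exact (Submodule.Quotient.mk_eq_zero _).2 (idealSpan_mul_right x ha))

instance (S : Set A) : Mul (IdealQuot k S) := ⟨fun x y => IdealQuot.mulHom k S x y⟩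

theorem IdealQuot.mk_mul (S : Set A) (a b : A) :
    IdealQuot.mk k S (a * b) = IdealQuot.mk k S a * IdealQuot.mk k S b := rfl

instance (S : Set A) : NonUnitalRing (IdealQuot k S) :=
  { (inferInstance : AddCommGroup (IdealQuot k S)),
    (inferInstance : Mul (IdealQuot k S)) with
    left_distrib := fun a b c => map_add (IdealQuot.mulHom k S a) b c
    right_distrib := fun a b c => by
      change IdealQuot.mulHom k S (a + b) c = _
      rw [map_add]; rfl
    zero_mul := fun a => by
      change IdealQuot.mulHom k S 0 a = _
      rw [map_zero]; rfl
    mul_zero := fun a => map_zero (IdealQuot.mulHom k S a)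
    mul_assoc := fun a b c => by
      obtain ⟨a, rfl⟩ := IdealQuot.mk_surjective k S a
      obtain ⟨b, rfl⟩ := IdealQuot.mk_surjective k S b
      obtain ⟨c, rfl⟩ := IdealQuot.mk_surjective k S c
      simp only [← IdealQuot.mk_mul, mul_assoc] }

instance (S : Set A) : IsScalarTower k (IdealQuot k S) (IdealQuot k S) :=
  ⟨fun c x y => by
    change IdealQuot.mulHom k S (c • x) y = c • IdealQuot.mulHom k S x y
    rw [map_smul]; rfl⟩

instance (S : Set A) : SMulCommClass k (IdealQuot k S) (IdealQuot k S) :=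
  ⟨fun c x y => (map_smul (IdealQuot.mulHom k S x) c y).symm⟩

end IdealQuotient

/-! ### Path algebras of quivers -/

section PathAlgebra

variable (k : Type u) [Field k] (V : Type) [Quiver.{0} V]

/-- All paths of a quiver: triples (start, end, path). -/
abbrev TotalPath : Type := Σ a b : V, Quiver.Path a b

/-- The path algebra `kQ`: the `k`-vector space on the paths of the quiver. -/
def PathAlg : Type u := TotalPath V →₀ k

instance : AddCommGroup (PathAlg k V) := inferInstanceAs (AddCommGroup (TotalPath V →₀ k))
instance : Module k (PathAlg k V) := inferInstanceAs (Module k (TotalPath V →₀ k))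

variable {V}

/-- The element of `kQ` given by a path. -/
def ofPath {a b : V} (p : Quiver.Path a b) : PathAlg k V :=
  (Finsupp.single (⟨a, b, p⟩ : TotalPath V) (1 : k) : TotalPath V →₀ k)

open Classical in
/-- The product `x * y` of two paths in `kQ`: first `y`, then `x`, if `y` ends where `x` starts,
and zero otherwise. -/
def pathMul (x y : TotalPath V) : TotalPath V →₀ k :=
  if h : y.2.1 = x.1 then
    Finsupp.single ⟨y.1, x.2.1, Quiver.Path.comp (y.2.2.cast rfl h) x.2.2⟩ 1
  else 0

/-- The bilinear extension of the product of paths. -/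
def pathMulHom : (TotalPath V →₀ k) →ₗ[k] (TotalPath V →₀ k) →ₗ[k] (TotalPath V →₀ k) :=
  Finsupp.linearCombination k (fun x : TotalPath V =>
    Finsupp.linearCombination k (fun y : TotalPath V => pathMul k x y))

theorem pathMulHom_single (x y : TotalPath V) :
    pathMulHom k (Finsupp.single x 1) (Finsupp.single y 1) = pathMul k x y := by
  simp [pathMulHom]

/-- The multiplication of `kQ` as a bilinear map. -/
def mulHom : PathAlg k V →ₗ[k] PathAlg k V →ₗ[k] PathAlg k V := pathMulHom k

instance : Mul (PathAlg k V) := ⟨fun x y => mulHom k x y⟩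

theorem ofPath_mul_ofPath {a b c : V} (p : Quiver.Path a b) (q : Quiver.Path b c) :
    ofPath k q * ofPath k p = ofPath k (p.comp q) := by
  refine (pathMulHom_single k _ _).trans ?_
  simp [ofPath, pathMul]

theorem ofPath_mul_ofPath_of_ne {a b c d : V} (p : Quiver.Path a b) (q : Quiver.Path c d)
    (h : b ≠ c) : ofPath k q * ofPath k p = 0 := by
  refine (pathMulHom_single k _ _).trans ?_
  simp only [pathMul, dif_neg h]
  rfl

theorem pathAlg_induction {C : PathAlg k V → Prop} (x : PathAlg k V) (zero : C 0)
    (add : ∀ x y, C x → C y → C (x + y)) (smul : ∀ (c : k) x, C x → C (c • x))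
    (path : ∀ (a b : V) (p : Quiver.Path a b), C (ofPath k p)) : C x := by
  induction x using Finsupp.induction_linear with
  | zero => exact zero
  | add f g hf hg => exact add f g hf hg
  | single p c =>
    obtain ⟨a, b, p⟩ := p
    have := smul c _ (path a b p)
    have e : c • ofPath k p = (Finsupp.single (⟨a, b, p⟩ : TotalPath V) c : TotalPath V →₀ k) := by
      change c • (Finsupp.single (⟨a, b, p⟩ : TotalPath V) (1 : k)) = _
      simp
    rwa [e] at this

instance : NonUnitalNonAssocRing (PathAlg k V) :=
  { (inferInstance : AddCommGroup (PathAlg k V)),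
    (inferInstance : Mul (PathAlg k V)) with
    left_distrib := fun a b c => map_add (mulHom k a) b c
    right_distrib := fun a b c => by
      change mulHom k (a + b) c = _
      rw [map_add]; rfl
    zero_mul := fun a => by
      change mulHom k 0 a = _
      rw [map_zero]; rfl
    mul_zero := fun a => map_zero (mulHom k a) }

instance : IsScalarTower k (PathAlg k V) (PathAlg k V) :=
  ⟨fun c x y => by
    change mulHom k (c • x) y = c • mulHom k x y
    rw [map_smul]; rfl⟩

instance : SMulCommClass k (PathAlg k V) (PathAlg k V) :=
  ⟨fun c x y => (map_smul (mulHom k x) c y).symm⟩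

theorem pathAlg_mul_assoc (x y z : PathAlg k V) : x * y * z = x * (y * z) := by
  induction x using pathAlg_induction with
  | zero => simp
  | add x x' h h' => simp only [add_mul, h, h']
  | smul c x h => simp only [smul_mul_assoc, h]
  | path a b p =>
    induction y using pathAlg_induction with
    | zero => simp
    | add x x' h h' => simp only [add_mul, mul_add, h, h']
    | smul c x h => simp only [smul_mul_assoc, mul_smul_comm, h]
    | path a' b' q =>
      induction z using pathAlg_induction with
      | zero => simp
      | add x x' h h' => simp only [mul_add, h, h']
      | smul c x h => simp only [mul_smul_comm, h]
      | path a'' b'' r =>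
        by_cases h1 : b' = a
        · subst h1
          by_cases h2 : b'' = a'
          · subst h2
            simp only [ofPath_mul_ofPath, Quiver.Path.comp_assoc]
          · rw [ofPath_mul_ofPath, ofPath_mul_ofPath_of_ne k _ _ h2,
              ofPath_mul_ofPath_of_ne k _ _ h2, mul_zero]
        · rw [ofPath_mul_ofPath_of_ne k _ _ h1, zero_mul]
          by_cases h2 : b'' = a'
          · subst h2
            rw [ofPath_mul_ofPath, ofPath_mul_ofPath_of_ne k _ _ h1]
          · rw [ofPath_mul_ofPath_of_ne k _ _ h2, mul_zero]

instance : NonUnitalRing (PathAlg k V) :=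
  { (inferInstance : NonUnitalNonAssocRing (PathAlg k V)) with
    mul_assoc := pathAlg_mul_assoc k }

/-- The idempotent (trivial path) at a vertex. -/
def idem (a : V) : PathAlg k V := ofPath k (Quiver.Path.nil : Quiver.Path a a)

theorem idem_mul_ofPath {a b : V} (p : Quiver.Path a b) : idem k b * ofPath k p = ofPath k p := by
  rw [idem, ofPath_mul_ofPath, Quiver.Path.comp_nil]

theorem ofPath_mul_idem {a b : V} (p : Quiver.Path a b) : ofPath k p * idem k a = ofPath k p := by
  rw [idem, ofPath_mul_ofPath, Quiver.Path.nil_comp]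

variable {k}

/-- The algebra `kQ/(ρ)` of the bound quiver `(Q, ρ)`. -/
abbrev BoundAlg (ρ : Set (PathAlg k V)) : Type u := IdealQuot k ρ

/-- The image of a path in `kQ/(ρ)`. -/
def pathClass (ρ : Set (PathAlg k V)) {a b : V} (p : Quiver.Path a b) : BoundAlg ρ :=
  IdealQuot.mk k ρ (ofPath k p)

/-- A bound path: a path with nonzero image in `kQ/(ρ)`. -/
def IsBoundPath (ρ : Set (PathAlg k V)) {a b : V} (p : Quiver.Path a b) : Prop :=
  pathClass ρ p ≠ 0

/-- `Λ_l`, the part of degree `l` of `Λ = kQ/(ρ)`. -/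
def degreePart (ρ : Set (PathAlg k V)) (l : ℕ) : Submodule k (BoundAlg ρ) :=
  Submodule.span k {x | ∃ (a b : V) (p : Quiver.Path a b), p.length = l ∧ x = pathClass ρ p}

/-- `e_b Λ_l e_a`, spanned by the paths of length `l` from `a` to `b`. -/
def homPart (ρ : Set (PathAlg k V)) (a b : V) (l : ℕ) : Submodule k (BoundAlg ρ) :=
  Submodule.span k {x | ∃ p : Quiver.Path a b, p.length = l ∧ x = pathClass ρ p}

section Unital

variable [Finite V] (ρ : Set (PathAlg k V))

/-- For a quiver with finitely many vertices, `1 = ∑ e_i`. -/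
instance : One (BoundAlg ρ) :=
  ⟨let _ := Fintype.ofFinite V; IdealQuot.mk k ρ (∑ a : V, idem k a)⟩

theorem sum_idem_mul [Fintype V] (x : PathAlg k V) : (∑ a : V, idem k a) * x = x := by
  induction x using pathAlg_induction with
  | zero => simp
  | add x x' h h' => simp only [mul_add, h, h']
  | smul c x h => simp only [mul_smul_comm, h]
  | path a b p =>
    rw [Finset.sum_mul, Finset.sum_eq_single b, idem_mul_ofPath]
    · intro c _ hc
      exact ofPath_mul_ofPath_of_ne k _ _ (Ne.symm hc)
    · simp

theorem mul_sum_idem [Fintype V] (x : PathAlg k V) : x * (∑ a : V, idem k a) = x := by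
  induction x using pathAlg_induction with
  | zero => simp
  | add x x' h h' => simp only [add_mul, h, h']
  | smul c x h => simp only [smul_mul_assoc, h]
  | path a b p =>
    rw [Finset.mul_sum, Finset.sum_eq_single a, ofPath_mul_idem]
    · intro c _ hc
      exact ofPath_mul_ofPath_of_ne k _ _ hc
    · simp

instance : Ring (BoundAlg ρ) :=
  { (inferInstance : NonUnitalRing (BoundAlg ρ)), (inferInstance : One (BoundAlg ρ)) with
    one_mul := fun x => by
      obtain ⟨x, rfl⟩ := IdealQuot.mk_surjective k ρ x
      let _ := Fintype.ofFinite V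
      change IdealQuot.mk k ρ (∑ a : V, idem k a) * _ = _
      rw [← IdealQuot.mk_mul, sum_idem_mul]
    mul_one := fun x => by
      obtain ⟨x, rfl⟩ := IdealQuot.mk_surjective k ρ x
      let _ := Fintype.ofFinite V
      change _ * IdealQuot.mk k ρ (∑ a : V, idem k a) = _
      rw [← IdealQuot.mk_mul, mul_sum_idem] }

end Unital

end PathAlgebra

/-! ### `n`-translation quivers, almost Koszul algebras, `n`-translation algebras -/

section Translation

variable {k : Type u} [Field k] {V : Type} [Quiver.{0} V]

/-- A bound path is maximal if no longer path containing it is bound. -/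
def IsMaximalBoundPath (ρ : Set (PathAlg k V)) {a b : V} (p : Quiver.Path a b) : Prop :=
  IsBoundPath ρ p ∧ ∀ (a' b' : V) (q : Quiver.Path a' a) (r : Quiver.Path b b'),
    IsBoundPath ρ ((q.comp p).comp r) → q.length = 0 ∧ r.length = 0

/-- `(Q, ρ)` is an `n`-translation quiver with `n`-translation `τ : Q₀ \ 𝒫 → Q₀ \ ℐ`, where
`𝒫 = Pr` is the set of projective vertices and `ℐ = In` the set of injective vertices. -/
structure IsTranslationQuiver (n : ℕ) (ρ : Set (PathAlg k V)) (Pr In : Set V)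
    (τ : {a : V // a ∉ Pr} ≃ {a : V // a ∉ In}) : Prop where
  maximal : ∀ (a b : V) (p : Quiver.Path a b), IsMaximalBoundPath ρ p →
    p.length = n + 1 ∧ ∃ i : {a : V // a ∉ Pr}, a = τ i ∧ b = i
  dependent : ∀ (i : {a : V // a ∉ Pr}) (p q : Quiver.Path (τ i : V) (i : V)),
    IsBoundPath ρ p → IsBoundPath ρ q → p.length = n + 1 → q.length = n + 1 →
    ¬ LinearIndependent k ![pathClass ρ p, pathClass ρ q]
  extend_start : ∀ (i : {a : V // a ∉ Pr}) (j : V) (t : ℕ), t ≤ n + 1 →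
    ∀ x ∈ homPart ρ j (i : V) t, x ≠ 0 →
    ∃ q : Quiver.Path (τ i : V) j, q.length = n + 1 - t ∧ x * pathClass ρ q ≠ 0
  extend_end : ∀ (i : {a : V // a ∉ In}) (j : V) (t : ℕ), t ≤ n + 1 →
    ∀ x ∈ homPart ρ (i : V) j t, x ≠ 0 →
    ∃ p : Quiver.Path j (τ.symm i : V), p.length = n + 1 - t ∧ pathClass ρ p * x ≠ 0

variable [Finite V] (ρ : Set (PathAlg k V))

/-- The left ideal generated by the `e_b`, `b ≠ a`, and by `Λ_l`, `l ≥ 1`. -/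
def simpleKer (a : V) : Submodule (BoundAlg ρ) (BoundAlg ρ) :=
  Submodule.span (BoundAlg ρ)
    ({x | ∃ b : V, b ≠ a ∧ x = pathClass ρ (Quiver.Path.nil : Quiver.Path b b)} ∪
      {x | ∃ l : ℕ, 1 ≤ l ∧ x ∈ degreePart ρ l})

/-- The simple left module `S(a) = Λ_0 e_a`. -/
abbrev SimpleMod (a : V) : Type u := BoundAlg ρ ⧸ simpleKer ρ a

/-- The submodule `Λ_{≥ 1} M` of a `Λ`-module `M`. -/
def radSubmodule (M : Type u) [AddCommGroup M] [Module (BoundAlg ρ) M] :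
    Submodule (BoundAlg ρ) M :=
  Submodule.span (BoundAlg ρ)
    {z | ∃ (l : ℕ) (x : BoundAlg ρ) (y : M), 1 ≤ l ∧ x ∈ degreePart ρ l ∧ z = x • y}

/-- A minimal graded projective resolution
`⋯ → P 2 → P 1 → P 0 → S(a) → 0` of the simple module `S(a)`, placed in degree `0`. -/
structure MinimalResolution (a : V) where
  P : ℕ → Type u
  [grp : ∀ t, AddCommGroup (P t)]
  [mod : ∀ t, Module (BoundAlg ρ) (P t)]
  projective : ∀ t, Module.Projective (BoundAlg ρ) (P t)
  /-- `deg t l` is the part of degree `l` of `P t`. -/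
  deg : ∀ t, ℕ → AddSubgroup (P t)
  isInternal : ∀ t, DirectSum.IsInternal (deg t)
  smul_mem : ∀ (t l l' : ℕ) (x : BoundAlg ρ) (y : P t),
    x ∈ degreePart ρ l → y ∈ deg t l' → x • y ∈ deg t (l + l')
  aug : P 0 →ₗ[BoundAlg ρ] SimpleMod ρ a
  d : ∀ t, P (t + 1) →ₗ[BoundAlg ρ] P t
  aug_deg : ∀ l, 1 ≤ l → ∀ y ∈ deg 0 l, aug y = 0
  d_deg : ∀ t l, ∀ y ∈ deg (t + 1) l, d t y ∈ deg t l
  aug_surjective : Function.Surjective aug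
  exact_zero : LinearMap.range (d 0) = LinearMap.ker aug
  exact_succ : ∀ t, LinearMap.range (d (t + 1)) = LinearMap.ker (d t)
  minimal_zero : LinearMap.ker aug ≤ radSubmodule ρ (P 0)
  minimal_succ : ∀ t, LinearMap.ker (d t) ≤ radSubmodule ρ (P (t + 1))

attribute [instance] MinimalResolution.grp MinimalResolution.mod

variable {ρ}

/-- The kernel of `f_t`, where `f_0 : P 0 → S(a)` and `f_t : P t → P (t - 1)` for `t ≥ 1`. -/
def MinimalResolution.syz {a : V} (R : MinimalResolution ρ a) :
    ∀ t, Submodule (BoundAlg ρ) (R.P t)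
  | 0 => LinearMap.ker R.aug
  | t + 1 => LinearMap.ker (R.d t)

variable (ρ)

/-- `Λ = kQ/(ρ)` is `(p, q)`-Koszul (almost Koszul of type `(p, q)`), `q ∈ ℕ ∪ {∞}`. As a minimal
graded projective resolution exists and is unique up to isomorphism, "some" and "every" minimal
resolution mean the same here. -/
def IsAlmostKoszul (p : ℕ) (q : ℕ∞) : Prop :=
  (∀ l, p < l → degreePart ρ l = ⊥) ∧
  ∀ a : V, ∃ R : MinimalResolution ρ a,
    (∀ t : ℕ, (t : ℕ∞) ≤ q →
      Submodule.span (BoundAlg ρ) (R.deg t t : Set (R.P t)) = ⊤) ∧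
    (∀ t : ℕ, (t : ℕ∞) = q → ∀ x ∈ R.syz t, x ∈ R.deg t (p + t))

/-- `Λ = kQ/(ρ)` is an `n`-translation algebra. -/
def IsTranslationAlgebra (n : ℕ) : Prop :=
  (∃ (Pr In : Set V) (τ : {a : V // a ∉ Pr} ≃ {a : V // a ∉ In}),
    IsTranslationQuiver n ρ Pr In τ) ∧
  ∃ q : ℕ∞, IsAlmostKoszul ρ (n + 1) q

end Translation

/-! ### The smash product `A # ℤ*` -/

section Smash

variable {k : Type u} [Field k] {A : Type u} [NonUnitalRing A] [Module k A]
  [IsScalarTower k A A] [SMulCommClass k A A]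

/-- The smash product `A # ℤ*` of a `ℤ`-graded algebra: as a vector space it is the direct sum of
copies `A p_v` of `A`, `v ∈ ℤ`. -/
def Smash (_𝒜 : ℤ → Submodule k A) : Type u := ℤ →₀ A

variable (𝒜 : ℤ → Submodule k A)

instance : AddCommGroup (Smash 𝒜) := inferInstanceAs (AddCommGroup (ℤ →₀ A))
instance : Module k (Smash 𝒜) := inferInstanceAs (Module k (ℤ →₀ A))

/-- The element `a p_v` of `A # ℤ*`. -/
def Smash.of (v : ℤ) : A →ₗ[k] Smash 𝒜 := (Finsupp.lsingle v : A →ₗ[k] (ℤ →₀ A))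

variable [DirectSum.Decomposition 𝒜]

/-- The homogeneous component of degree `v`. -/
def component (v : ℤ) : A →ₗ[k] A where
  toFun a := (DirectSum.decompose 𝒜 a v : A)
  map_add' := by simp [DirectSum.decompose_add]
  map_smul' := fun c a => by
    rw [DirectSum.decompose_smul]; rfl

/-- The multiplication `(a p_u) (b p_v) = a b_{u - v} p_v` of `A # ℤ*`, as a bilinear map. -/
def smashMulHom : (ℤ →₀ A) →ₗ[k] (ℤ →₀ A) →ₗ[k] (ℤ →₀ A) :=
  Finsupp.lsum k (fun u : ℤ => LinearMap.flip
    (Finsupp.lsum k (fun v : ℤ => LinearMap.flip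
      (LinearMap.compr₂ ((LinearMap.mul k A).compl₂ (component 𝒜 (u - v)))
        (Finsupp.lsingle v : A →ₗ[k] (ℤ →₀ A))))))

theorem smashMulHom_single (u v : ℤ) (a b : A) :
    smashMulHom 𝒜 (Finsupp.single u a) (Finsupp.single v b) =
      Finsupp.single v (a * component 𝒜 (u - v) b) := by
  unfold smashMulHom
  rw [Finsupp.lsum_single, LinearMap.flip_apply, Finsupp.lsum_single, LinearMap.flip_apply]
  rfl

/-- The multiplication of `A # ℤ*`. -/
def Smash.mulHom : Smash 𝒜 →ₗ[k] Smash 𝒜 →ₗ[k] Smash 𝒜 := smashMulHom 𝒜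

instance : Mul (Smash 𝒜) := ⟨fun x y => Smash.mulHom 𝒜 x y⟩

theorem Smash.of_mul_of (u v : ℤ) (a b : A) :
    Smash.of 𝒜 u a * Smash.of 𝒜 v b = Smash.of 𝒜 v (a * component 𝒜 (u - v) b) :=
  smashMulHom_single 𝒜 u v a b

theorem component_mul_component [SetLike.GradedMul 𝒜] (u v : ℤ) (a b : A) :
    component 𝒜 u (a * component 𝒜 v b) = component 𝒜 (u - v) a * component 𝒜 v b := by
  have hb : component 𝒜 v b ∈ 𝒜 v := (DirectSum.decompose 𝒜 b v).2
  generalize component 𝒜 v b = c at hb ⊢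
  induction a using DirectSum.Decomposition.inductionOn 𝒜 with
  | zero => simp
  | add x y hx hy => simp only [add_mul, map_add, hx, hy]
  | homogeneous x =>
    rename_i w
    have hm : (x : A) * c ∈ 𝒜 (w + v) := SetLike.GradedMul.mul_mem x.2 hb
    by_cases h : w = u - v
    · subst h
      have h' : u - v + v = u := by ring
      rw [h'] at hm
      simp only [component, LinearMap.coe_mk, AddHom.coe_mk]
      rw [DirectSum.decompose_of_mem_same 𝒜 hm, DirectSum.decompose_of_mem_same 𝒜 x.2]
    · have h' : w + v ≠ u := fun e => h (by rw [← e]; ring)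
      simp only [component, LinearMap.coe_mk, AddHom.coe_mk]
      rw [DirectSum.decompose_of_mem_ne 𝒜 hm h', DirectSum.decompose_of_mem_ne 𝒜 x.2 h, zero_mul]

theorem Smash.induction {C : Smash 𝒜 → Prop} (x : Smash 𝒜) (zero : C 0)
    (add : ∀ x y, C x → C y → C (x + y)) (of : ∀ v a, C (Smash.of 𝒜 v a)) : C x := by
  induction x using Finsupp.induction_linear with
  | zero => exact zero
  | add f g hf hg => exact add f g hf hg
  | single v a => exact of v a

instance : NonUnitalNonAssocRing (Smash 𝒜) :=
  { (inferInstance : AddCommGroup (Smash 𝒜)),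
    (inferInstance : Mul (Smash 𝒜)) with
    left_distrib := fun a b c => map_add (Smash.mulHom 𝒜 a) b c
    right_distrib := fun a b c => by
      change Smash.mulHom 𝒜 (a + b) c = _
      rw [map_add]; rfl
    zero_mul := fun a => by
      change Smash.mulHom 𝒜 0 a = _
      rw [map_zero]; rfl
    mul_zero := fun a => map_zero (Smash.mulHom 𝒜 a) }

instance [SetLike.GradedMul 𝒜] : NonUnitalRing (Smash 𝒜) :=
  { (inferInstance : NonUnitalNonAssocRing (Smash 𝒜)) with
    mul_assoc := fun x y z => by
      induction x using Smash.induction with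
      | zero => simp
      | add x x' h h' => simp only [add_mul, h, h']
      | of u a =>
        induction y using Smash.induction with
        | zero => simp
        | add x x' h h' => simp only [add_mul, mul_add, h, h']
        | of v b =>
          induction z using Smash.induction with
          | zero => simp
          | add x x' h h' => simp only [mul_add, h, h']
          | of w c =>
            simp only [Smash.of_mul_of, component_mul_component, mul_assoc]
            rw [show u - w - (v - w) = u - v by ring] }

instance : IsScalarTower k (Smash 𝒜) (Smash 𝒜) :=
  ⟨fun c x y => by
    change Smash.mulHom 𝒜 (c • x) y = c • Smash.mulHom 𝒜 x y
    rw [map_smul]; rfl⟩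

instance : SMulCommClass k (Smash 𝒜) (Smash 𝒜) :=
  ⟨fun c x y => (map_smul (Smash.mulHom 𝒜 x) c y).symm⟩

end Smash

/-! ### Gradings of bound quiver algebras by weights of arrows -/

section WeightGrading

variable {k : Type u} [Field k] {V : Type} [Quiver.{0} V] (w : ∀ a b : V, (a ⟶ b) → ℤ)

/-- The sum of the weights of the arrows of a path. -/
def pathWeight {a b : V} (p : Quiver.Path a b) : ℤ := p.addWeight (fun {a b} e => w a b e)

theorem pathWeight_comp {a b c : V} (p : Quiver.Path a b) (q : Quiver.Path b c) :
    pathWeight w (p.comp q) = pathWeight w p + pathWeight w q :=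
  Quiver.Path.addWeight_comp _ p q

/-- The linear map on `kQ` with given values on the paths. -/
def pathLift {M : Type u} [AddCommGroup M] [Module k M] (f : TotalPath V → M) :
    PathAlg k V →ₗ[k] M :=
  (Finsupp.linearCombination k f : (TotalPath V →₀ k) →ₗ[k] M)

theorem pathLift_ofPath {M : Type u} [AddCommGroup M] [Module k M] (f : TotalPath V → M)
    {a b : V} (p : Quiver.Path a b) : pathLift f (ofPath k p) = f ⟨a, b, p⟩ :=
  (Finsupp.linearCombination_single k _ _).trans (one_smul k _)

/-- For a weight function `w` on the arrows, the span of the paths of weight `d` in `kQ/(ρ)`. -/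
def weightPart (ρ : Set (PathAlg k V)) (d : ℤ) : Submodule k (BoundAlg ρ) :=
  Submodule.span k
    {x | ∃ (a b : V) (p : Quiver.Path a b), pathWeight w p = d ∧ x = pathClass ρ p}

/-- The relations in `ρ` are homogeneous for the weight `w`. -/
def IsHomogeneousRel (ρ : Set (PathAlg k V)) : Prop :=
  ∀ r ∈ ρ, ∃ d : ℤ, r ∈ Submodule.span k
    {x : PathAlg k V | ∃ (a b : V) (p : Quiver.Path a b), pathWeight w p = d ∧ x = ofPath k p}

variable (k) in
/-- The projection of `kQ` onto the span of the paths of weight `d`. -/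
def freeProj (d : ℤ) : PathAlg k V →ₗ[k] PathAlg k V :=
  pathLift (fun x : TotalPath V => if pathWeight w x.2.2 = d then ofPath k x.2.2 else 0)

theorem freeProj_ofPath (d : ℤ) {a b : V} (p : Quiver.Path a b) :
    freeProj k w d (ofPath k p) = if pathWeight w p = d then ofPath k p else 0 :=
  pathLift_ofPath _ p

theorem freeProj_mul (d : ℤ) {a b : V} (p : Quiver.Path a b) (x : PathAlg k V) :
    freeProj k w d (ofPath k p * x) = ofPath k p * freeProj k w (d - pathWeight w p) x := by
  induction x using pathAlg_induction with
  | zero => simp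
  | add x y hx hy => simp only [mul_add, map_add, hx, hy]
  | smul c x h => simp only [mul_smul_comm, map_smul, h]
  | path a' b' q =>
    by_cases h : b' = a
    · subst h
      rw [ofPath_mul_ofPath, freeProj_ofPath, freeProj_ofPath, pathWeight_comp]
      by_cases e : pathWeight w q + pathWeight w p = d
      · rw [if_pos e, if_pos (by rw [← e]; ring), ofPath_mul_ofPath]
      · rw [if_neg e, if_neg (fun e' => e (by rw [e']; ring)), mul_zero]
    · rw [ofPath_mul_ofPath_of_ne k _ _ h, freeProj_ofPath, map_zero]
      split_ifs
      · rw [ofPath_mul_ofPath_of_ne k _ _ h]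
      · rw [mul_zero]

theorem freeProj_mul' (d : ℤ) {a b : V} (p : Quiver.Path a b) (x : PathAlg k V) :
    freeProj k w d (x * ofPath k p) = freeProj k w (d - pathWeight w p) x * ofPath k p := by
  induction x using pathAlg_induction with
  | zero => simp
  | add x y hx hy => simp only [add_mul, map_add, hx, hy]
  | smul c x h => simp only [smul_mul_assoc, map_smul, h]
  | path a' b' q =>
    by_cases h : b = a'
    · subst h
      rw [ofPath_mul_ofPath, freeProj_ofPath, freeProj_ofPath, pathWeight_comp]
      by_cases e : pathWeight w p + pathWeight w q = d
      · rw [if_pos e, if_pos (by rw [← e]; ring), ofPath_mul_ofPath]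
      · rw [if_neg e, if_neg (fun e' => e (by rw [e']; ring)), zero_mul]
    · rw [ofPath_mul_ofPath_of_ne k _ _ h, freeProj_ofPath, map_zero]
      split_ifs
      · rw [ofPath_mul_ofPath_of_ne k _ _ h]
      · rw [zero_mul]

variable {w}

theorem freeProj_mem {ρ : Set (PathAlg k V)} (hρ : IsHomogeneousRel w ρ) (d : ℤ)
    {x : PathAlg k V} (hx : x ∈ idealSpan k ρ) : freeProj k w d x ∈ idealSpan k ρ := by
  have key : idealSpan k ρ ≤ ⨅ d, (idealSpan k ρ).comap (freeProj k w d) := by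
    refine idealSpan_le ?_ ?_
    · intro r hr
      simp only [SetLike.mem_coe, Submodule.mem_iInf, Submodule.mem_comap]
      intro d
      obtain ⟨d', hd'⟩ := hρ r hr
      have e : freeProj k w d r = if d' = d then r else 0 := by
        refine Submodule.span_induction (p := fun r _ => freeProj k w d r = if d' = d then r else 0)
          ?_ ?_ ?_ ?_ hd'
        · rintro _ ⟨a, b, p, rfl, rfl⟩
          exact freeProj_ofPath w d p
        · simp
        · intro x y _ _ hx hy
          rw [map_add, hx, hy]; split_ifs <;> simp
        · intro c x _ hx
          rw [map_smul, hx]; split_ifs <;> simp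
      rw [e]
      split_ifs
      · exact subset_idealSpan ρ hr
      · exact Submodule.zero_mem _
    · intro a x hx
      simp only [Submodule.mem_iInf, Submodule.mem_comap] at hx ⊢
      rw [← forall_and]
      intro d
      induction a using pathAlg_induction with
      | zero => simp
      | add a b ha hb =>
        simp only [add_mul, mul_add, map_add]
        exact ⟨Submodule.add_mem _ ha.1 hb.1, Submodule.add_mem _ ha.2 hb.2⟩
      | smul c a h =>
        simp only [smul_mul_assoc, mul_smul_comm, map_smul]
        exact ⟨Submodule.smul_mem _ _ h.1, Submodule.smul_mem _ _ h.2⟩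
      | path a b p =>
        rw [freeProj_mul, freeProj_mul']
        exact ⟨idealSpan_mul_left _ (hx _), idealSpan_mul_right _ (hx _)⟩
  have := key hx
  simp only [Submodule.mem_iInf, Submodule.mem_comap] at this
  exact this d

variable (w)

/-- The map sending a path to its class, placed in the weight of the path. -/
def freeDecompose (ρ : Set (PathAlg k V)) :
    PathAlg k V →ₗ[k] DirectSum ℤ (fun d => weightPart w ρ d) :=
  pathLift (fun x : TotalPath V =>
    DirectSum.lof k ℤ (fun d => weightPart w ρ d) (pathWeight w x.2.2)
      ⟨pathClass ρ x.2.2, Submodule.subset_span ⟨_, _, _, rfl, rfl⟩⟩)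

theorem freeDecompose_ofPath (ρ : Set (PathAlg k V)) {a b : V} (p : Quiver.Path a b) :
    freeDecompose w ρ (ofPath k p) =
      DirectSum.lof k ℤ (fun d => weightPart w ρ d) (pathWeight w p)
        ⟨pathClass ρ p, Submodule.subset_span ⟨_, _, _, rfl, rfl⟩⟩ :=
  pathLift_ofPath _ p

theorem freeDecompose_apply (ρ : Set (PathAlg k V)) (x : PathAlg k V) (d : ℤ) :
    ((freeDecompose w ρ x) d : BoundAlg ρ) = IdealQuot.mk k ρ (freeProj k w d x) := by
  induction x using pathAlg_induction with
  | zero => simp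
  | add x y hx hy => rw [map_add, map_add, map_add, ← hx, ← hy]; rfl
  | smul c x h => rw [map_smul, map_smul, map_smul, ← h]; rfl
  | path a b p =>
    rw [freeDecompose_ofPath, freeProj_ofPath]
    split_ifs with h
    · subst h
      rw [DirectSum.lof_apply]; rfl
    · rw [DirectSum.lof_eq_of, DirectSum.of_eq_of_ne _ _ _ (Ne.symm h), map_zero]; rfl

variable {w}

/-- The decomposition of `kQ/(ρ)` into its parts of given weight, if `ρ` is homogeneous. -/
def weightDecompose {ρ : Set (PathAlg k V)} (hρ : IsHomogeneousRel w ρ) :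
    BoundAlg ρ →ₗ[k] DirectSum ℤ (fun d => weightPart w ρ d) :=
  (idealSpan k ρ).liftQ (freeDecompose w ρ) (by
    intro x hx
    rw [LinearMap.mem_ker]
    refine DFinsupp.ext fun d => Subtype.ext ?_
    rw [freeDecompose_apply]
    exact (Submodule.Quotient.mk_eq_zero _).2 (freeProj_mem hρ d hx))

theorem weightDecompose_pathClass {ρ : Set (PathAlg k V)} (hρ : IsHomogeneousRel w ρ)
    {a b : V} (p : Quiver.Path a b) :
    weightDecompose hρ (pathClass ρ p) =
      DirectSum.lof k ℤ (fun d => weightPart w ρ d) (pathWeight w p)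
        ⟨pathClass ρ p, Submodule.subset_span ⟨_, _, _, rfl, rfl⟩⟩ :=
  freeDecompose_ofPath w ρ p

/-- `kQ/(ρ)` is the direct sum of its parts of given weight, if `ρ` is homogeneous. -/
abbrev weightDecomposition {ρ : Set (PathAlg k V)} (hρ : IsHomogeneousRel w ρ) :
    DirectSum.Decomposition (weightPart w ρ) :=
  DirectSum.Decomposition.ofLinearMap (weightPart w ρ) (weightDecompose hρ)
    (by
      refine LinearMap.ext fun x => ?_
      obtain ⟨x, rfl⟩ := IdealQuot.mk_surjective k ρ x
      induction x using pathAlg_induction with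
      | zero => simp
      | add x y hx hy => simp only [map_add, hx, hy]
      | smul c x h => simp only [map_smul, h]
      | path a b p =>
        rw [LinearMap.comp_apply]
        erw [weightDecompose_pathClass hρ p]
        rw [DirectSum.coeLinearMap_lof]; rfl)
    (by
      refine DirectSum.linearMap_ext _ fun d => LinearMap.ext ?_
      rintro ⟨x, hx⟩
      simp only [LinearMap.comp_apply, DirectSum.coeLinearMap_lof, LinearMap.id_apply]
      refine Submodule.span_induction (p := fun x hx => weightDecompose hρ x =
        DirectSum.lof k ℤ (fun d => weightPart w ρ d) d ⟨x, hx⟩) ?_ ?_ ?_ ?_ hx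
      · rintro _ ⟨a, b, p, rfl, rfl⟩
        exact weightDecompose_pathClass hρ p
      · rw [map_zero]; exact (map_zero _).symm
      · intro x y hx hy ex ey
        rw [map_add, ex, ey, ← map_add]; rfl
      · intro c x hx ex
        rw [map_smul, ex, ← map_smul]; rfl)

instance weightPart_gradedMul (ρ : Set (PathAlg k V)) : SetLike.GradedMul (weightPart w ρ) where
  mul_mem := by
    intro d d' x y hx hy
    refine Submodule.span_induction (p := fun x _ => x * y ∈ weightPart w ρ (d + d'))
      ?_ ?_ ?_ ?_ hx
    · rintro _ ⟨a, b, p, rfl, rfl⟩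
      refine Submodule.span_induction (p := fun y _ => pathClass ρ p * y ∈
        weightPart w ρ (pathWeight w p + d')) ?_ ?_ ?_ ?_ hy
      · rintro _ ⟨a', b', q, rfl, rfl⟩
        by_cases h : b' = a
        · subst h
          refine Submodule.subset_span ⟨_, _, q.comp p, ?_, ?_⟩
          · rw [pathWeight_comp, add_comm]
          · rw [pathClass, pathClass, ← IdealQuot.mk_mul, ofPath_mul_ofPath]; rfl
        · rw [pathClass, pathClass, ← IdealQuot.mk_mul, ofPath_mul_ofPath_of_ne k _ _ h, map_zero]
          exact Submodule.zero_mem _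
      · rw [mul_zero]; exact Submodule.zero_mem _
      · intro x y _ _ hx hy
        rw [mul_add]; exact Submodule.add_mem _ hx hy
      · intro c x _ hx
        rw [mul_smul_comm]; exact Submodule.smul_mem _ _ hx
    · rw [zero_mul]; exact Submodule.zero_mem _
    · intro x y _ _ hx hy
      rw [add_mul]; exact Submodule.add_mem _ hx hy
    · intro c x _ hx
      rw [smul_mul_assoc]; exact Submodule.smul_mem _ _ hx

end WeightGrading

/-! ### Pyramid shaped cubic quivers

All quivers below have as vertices a set `X` of integral vectors `i = (i_1, …, i_p)`, and an arrow of
type `t` from `i` to `i - e_{t-1} + e_t` (with `e_0 = e_{p+1} = 0`) whenever both vectors are in `X`.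
In the code coordinates and types are counted from `0`: the coordinates are indexed by `Fin p`, the
types by `Fin N` with `N = p` or `N = p + 1`. -/

section Cubic

variable {k : Type u} [Field k] {p : ℕ}

/-- The vector `e_t - e_{t-1}` in `ℤ^p` by which an arrow of type `t` moves (`0`-based); for `t = p`
this is `- e_{p-1}`. -/
def step (p t : ℕ) : Fin p → ℤ :=
  fun s => (if (s : ℕ) = t then 1 else 0) - (if (s : ℕ) + 1 = t then 1 else 0)

/-- The vertices of the quiver with vertex set `X` and arrows of `N` types. -/
structure Vert (N : ℕ) (X : Set (Fin p → ℤ)) : Type where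
  val : Fin p → ℤ
  mem : val ∈ X

instance (N : ℕ) (X : Set (Fin p → ℤ)) : Quiver.{0} (Vert N X) :=
  ⟨fun i j => {t : Fin N // j.val = i.val + step p t}⟩

/-- The arrow of type `t` from `i` to `i + step p t`. -/
def stepArrow {N : ℕ} {X : Set (Fin p → ℤ)} (t : Fin N) (i : Fin p → ℤ) (h : i ∈ X)
    (h' : i + step p t ∈ X) : (⟨i, h⟩ : Vert N X) ⟶ ⟨i + step p t, h'⟩ :=
  ⟨t, rfl⟩

open Classical in
/-- The idempotent `e_i`, read as `0` if `i` is not a vertex. -/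
def idemAt (N : ℕ) (X : Set (Fin p → ℤ)) (i : Fin p → ℤ) : PathAlg k (Vert N X) :=
  if h : i ∈ X then idem k (⟨i, h⟩ : Vert N X) else 0

open Classical in
/-- The arrow of type `t` starting at `i`, read as `0` if there is no such arrow. -/
def arrowAt (N : ℕ) (X : Set (Fin p → ℤ)) (t : Fin N) (i : Fin p → ℤ) : PathAlg k (Vert N X) :=
  if h : i ∈ X ∧ i + step p t ∈ X then
    ofPath k (stepArrow t i h.1 h.2).toPath
  else 0

/-- All corners of the cube at `i` spanned by the types in `T` are vertices. -/
def CubeIn {N : ℕ} (X : Set (Fin p → ℤ)) (T : Finset (Fin N)) (i : Fin p → ℤ) : Prop :=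
  ∀ S ⊆ T, i + ∑ u ∈ S, step p u ∈ X

/-- The relations: with `γ t i` the arrow of type `t` starting at `i`,
`d s t i • γ t (i(s)) γ s i = γ s (i(t)) γ t i` for `t < s` whenever `i, i(t), i(s), i(t)(s)` are
vertices, and `γ t (i(t)) γ t i = 0`. -/
def cubicRel (N : ℕ) (X : Set (Fin p → ℤ)) (d : Fin N → Fin N → (Fin p → ℤ) → k) :
    Set (PathAlg k (Vert N X)) :=
  {r | ∃ (s t : Fin N) (i : Fin p → ℤ), t < s ∧ CubeIn X {s, t} i ∧
    r = d s t i • (arrowAt N X t (i + step p s) * arrowAt N X s i) -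
      arrowAt N X s (i + step p t) * arrowAt N X t i} ∪
  {r | ∃ (t : Fin N) (i : Fin p → ℤ), i ∈ X ∧ i + step p t ∈ X ∧ i + step p t + step p t ∈ X ∧
    r = arrowAt N X t (i + step p t) * arrowAt N X t i}

/-- The twisting scalars `d s t i` (`t < s`) are nonzero on every square, and for each type `r` the
maps `γ t i ↦ d r t i • γ t (i(r))` (`t < r`) carry the commutation relations between two types
`t < s < r` to commutation relations, wherever both squares are joined by arrows of type `r`. -/
structure IsTwist {N : ℕ} (X : Set (Fin p → ℤ)) (d : Fin N → Fin N → (Fin p → ℤ) → k) : Prop where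
  ne_zero : ∀ (s t : Fin N) (i : Fin p → ℤ), t < s → CubeIn X {s, t} i → d s t i ≠ 0
  compatible : ∀ (r s t : Fin N) (i : Fin p → ℤ), t < s → s < r → CubeIn X {r, s, t} i →
    d r s (i + step p t) * d r t i * d s t (i + step p r) =
      d s t i * d r t (i + step p s) * d r s i

/-- The vertex set of the `n`-cubic pyramid quiver `Q(n)` of height `m`:
`1 ≤ i_t` and `i_1 + ⋯ + i_s ≤ m + s - 1`. -/
def pyramid (n m : ℕ) : Set (Fin n → ℤ) :=
  {i | (∀ t, 1 ≤ i t) ∧ ∀ s : Fin n, ∑ t ∈ Finset.Iic s, i t ≤ (m : ℤ) + (s : ℕ)}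

theorem pyramid_finite (n m : ℕ) : (pyramid n m).Finite := by
  refine (Set.finite_Icc (fun _ => (1 : ℤ)) (fun s : Fin n => (m : ℤ) + (s : ℕ))).subset ?_
  rintro i ⟨h1, h2⟩
  refine ⟨h1, fun s => (Finset.single_le_sum (f := i) (fun t _ => ?_) ?_).trans (h2 s)⟩
  · have := h1 t
    omega
  · simp

instance (N n m : ℕ) : Finite (Vert N (pyramid n m)) := 
  have := (pyramid_finite n m).to_subtype
  Finite.of_injective (fun v : Vert N (pyramid n m) => (⟨v.val, v.mem⟩ : pyramid n m)) (by
    rintro ⟨a, _⟩ ⟨b, _⟩ h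
    simpa using h)

/-- The relations of the `n`-cubic pyramid algebra. -/
def pyramidRel (n m : ℕ) (d : Fin n → Fin n → (Fin n → ℤ) → k) :
    Set (PathAlg k (Vert n (pyramid n m))) := cubicRel n (pyramid n m) d

/-- The `n`-cubic pyramid algebra `Λ(n)` of height `m` with twisting scalars `d`. -/
abbrev PyramidAlg (n m : ℕ) (d : Fin n → Fin n → (Fin n → ℤ) → k) : Type u :=
  BoundAlg (pyramidRel n m d)

variable (n m : ℕ) (d : Fin (n + 1) → Fin (n + 1) → (Fin n → ℤ) → k) (t : ℤ)

/-- The relations of `Λ̃(n)`, on the stable quiver `Q̃(n)` obtained from `Q(n)` by adding the arrows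
`i → i - e_n` of type `n + 1`. -/
def stableRel : Set (PathAlg k (Vert (n + 1) (pyramid n m))) := cubicRel (n + 1) (pyramid n m) d

/-- The stable `n`-cubic pyramid algebra `Λ̃(n)`, the twisted trivial extension of `Λ(n)`. -/
abbrev StableAlg : Type u := BoundAlg (stableRel n m d)

/-- The weight of an arrow of the stable quiver: `1` for type `n + 1` and `0` for the arrows of
`Q(n)`. -/
def lastWeight (a b : Vert (n + 1) (pyramid n m)) (e : a ⟶ b) : ℤ :=
  if e.1 = Fin.last n then 1 else 0

theorem arrowAt_mul_mem (t s : Fin (n + 1)) (i j : Fin n → ℤ) :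
    (arrowAt (n + 1) (pyramid n m) s j * arrowAt (n + 1) (pyramid n m) t i :
      PathAlg k (Vert (n + 1) (pyramid n m))) ∈ Submodule.span k
    {x | ∃ (a b : Vert (n + 1) (pyramid n m)) (p : Quiver.Path a b),
      pathWeight (lastWeight n m) p =
        (if t = Fin.last n then 1 else 0) + (if s = Fin.last n then 1 else 0) ∧
      x = ofPath k p} := by
  unfold arrowAt
  by_cases h1 : j ∈ pyramid n m ∧ j + step n s ∈ pyramid n m
  swap
  · simp [dif_neg h1]
  by_cases h2 : i ∈ pyramid n m ∧ i + step n t ∈ pyramid n m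
  swap
  · simp [dif_neg h2]
  rw [dif_pos h1, dif_pos h2]
  by_cases e : i + step n t = j
  · subst e
    rw [ofPath_mul_ofPath]
    refine Submodule.subset_span ⟨_, _, _, ?_, rfl⟩
    rw [pathWeight_comp]
    simp [pathWeight, lastWeight, stepArrow, Quiver.Hom.toPath]
  · rw [ofPath_mul_ofPath_of_ne]
    · exact Submodule.zero_mem _
    · exact fun h => e (congrArg Vert.val h)

theorem stableRel_homogeneous : IsHomogeneousRel (lastWeight n m) (stableRel n m d) := by
  rintro r (⟨s, t, i, _, _, rfl⟩ | ⟨t, i, _, _, _, rfl⟩)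
  · refine ⟨_, Submodule.sub_mem _ (Submodule.smul_mem _ _ (arrowAt_mul_mem n m s t _ _)) ?_⟩
    have := arrowAt_mul_mem (k := k) n m t s i (i + step n t)
    rwa [add_comm (if t = Fin.last n then (1 : ℤ) else 0)] at this
  · exact ⟨_, arrowAt_mul_mem n m t t _ _⟩

/-- The `ℤ`-grading of `Λ̃(n)` with `Q(n)` in degree `0` and the arrows of type `n + 1` in degree
`1`. -/
def stableGrading (v : ℤ) : Submodule k (StableAlg n m d) :=
  weightPart (lastWeight n m) (stableRel n m d) v

instance : DirectSum.Decomposition (stableGrading n m d) :=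
  weightDecomposition (stableRel_homogeneous n m d)

instance : SetLike.GradedMul (stableGrading n m d) :=
  weightPart_gradedMul (w := lastWeight n m) (stableRel n m d)

/-- `Λ̄(n) = Λ̃(n) # ℤ*`. -/
abbrev SmashAlg : Type u := Smash (stableGrading n m d)

/-- The vertex set `Q̄(n)_0 = Q(n)_0 × ℤ`. -/
def stack : Set (Fin (n + 1) → ℤ) := {i | Fin.init i ∈ pyramid n m}

variable {n} in
/-- The scalars `d` of `Λ̃(n)`, viewed on vectors with `n + 1` coordinates. -/
def liftScalars : Fin (n + 1) → Fin (n + 1) → (Fin (n + 1) → ℤ) → k :=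
  fun s t i => d s t (Fin.init i)

/-- The relations of `Λ̄(n)` on the quiver `Q̄(n)`. -/
def stackRel : Set (PathAlg k (Vert (n + 1) (stack n m))) :=
  cubicRel (n + 1) (stack n m) (liftScalars d)

variable {n} in
/-- The side lengths `b_1 = m + n - 1 - |i|` and `b_t = i_{t-1} - 1` (`2 ≤ t ≤ n + 1`). -/
def sides (i : Fin n → ℤ) : Fin (n + 1) → ℤ :=
  Fin.cons ((m : ℤ) + n - 1 - ∑ t, i t) (fun t => i t - 1)

variable {n} in
/-- The integral points of the `(n+1)`-cuboid associated to `i`. -/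
def cuboid (i : Fin n → ℤ) : Set (Fin (n + 1) → ℤ) :=
  {a | ∀ t, 0 ≤ a t ∧ a t ≤ sides m i t}

variable {n} in
/-- `(i_1 + a_1 - a_2, …, i_n + a_n - a_{n+1}, i_{n+1} + a_{n+1})`. -/
def move (i a : Fin (n + 1) → ℤ) : Fin (n + 1) → ℤ :=
  fun s => i s + a s - (if h : (s : ℕ) + 1 < n + 1 then a ⟨s + 1, h⟩ else 0)

/-- The vertex set of the `(n+1)`-cuboid completion `Q(n+1)(t)` of `Q(n) × {t}`. -/
def completion : Set (Fin (n + 1) → ℤ) :=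
  {j | ∃ i : Fin (n + 1) → ℤ, Fin.init i ∈ pyramid n m ∧ i (Fin.last n) = t ∧
    ∃ a ∈ cuboid m (Fin.init i), j = move i a}

theorem sum_Iic_telescope {n : ℕ} (i : Fin n → ℤ) (a : Fin (n + 1) → ℤ) (s : Fin n) :
    ∑ u ∈ Finset.Iic s, (i u + a u.castSucc - a u.succ) =
      ∑ u ∈ Finset.Iic s, i u + a 0 - a s.succ := by
  obtain ⟨s, hs⟩ := s
  induction s with
  | zero =>
    have e : Finset.Iic (⟨0, hs⟩ : Fin n) = {⟨0, hs⟩} := by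
      ext x; simp [Fin.ext_iff, Fin.le_def]
    rw [e]; simp
  | succ s ih =>
    have hs' : s < n := by omega
    have e : Finset.Iic (⟨s + 1, hs⟩ : Fin n) =
        insert ⟨s + 1, hs⟩ (Finset.Iic (⟨s, hs'⟩ : Fin n)) := by
      ext x; simp [Fin.ext_iff, Fin.le_def]; omega
    have hn : (⟨s + 1, hs⟩ : Fin n) ∉ Finset.Iic (⟨s, hs'⟩ : Fin n) := by
      simp
    rw [e, Finset.sum_insert hn, Finset.sum_insert hn, ih hs']
    have e2 : (⟨s + 1, hs⟩ : Fin n).castSucc = (⟨s, hs'⟩ : Fin n).succ := rfl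
    rw [e2]
    ring

theorem completion_subset_stack : completion n m t ⊆ stack n m := by
  rintro _ ⟨i, ⟨h1, h2⟩, _, a, ha, rfl⟩
  have key : ∀ u : Fin n, Fin.init (move i a) u = Fin.init i u + a u.castSucc - a u.succ := by
    intro u
    simp only [Fin.init, move, Fin.val_castSucc]
    rw [dif_pos (by omega)]
    rfl
  have hb : ∀ u : Fin n, a u.succ ≤ Fin.init i u - 1 := fun u => by
    have := (ha u.succ).2
    rwa [sides, Fin.cons_succ] at this
  refine ⟨fun u => ?_, fun s => ?_⟩
  · rw [key]
    have := (ha u.castSucc).1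
    have := hb u
    omega
  · rw [Finset.sum_congr rfl (fun u _ => key u), sum_Iic_telescope]
    have h0 : a 0 ≤ (m : ℤ) + n - 1 - ∑ u, Fin.init i u := (ha 0).2
    have hs : ((Finset.univ \ Finset.Iic s).card : ℤ) ≤
        ∑ u ∈ Finset.univ \ Finset.Iic s, Fin.init i u := by
      have := Finset.card_nsmul_le_sum (Finset.univ \ Finset.Iic s) (Fin.init i) 1
        (fun u _ => h1 u)
      simpa using this
    have hsum := Finset.sum_sdiff (f := Fin.init i) (Finset.subset_univ (Finset.Iic s))
    have hc : (Finset.univ \ Finset.Iic s).card = n - (s + 1) := by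
      rw [Finset.card_sdiff_of_subset (Finset.subset_univ _)]
      simp
    rw [hc] at hs
    have hsn := s.2
    have := (ha s.succ).1
    push_cast [Nat.cast_sub (show (s : ℕ) + 1 ≤ n by omega)] at hs
    omega

/-- The inclusion of a full subquiver. -/
def fullInclusion {N : ℕ} {X Y : Set (Fin p → ℤ)} (h : X ⊆ Y) : Vert N X ⥤q Vert N Y where
  obj i := ⟨i.val, h i.mem⟩
  map e := ⟨e.1, e.2⟩

/-- The embedding of path algebras induced by the inclusion of a full subquiver. -/
def pathInclusion {N : ℕ} {X Y : Set (Fin p → ℤ)} (h : X ⊆ Y) :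
    PathAlg k (Vert N X) →ₗ[k] PathAlg k (Vert N Y) :=
  pathLift (fun x => ofPath k ((fullInclusion h).mapPath x.2.2))

/-- The restriction `ρ[Q'] = {e_b r e_a | r ∈ ρ, a, b ∈ Q'_0}` of a relation set to a full
subquiver, as a set of elements of the path algebra of the subquiver. -/
def restrictRel {N : ℕ} {X Y : Set (Fin p → ℤ)} (h : X ⊆ Y) (ρ : Set (PathAlg k (Vert N Y))) :
    Set (PathAlg k (Vert N X)) :=
  {x | ∃ r ∈ ρ, ∃ a ∈ X, ∃ b ∈ X, pathInclusion h x = idemAt N Y b * r * idemAt N Y a}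

/-- The relations `ρ(n+1)(t)` of the `(n+1)`-cuboid truncation. -/
def truncRel : Set (PathAlg k (Vert (n + 1) (completion n m t))) :=
  restrictRel (completion_subset_stack n m t) (stackRel n m d)

/-- The `(n+1)`-cuboid truncation `Λ(n+1)(t)` of `Λ̄(n)`. -/
abbrev TruncAlg : Type u := BoundAlg (truncRel n m d t)

/-- The idempotents of `Λ̄(n)` at the vertices in `Q̄(n)_0` outside `Q(n+1)(t)_0`. -/
def outsideIdempotents : Set (SmashAlg n m d) :=
  {x | ∃ i ∈ stack n m, i ∉ completion n m t ∧
    x = Smash.of (stableGrading n m d) (i (Fin.last n))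
      (IdealQuot.mk k (stableRel n m d) (idemAt (n + 1) (pyramid n m) (Fin.init i)))}

/-- The quotient of `Λ̄(n)` by the ideal `I(t)` generated by the idempotents outside
`Q(n+1)(t)`. -/
abbrev SmashQuot : Type u := IdealQuot k (outsideIdempotents n m d t)

/-- The algebra `Λ(n+1)`: the `(n+1)`-cubic pyramid algebra with the scalars of `Λ̃(n)`. -/
abbrev NextAlg : Type u := PyramidAlg (n + 1) m (liftScalars d)

/-- The translation by `c` in the last coordinate. -/
def shiftLast {n : ℕ} (c : ℤ) (i : Fin (n + 1) → ℤ) : Fin (n + 1) → ℤ :=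
  fun s => if s = Fin.last n then i s + c else i s

end Cubic

end

end CubicPyramid

namespace CubicPyramid

noncomputable section

/-! ### Homomorphisms out of bound quiver algebras -/

section Homs

variable {k : Type u} [Field k]

/-! Statements (a) and (b) are geometry of the stack. The cuboid completion at height `t` is the
slab `layer n m t`: the points of the stack with last coordinate at least `t` and coordinate sum at
most `m + n - 1 + t` (`completion_eq_layer`). The pyramid is the slab at height 1, translation in
the last coordinate permutes the slabs, and the lifted scalars do not depend on that coordinate.
Neither the last coordinate nor the coordinate sum decreases along an arrow, so slabs are convex
(`layer_convex`): a square of the stack with start and end in the slab lies in it. Hence restricting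
the relations to a slab gives the cubic relations of the slab (`idealSpan_restrictRel`), which is
(a). For (b), a path of the stable quiver has exactly one lift to the stack from each starting
height, and the lifts compose like the elements of the smash product. This gives homomorphisms out
of the smash product from values on the generators of the stack (`smashHom`). Sending the generators
outside the slab to zero respects the relations, again by convexity, and the two maps are inverse on
generators.

For (c), a vertex is described by the numbers `a t` of arrows of type `t` on a path to it from `(1,
…, 1)`. The vertices become the partitions with `n + 1` rows of length at most `m - 1`, and an arrow
of type `t` adds a box to row `t`. The cube condition on the scalars allows the arrows to be
rescaled so that all squares commute (`gauge_square`). Since partitions are closed under meets, a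
product of rescaled arrows then depends only on its two ends (`monomial_unique`), and it vanishes if
some row grows by two (`monomial_eq_zero`). A coefficient map that kills the relations shows that
nothing else vanishes (`freeCoef_eq_zero`). So there is a basis indexed by the pairs `(c, a)` for
which `c/a` is a vertical strip, and the product of composable basis elements is a basis element or
zero.

The translation removes a full column, and each vertical strip between suitable partitions extends
to a full column; this gives the translation quiver. The simple module at `o` is resolved by a
Koszul complex: its term at level `l` is the sum of the projectives at the partitions `v` for which
`v/o` is a horizontal strip with `l` boxes, that is, which interlace with `o` (`Box`). A contracting
homotopy looks at the first row in which `c` differs from `o` and moves the last box of that row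
from `c/a` to `a/o` (`homotopy_identity`). A horizontal strip has at most `m - 1` boxes
(`Box.sum_le`), so the resolution ends at level `m - 1` and the kernel there is zero, which is
almost Koszulity of type `(n + 1, m - 1)`. -/

theorem IdealQuot.mk_eq_zero {A : Type u} [NonUnitalRing A] [Module k A] [IsScalarTower k A A]
    [SMulCommClass k A A] (S : Set A) {x : A} : IdealQuot.mk k S x = 0 ↔ x ∈ idealSpan k S :=
  Submodule.Quotient.mk_eq_zero _

theorem IdealQuot.mk_of_mem {A : Type u} [NonUnitalRing A] [Module k A] [IsScalarTower k A A]
    [SMulCommClass k A A] {S : Set A} {x : A} (hx : x ∈ S) : IdealQuot.mk k S x = 0 :=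
  (IdealQuot.mk_eq_zero S).2 (subset_idealSpan S hx)

/-- The homomorphism induced on a quotient by a homomorphism that kills the generators of the
ideal. -/
def IdealQuot.lift {A B : Type u} [NonUnitalRing A] [Module k A] [IsScalarTower k A A]
    [SMulCommClass k A A] [NonUnitalRing B] [Module k B] [IsScalarTower k B B]
    [SMulCommClass k B B] (S : Set A) (f : A →ₙₐ[k] B) (hf : ∀ x ∈ S, f x = 0) :
    IdealQuot k S →ₙₐ[k] B :=
  let g : IdealQuot k S →ₗ[k] B := (idealSpan k S).liftQ (f : A →ₗ[k] B) (by
    refine idealSpan_le (fun x hx => hf x hx) fun a x hx => ?_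
    have hx' : f x = 0 := hx
    exact ⟨show f (a * x) = 0 by rw [map_mul, hx', mul_zero],
      show f (x * a) = 0 by rw [map_mul, hx', zero_mul]⟩)
  { g with
    map_zero' := map_zero g
    map_mul' := fun x y => by
      obtain ⟨x, rfl⟩ := IdealQuot.mk_surjective k S x
      obtain ⟨y, rfl⟩ := IdealQuot.mk_surjective k S y
      exact map_mul f x y }

theorem IdealQuot.lift_mk {A B : Type u} [NonUnitalRing A] [Module k A] [IsScalarTower k A A]
    [SMulCommClass k A A] [NonUnitalRing B] [Module k B] [IsScalarTower k B B]
    [SMulCommClass k B B] (S : Set A) (f : A →ₙₐ[k] B) (hf : ∀ x ∈ S, f x = 0) (x : A) :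
    IdealQuot.lift S f hf (IdealQuot.mk k S x) = f x := rfl

variable {V : Type} [Quiver.{0} V] {A : Type u} [NonUnitalRing A]

/-- The value of a path, if values are given for the vertices and the arrows. -/
def pathVal (E : V → A) (F : ∀ {a b : V}, (a ⟶ b) → A) {a : V} : ∀ {b : V}, Quiver.Path a b → A
  | _, Quiver.Path.nil => E a
  | _, Quiver.Path.cons p e => F e * pathVal E F p

/-- Values `E` of the vertices and `F` of the arrows that define an algebra homomorphism. -/
structure IsQuiverRep (E : V → A) (F : ∀ {a b : V}, (a ⟶ b) → A) : Prop where
  idem : ∀ a, E a * E a = E a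
  orth : ∀ a b, a ≠ b → E a * E b = 0
  left : ∀ {a b : V} (e : a ⟶ b), E b * F e = F e
  right : ∀ {a b : V} (e : a ⟶ b), F e * E a = F e

namespace IsQuiverRep

variable {E : V → A} {F : ∀ {a b : V}, (a ⟶ b) → A}

theorem idem_mul_pathVal (h : IsQuiverRep E F) {a b : V} (p : Quiver.Path a b) :
    E b * pathVal E F p = pathVal E F p := by
  cases p with
  | nil => exact h.idem a
  | cons p e => rw [pathVal, ← mul_assoc, h.left]

theorem pathVal_mul_idem (h : IsQuiverRep E F) {a b : V} (p : Quiver.Path a b) :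
    pathVal E F p * E a = pathVal E F p := by
  induction p with
  | nil => exact h.idem a
  | cons p e ih => rw [pathVal, mul_assoc, ih]

theorem pathVal_comp (h : IsQuiverRep E F) {a b c : V} (p : Quiver.Path a b)
    (q : Quiver.Path b c) : pathVal E F (p.comp q) = pathVal E F q * pathVal E F p := by
  induction q with
  | nil => rw [Quiver.Path.comp_nil, pathVal, h.idem_mul_pathVal]
  | cons q e ih => rw [Quiver.Path.comp_cons, pathVal, pathVal, ih, mul_assoc]

theorem pathVal_mul_of_ne (h : IsQuiverRep E F) {a b c d : V} (p : Quiver.Path a b)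
    (q : Quiver.Path c d) (hbc : b ≠ c) : pathVal E F q * pathVal E F p = 0 := by
  rw [← h.pathVal_mul_idem q, ← h.idem_mul_pathVal p, mul_assoc, ← mul_assoc (E c),
    h.orth c b hbc.symm, zero_mul, mul_zero]

variable [Module k A] [IsScalarTower k A A] [SMulCommClass k A A]

variable (k) in
/-- The homomorphism from the path algebra with given values of the vertices and the arrows. -/
def freeHom (h : IsQuiverRep E F) : PathAlg k V →ₙₐ[k] A :=
  let g : PathAlg k V →ₗ[k] A := pathLift (fun x : TotalPath V => pathVal E F x.2.2)
  { g with
    map_zero' := map_zero g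
    map_mul' := fun x y => by
      change g (x * y) = g x * g y
      induction x using pathAlg_induction with
      | zero => simp
      | add x x' hx hx' => simp only [add_mul, map_add, hx, hx']
      | smul c x hx => simp only [smul_mul_assoc, map_smul, hx]
      | path a b p =>
        induction y using pathAlg_induction with
        | zero => simp
        | add x x' hx hx' => simp only [mul_add, map_add, hx, hx']
        | smul c x hx => simp only [mul_smul_comm, map_smul, hx]
        | path a' b' q =>
          by_cases e : b' = a
          · subst e
            rw [ofPath_mul_ofPath, pathLift_ofPath, pathLift_ofPath, pathLift_ofPath]
            exact h.pathVal_comp q p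
          · rw [ofPath_mul_ofPath_of_ne k _ _ e, map_zero, pathLift_ofPath, pathLift_ofPath]
            exact (h.pathVal_mul_of_ne q p e).symm }

theorem freeHom_ofPath (h : IsQuiverRep E F) {a b : V} (p : Quiver.Path a b) :
    h.freeHom k (ofPath k p) = pathVal E F p :=
  pathLift_ofPath _ p

end IsQuiverRep

/-- A homomorphism on the path algebra is determined by the values of the trivial paths and the
arrows. -/
theorem ofPath_mem_of_generators {C : PathAlg k V → Prop} (idem : ∀ a : V, C (idem k a))
    (arrow : ∀ {a b : V} (e : a ⟶ b), C (ofPath k e.toPath))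
    (mul : ∀ x y, C x → C y → C (x * y)) {a b : V} (p : Quiver.Path a b) : C (ofPath k p) := by
  induction p with
  | nil => exact idem a
  | cons p e ih =>
    have : ofPath k (p.cons e) = ofPath k e.toPath * ofPath k p := by
      rw [ofPath_mul_ofPath]; rfl
    rw [this]
    exact mul _ _ (arrow e) ih

end Homs

/-! ### Idempotents and arrows of cubic quivers -/

section Generators

variable {k : Type u} [Field k] {p N : ℕ} {X : Set (Fin p → ℤ)}

theorem idemAt_of_mem (v : Vert N X) : idemAt N X v.val = idem k v := dif_pos v.mem

theorem idemAt_of_notMem {i : Fin p → ℤ} (h : i ∉ X) :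
    (idemAt N X i : PathAlg k (Vert N X)) = 0 := dif_neg h

/-- The target of an arrow is tied to its source by an equation of vectors; substituting that
equation first avoids all transport of paths. -/
theorem arrowAt_of_hom {v w : Vert N X} (e : v ⟶ w) :
    arrowAt N X e.1 v.val = ofPath k e.toPath := by
  obtain ⟨w, hw⟩ := w
  obtain ⟨t, ht⟩ := e
  dsimp only at ht
  subst ht
  exact dif_pos ⟨v.mem, hw⟩

theorem arrowAt_of_notMem {i : Fin p → ℤ} {t : Fin N} (h : ¬ (i ∈ X ∧ i + step p t ∈ X)) :
    (arrowAt N X t i : PathAlg k (Vert N X)) = 0 := dif_neg h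

theorem idemAt_mul_idemAt (i : Fin p → ℤ) :
    (idemAt N X i * idemAt N X i : PathAlg k (Vert N X)) = idemAt N X i := by
  by_cases h : i ∈ X
  · rw [idemAt, dif_pos h]; exact idem_mul_ofPath k _
  · rw [idemAt_of_notMem h, mul_zero]

theorem idemAt_mul_idemAt_of_ne {i j : Fin p → ℤ} (hij : i ≠ j) :
    (idemAt N X i * idemAt N X j : PathAlg k (Vert N X)) = 0 := by
  by_cases h : i ∈ X
  · by_cases h' : j ∈ X
    · rw [idemAt, idemAt, dif_pos h, dif_pos h']
      exact ofPath_mul_ofPath_of_ne k _ _ fun e => hij (congrArg Vert.val e).symm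
    · rw [idemAt_of_notMem h', mul_zero]
  · rw [idemAt_of_notMem h, zero_mul]

theorem idemAt_mul_arrowAt (t : Fin N) (i : Fin p → ℤ) :
    (idemAt N X (i + step p t) * arrowAt N X t i : PathAlg k (Vert N X)) = arrowAt N X t i := by
  by_cases h : i ∈ X ∧ i + step p t ∈ X
  · rw [idemAt, arrowAt, dif_pos h, dif_pos h.2]; exact idem_mul_ofPath k _
  · rw [arrowAt_of_notMem h, mul_zero]

theorem arrowAt_mul_idemAt (t : Fin N) (i : Fin p → ℤ) :
    (arrowAt N X t i * idemAt N X i : PathAlg k (Vert N X)) = arrowAt N X t i := by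
  by_cases h : i ∈ X ∧ i + step p t ∈ X
  · rw [idemAt, arrowAt, dif_pos h, dif_pos h.1]; exact ofPath_mul_idem k _
  · rw [arrowAt_of_notMem h, zero_mul]

/-- Two homomorphisms of the path algebra of a cubic quiver that agree on vertices and arrows. -/
theorem cubic_hom_ext {A : Type u} [NonUnitalRing A] [Module k A]
    {f g : PathAlg k (Vert N X) →ₙₐ[k] A} (hi : ∀ i ∈ X, f (idemAt N X i) = g (idemAt N X i))
    (ha : ∀ t : Fin N, ∀ i ∈ X, i + step p t ∈ X → f (arrowAt N X t i) = g (arrowAt N X t i)) :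
    f = g := by
  refine NonUnitalAlgHom.ext fun x => ?_
  induction x using pathAlg_induction with
  | zero => simp
  | add x y hx hy => rw [map_add, map_add, hx, hy]
  | smul c x hx => rw [map_smul, map_smul, hx]
  | path a b p =>
    refine ofPath_mem_of_generators (C := fun x => f x = g x) (fun a => ?_) (fun {a b} e => ?_)
      (fun x y hx hy => by rw [map_mul, map_mul, hx, hy]) p
    · rw [← idemAt_of_mem]; exact hi _ a.mem
    · rw [← arrowAt_of_hom]; exact ha _ _ a.mem (e.2 ▸ b.mem)

/-- Values of the vertices and arrows of a cubic quiver, depending on the vectors only. -/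
structure IsCubicRep {A : Type u} [NonUnitalRing A] (N : ℕ) (e : (Fin p → ℤ) → A)
    (f : Fin N → (Fin p → ℤ) → A) : Prop where
  idem : ∀ i, e i * e i = e i
  orth : ∀ i j, i ≠ j → e i * e j = 0
  left : ∀ (t : Fin N) (i), e (i + step p t) * f t i = f t i
  right : ∀ t i, f t i * e i = f t i

variable {A : Type u} [NonUnitalRing A] {e : (Fin p → ℤ) → A} {f : Fin N → (Fin p → ℤ) → A}

theorem IsCubicRep.isQuiverRep (h : IsCubicRep N e f) (X : Set (Fin p → ℤ)) :
    IsQuiverRep (V := Vert N X) (fun v => e v.val) (fun {v w} (a : v ⟶ w) => f a.1 v.val) where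
  idem v := h.idem _
  orth v w hvw := h.orth _ _ fun hh => hvw (by cases v; cases w; simpa using hh)
  left {v w} a := by
    have := h.left a.1 v.val
    rwa [← a.2] at this
  right a := h.right _ _

theorem isCubicRep_generators (N : ℕ) (X : Set (Fin p → ℤ)) :
    IsCubicRep N (idemAt N X : _ → PathAlg k (Vert N X)) (arrowAt N X) :=
  ⟨idemAt_mul_idemAt, fun _ _ => idemAt_mul_idemAt_of_ne, idemAt_mul_arrowAt, arrowAt_mul_idemAt⟩

theorem IsCubicRep.map {B : Type u} [NonUnitalRing B] {S : Type*} [FunLike S A B]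
    [MulHomClass S A B] (h : IsCubicRep N e f) (φ : S) (h0 : φ 0 = 0) :
    IsCubicRep N (fun i => φ (e i)) (fun t i => φ (f t i)) where
  idem i := by rw [← map_mul, h.idem]
  orth i j hij := by rw [← map_mul, h.orth i j hij, h0]
  left t i := by rw [← map_mul, h.left]
  right t i := by rw [← map_mul, h.right]

theorem IsCubicRep.translate (h : IsCubicRep N e f) (c : Fin p → ℤ) :
    IsCubicRep N (fun i => e (i + c)) (fun t i => f t (i + c)) where
  idem i := h.idem _
  orth i j hij := h.orth _ _ fun hh => hij (by simpa using hh)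
  left t i := by
    have := h.left t (i + c)
    rwa [show i + c + step p t = i + step p t + c by abel] at this
  right t i := h.right _ _

variable [Module k A] [IsScalarTower k A A] [SMulCommClass k A A]

variable (k) in
/-- The homomorphism from the path algebra of a cubic quiver with given values of the vertices and
the arrows. -/
def IsCubicRep.hom (h : IsCubicRep N e f) (X : Set (Fin p → ℤ)) :
    PathAlg k (Vert N X) →ₙₐ[k] A := (h.isQuiverRep X).freeHom k

theorem IsCubicRep.hom_idemAt (h : IsCubicRep N e f) {i : Fin p → ℤ} (hi : i ∈ X) :
    h.hom k X (idemAt N X i) = e i := by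
  rw [idemAt, dif_pos hi]
  exact (h.isQuiverRep X).freeHom_ofPath _

theorem IsCubicRep.hom_arrowAt (h : IsCubicRep N e f) {t : Fin N} {i : Fin p → ℤ} (hi : i ∈ X)
    (hi' : i + step p t ∈ X) : h.hom k X (arrowAt N X t i) = f t i := by
  rw [arrowAt, dif_pos ⟨hi, hi'⟩]
  -- An arrow is the trivial path followed by one step, so its value carries an extra idempotent
  -- factor on the right.
  exact ((h.isQuiverRep X).freeHom_ofPath _).trans (h.right _ _)

theorem cubeIn_pair_iff {s t : Fin N} (hst : t ≠ s) {i : Fin p → ℤ} :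
    CubeIn X {s, t} i ↔ i ∈ X ∧ i + step p s ∈ X ∧ i + step p t ∈ X ∧
      i + step p s + step p t ∈ X := by
  constructor
  · intro h
    refine ⟨?_, ?_, ?_, ?_⟩
    · simpa using h ∅ (by simp)
    · simpa using h {s} (by simp)
    · simpa using h {t} (by simp)
    · have := h {s, t} (by simp)
      rwa [Finset.sum_pair hst.symm, ← add_assoc] at this
  · rintro ⟨h0, h1, h2, h3⟩ S hS
    have : S = ∅ ∨ S = {s} ∨ S = {t} ∨ S = {s, t} := by
      by_cases hs : s ∈ S <;> by_cases ht : t ∈ S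
      · right; right; right
        exact Finset.Subset.antisymm hS (by simp [Finset.insert_subset_iff, hs, ht])
      · right; left
        ext x; constructor
        · intro hx
          have := hS hx
          simp only [Finset.mem_insert, Finset.mem_singleton] at this ⊢
          rcases this with rfl | rfl
          · rfl
          · exact absurd hx ht
        · simp only [Finset.mem_singleton]; rintro rfl; exact hs
      · right; right; left
        ext x; constructor
        · intro hx
          have := hS hx
          simp only [Finset.mem_insert, Finset.mem_singleton] at this ⊢
          rcases this with rfl | rfl
          · exact absurd hx hs
          · rfl
        · simp only [Finset.mem_singleton]; rintro rfl; exact ht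
      · left
        ext x; constructor
        · intro hx
          have := hS hx
          simp only [Finset.mem_insert, Finset.mem_singleton] at this
          rcases this with rfl | rfl
          · exact absurd hx hs
          · exact absurd hx ht
        · simp
    rcases this with rfl | rfl | rfl | rfl
    · simpa using h0
    · simpa using h1
    · simpa using h2
    · rwa [Finset.sum_pair hst.symm, ← add_assoc]

variable {d : Fin N → Fin N → (Fin p → ℤ) → k}

theorem cubicRel_comm {s t : Fin N} (hts : t < s) {i : Fin p → ℤ} (h : CubeIn X {s, t} i) :
    d s t i • (IdealQuot.mk k (cubicRel N X d) (arrowAt N X t (i + step p s)) *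
        IdealQuot.mk k (cubicRel N X d) (arrowAt N X s i)) =
      IdealQuot.mk k (cubicRel N X d) (arrowAt N X s (i + step p t)) *
        IdealQuot.mk k (cubicRel N X d) (arrowAt N X t i) := by
  rw [← sub_eq_zero, ← IdealQuot.mk_mul, ← IdealQuot.mk_mul, ← map_smul, ← map_sub]
  exact IdealQuot.mk_of_mem (Or.inl ⟨s, t, i, hts, h, rfl⟩)

/-- No membership hypotheses are needed: if one of the three vertices is missing, a factor is zero
by the default value of `arrowAt`. -/
theorem cubicRel_sq (t : Fin N) (i : Fin p → ℤ) :
    IdealQuot.mk k (cubicRel N X d) (arrowAt N X t (i + step p t)) *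
        IdealQuot.mk k (cubicRel N X d) (arrowAt N X t i) = 0 := by
  by_cases h : i ∈ X ∧ i + step p t ∈ X
  · by_cases h' : i + step p t + step p t ∈ X
    · rw [← IdealQuot.mk_mul]
      exact IdealQuot.mk_of_mem (Or.inr ⟨t, i, h.1, h.2, h', rfl⟩)
    · rw [arrowAt_of_notMem (i := i + step p t) (fun hh => h' hh.2), map_zero, zero_mul]
  · rw [arrowAt_of_notMem h, map_zero, mul_zero]

/-- A family of values kills the relations if it satisfies them. -/
theorem IsCubicRep.hom_cubicRel (h : IsCubicRep N e f)
    (comm : ∀ (s t : Fin N) (i), t < s → CubeIn X {s, t} i →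
      d s t i • (f t (i + step p s) * f s i) = f s (i + step p t) * f t i)
    (sq : ∀ (t : Fin N) (i), i ∈ X → i + step p t ∈ X → i + step p t + step p t ∈ X →
      f t (i + step p t) * f t i = 0) :
    ∀ r ∈ cubicRel N X d, h.hom k X r = 0 := by
  rintro r (⟨s, t, i, hts, hc, rfl⟩ | ⟨t, i, h0, h1, h2, rfl⟩)
  · obtain ⟨h0, h1, h2, h3⟩ := (cubeIn_pair_iff hts.ne).1 hc
    have h3' : i + step p t + step p s ∈ X := by rwa [add_right_comm]
    rw [map_sub, map_smul, map_mul, map_mul, h.hom_arrowAt h1 h3, h.hom_arrowAt h0 h1,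
      h.hom_arrowAt h2 h3', h.hom_arrowAt h0 h2, comm s t i hts hc, sub_self]
  · rw [map_mul, h.hom_arrowAt h1 h2, h.hom_arrowAt h0 h1, sq t i h0 h1 h2]

end Generators

/-! ### Geometry of the pyramids and their completions -/

section Geometry

/-- The sum is 1 for type 0, and for every other type the two entries cancel. So the coordinate sum
never decreases along an arrow, which is half of the convexity of slabs. -/
theorem sum_step_nonneg {N : ℕ} (t : Fin N) : 0 ≤ ∑ s, step N t s := by
  simp only [step, Finset.sum_sub_distrib, sub_nonneg]
  have h1 : ∑ s : Fin N, (if (s : ℕ) = t then (1 : ℤ) else 0) = 1 := by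
    rw [Finset.sum_eq_single t]
    · simp
    · intro b _ hb
      rw [if_neg fun h => hb (Fin.ext h)]
    · simp
  rw [h1]
  by_cases ht : (t : ℕ) = 0
  · rw [Finset.sum_eq_zero]
    · exact zero_le_one
    · intro s _
      rw [if_neg (by omega)]
  · have ht' : (t : ℕ) - 1 < N := by omega
    rw [Finset.sum_eq_single ⟨(t : ℕ) - 1, ht'⟩]
    · split_ifs <;> simp
    · intro b _ hb
      rw [if_neg fun h => hb (Fin.ext (by simp; omega))]
    · simp

/-- This is also the weight of the arrow in the grading of the stable algebra, so the last
coordinate in the stack keeps track of degrees in the smash product. -/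
theorem step_last {n : ℕ} (t : Fin (n + 1)) :
    step (n + 1) t (Fin.last n) = if t = Fin.last n then 1 else 0 := by
  have h : ¬ n + 1 = (t : ℕ) := by omega
  simp only [step, Fin.val_last, h, if_false, sub_zero, Fin.ext_iff, eq_comm]

theorem init_add_step {n : ℕ} (i : Fin (n + 1) → ℤ) (t : ℕ) :
    Fin.init (i + step (n + 1) t) = Fin.init i + step n t := rfl

/-- The coordinates after position `s` are all at least 1, so the bound on the total sum implies
every bound on a partial sum. -/
theorem mem_pyramid_succ {n m : ℕ} {x : Fin (n + 1) → ℤ} :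
    x ∈ pyramid (n + 1) m ↔ (∀ t, 1 ≤ x t) ∧ ∑ t, x t ≤ (m : ℤ) + n := by
  constructor
  · rintro ⟨h1, h2⟩
    refine ⟨h1, ?_⟩
    have := h2 (Fin.last n)
    rwa [show Finset.Iic (Fin.last n) = Finset.univ from by ext s; simp [Fin.le_last]] at this
  · rintro ⟨h1, h2⟩
    refine ⟨h1, fun s => ?_⟩
    have hs : ((Finset.univ \ Finset.Iic s).card : ℤ) ≤ ∑ u ∈ Finset.univ \ Finset.Iic s, x u := by
      have := Finset.card_nsmul_le_sum (Finset.univ \ Finset.Iic s) x 1 (fun u _ => h1 u)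
      simpa using this
    have hsum := Finset.sum_sdiff (f := x) (Finset.subset_univ (Finset.Iic s))
    have hc : (Finset.univ \ Finset.Iic s).card = n + 1 - (s + 1) := by
      rw [Finset.card_sdiff_of_subset (Finset.subset_univ _)]
      simp
    rw [hc] at hs
    have hsn := s.2
    push_cast [Nat.cast_sub (show (s : ℕ) + 1 ≤ n + 1 by omega)] at hs
    omega

/-- The vectors of the stack between the two ends of a pyramid whose lowest layer is at height
`c`. -/
def layer (n m : ℕ) (c : ℤ) : Set (Fin (n + 1) → ℤ) :=
  {y | y ∈ stack n m ∧ c ≤ y (Fin.last n) ∧ ∑ s, y s ≤ (m : ℤ) + n - 1 + c}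

/-- At height 1 the bound on the total is that of the pyramid; since the last coordinate is at least
1, it implies the bound that the stack puts on the other coordinates. -/
theorem pyramid_eq_layer {n m : ℕ} (hn : 1 ≤ n) : pyramid (n + 1) m = layer n m 1 := by
  obtain ⟨n, rfl⟩ := Nat.exists_eq_add_of_le' hn
  ext y
  simp only [layer, stack, Set.mem_ofPred_eq, mem_pyramid_succ, Fin.sum_univ_castSucc (n := n + 1),
    Fin.forall_fin_succ' (n := n + 1)]
  have e : ∀ s, Fin.init y s = y s.castSucc := fun s => rfl
  simp only [e]
  constructor
  · rintro ⟨⟨h1, h2⟩, h3⟩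
    refine ⟨⟨h1, ?_⟩, h2, ?_⟩
    · push_cast at h3; omega
    · push_cast at h3 ⊢; omega
  · rintro ⟨⟨h1, h2⟩, h3, h4⟩
    refine ⟨⟨h1, h3⟩, ?_⟩
    push_cast at h4 ⊢; omega

/-- The entries of `a` telescope, and only the entry at 0 is never subtracted. -/
theorem sum_move {n : ℕ} (i a : Fin (n + 1) → ℤ) : ∑ s, move i a s = ∑ s, i s + a 0 := by
  have h : ∑ s : Fin (n + 1), (if h : (s : ℕ) + 1 < n + 1 then a ⟨s + 1, h⟩ else 0) =
      ∑ s : Fin n, a s.succ := by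
    rw [Fin.sum_univ_castSucc]
    simp only [Fin.val_last, lt_irrefl, dite_false, add_zero]
    refine Finset.sum_congr rfl fun s _ => ?_
    rw [dif_pos (by simp)]
    rfl
  simp only [move, Finset.sum_sub_distrib, Finset.sum_add_distrib, h]
  rw [Fin.sum_univ_succ a]
  ring

/-- The lower bound on the last entry of `a` and the upper bound on its first entry are the two
inequalities of the slab. Conversely one side of the cuboid suffices: every point of the slab lies
on a line of arrows of the last type that issues from height `t`. -/
theorem completion_eq_layer {n m : ℕ} (hn : 1 ≤ n) (t : ℤ) :
    completion n m t = layer n m t := by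
  ext y
  constructor
  · intro hy
    refine ⟨completion_subset_stack n m t hy, ?_⟩
    obtain ⟨i, hi, ht, a, ha, rfl⟩ := hy
    constructor
    · have h : move i a (Fin.last n) = i (Fin.last n) + a (Fin.last n) := by
        simp [move]
      rw [h, ht]
      have := (ha (Fin.last n)).1
      omega
    · rw [sum_move, Fin.sum_univ_castSucc, ht]
      have : a 0 ≤ (m : ℤ) + n - 1 - ∑ u : Fin n, i u.castSucc := (ha 0).2
      omega
  · obtain ⟨n, rfl⟩ := Nat.exists_eq_add_of_le' hn
    rintro ⟨h1, h2, h3⟩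
    obtain ⟨h1, h4⟩ := mem_pyramid_succ.1 h1
    rw [Fin.sum_univ_castSucc] at h3
    have e : ∀ s, Fin.init y s = y s.castSucc := fun s => rfl
    simp only [e] at h1 h4
    -- The height above level `t`. The witness sits at height `t` with `c` added to the preceding
    -- coordinate, and `c` steps of the last type lead from it to `y`.
    set c := y (Fin.last (n + 1)) - t with hc
    have hl : ∀ s : Fin (n + 1), (if s = Fin.last n then c else 0) ≥ 0 := fun s => by
      split_ifs <;> omega
    have hsum : ∑ s : Fin (n + 1), (y s.castSucc + if s = Fin.last n then c else 0) =
        ∑ s : Fin (n + 1), y s.castSucc + c := by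
      rw [Finset.sum_add_distrib, Finset.sum_ite_eq' Finset.univ]; simp
    set i : Fin (n + 2) → ℤ :=
      Fin.snoc (α := fun _ => ℤ) (fun s => y s.castSucc + if s = Fin.last n then c else 0) t with hi
    have hinit : Fin.init i = fun s => y s.castSucc + if s = Fin.last n then c else 0 := by
      rw [hi]; exact Fin.init_snoc _ _
    have hilast : i (Fin.last (n + 1)) = t := by rw [hi]; exact Fin.snoc_last _ _
    refine ⟨i, ?_, hilast, Pi.single (Fin.last (n + 1)) c, ?_, ?_⟩
    · rw [hinit, mem_pyramid_succ]
      refine ⟨fun s => ?_, ?_⟩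
      · have := h1 s; have := hl s; omega
      · rw [hsum]; push_cast at h3; omega
    · intro s
      rw [hinit]
      refine Fin.cases ?_ (fun s => ?_) s
      · have h0 : (Pi.single (Fin.last (n + 1)) c : Fin (n + 2) → ℤ) 0 = 0 :=
          Pi.single_eq_of_ne (by simp [Fin.ext_iff]) _
        rw [h0, sides, Fin.cons_zero, hsum]
        refine ⟨le_rfl, ?_⟩
        push_cast at h3 ⊢
        omega
      · rw [sides, Fin.cons_succ]
        have h1s := h1 s
        by_cases hs : s = Fin.last n
        · subst hs
          rw [Fin.succ_last, Pi.single_eq_same, if_pos rfl]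
          omega
        · rw [Pi.single_eq_of_ne (by rw [← Fin.succ_last]; simpa using hs), if_neg hs]
          omega
    · funext s
      refine Fin.lastCases ?_ (fun s => ?_) s
      · simp only [move, hilast, Pi.single_eq_same, Fin.val_last, lt_irrefl, dite_false]
        omega
      · have e1 : i s.castSucc = y s.castSucc + if s = Fin.last n then c else 0 := congrFun hinit s
        simp only [move, e1, Fin.val_castSucc]
        rw [dif_pos (by omega), Pi.single_eq_of_ne (Fin.castSucc_lt_last s).ne]
        by_cases hs : s = Fin.last n
        · subst hs
          rw [if_pos rfl]
          have : (⟨((Fin.last n : Fin (n + 1)) : ℕ) + 1, by simp⟩ : Fin (n + 2)) =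
            Fin.last (n + 1) := rfl
          rw [this, Pi.single_eq_same]
          ring
        · rw [if_neg hs, Pi.single_eq_of_ne]
          · ring
          · intro h
            apply hs
            rw [Fin.ext_iff] at h ⊢
            simpa using h

theorem shiftLast_eq {n : ℕ} (c : ℤ) (i : Fin (n + 1) → ℤ) :
    shiftLast c i = i + Pi.single (Fin.last n) c := by
  funext s
  by_cases hs : s = Fin.last n
  · subst hs; simp [shiftLast]
  · simp [shiftLast, hs]

theorem init_add_single_last {n : ℕ} (c : ℤ) (i : Fin (n + 1) → ℤ) :
    Fin.init (i + Pi.single (Fin.last n) c) = Fin.init i := by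
  funext s
  simp only [Fin.init, Pi.add_apply]
  rw [Pi.single_eq_of_ne (Fin.castSucc_lt_last s).ne, add_zero]

theorem add_single_mem_layer {n m : ℕ} {c c' : ℤ} {i : Fin (n + 1) → ℤ} :
    i + Pi.single (Fin.last n) c ∈ layer n m c' ↔ i ∈ layer n m (c' - c) := by
  simp only [layer, stack, Set.mem_ofPred_eq, init_add_single_last, Pi.add_apply,
    Pi.single_eq_same, Finset.sum_add_distrib, Finset.sum_pi_single', Finset.mem_univ, if_true]
  constructor
  · rintro ⟨h1, h2, h3⟩
    exact ⟨h1, by omega, by omega⟩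
  · rintro ⟨h1, h2, h3⟩
    exact ⟨h1, by omega, by omega⟩

/-- The last coordinate and the coordinate sum are both weakly increasing along arrows: the lower
bound is inherited from the start, the upper bound from the end. -/
theorem layer_convex {n m : ℕ} {c : ℤ} {i : Fin (n + 1) → ℤ} (s t : Fin (n + 1))
    (h0 : i ∈ layer n m c) (h1 : i + step (n + 1) s ∈ stack n m)
    (h2 : i + step (n + 1) s + step (n + 1) t ∈ layer n m c) :
    i + step (n + 1) s ∈ layer n m c := by
  refine ⟨h1, ?_, ?_⟩
  · have := h0.2.1
    have h := step_last s
    rw [Pi.add_apply, h]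
    split_ifs <;> omega
  · have h := h2.2.2
    have ht := sum_step_nonneg t
    simp only [Pi.add_apply, Finset.sum_add_distrib] at h ⊢
    omega

theorem layer_subset_stack {n m : ℕ} {c : ℤ} : layer n m c ⊆ stack n m := fun _ h => h.1

theorem CubeIn.init {n m : ℕ} {T : Finset (Fin (n + 1))} {i : Fin (n + 1) → ℤ}
    (h : CubeIn (stack n m) T i) : CubeIn (pyramid n m) T (Fin.init i) := by
  intro S hS
  have h' : Fin.init (i + ∑ u ∈ S, step (n + 1) u) ∈ pyramid n m := h S hS
  have e : Fin.init (i + ∑ u ∈ S, step (n + 1) (u : ℕ)) =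
      Fin.init i + ∑ u ∈ S, step n (u : ℕ) := by
    funext s
    simp only [Fin.init, Pi.add_apply, Finset.sum_apply]
    rfl
  rwa [e] at h'

theorem CubeIn.mono {p N : ℕ} {X Y : Set (Fin p → ℤ)} (hXY : X ⊆ Y) {T : Finset (Fin N)}
    {i : Fin p → ℤ} (h : CubeIn X T i) : CubeIn Y T i := fun S hS => hXY (h S hS)

theorem liftScalars_add_single {k : Type u} {n : ℕ}
    (d : Fin (n + 1) → Fin (n + 1) → (Fin n → ℤ) → k) (s t : Fin (n + 1)) (c : ℤ)
    (i : Fin (n + 1) → ℤ) :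
    liftScalars d s t (i + Pi.single (Fin.last n) c) = liftScalars d s t i := by
  rw [liftScalars, liftScalars, init_add_single_last]

/-- Forgetting the last coordinate carries cubes of the new pyramid to cubes of the old one, and the
lifted scalars see only this projection. -/
theorem IsTwist.liftScalars {k : Type u} [Field k] {n m : ℕ} (hn : 1 ≤ n)
    {d : Fin (n + 1) → Fin (n + 1) → (Fin n → ℤ) → k} (hd : IsTwist (pyramid n m) d) :
    IsTwist (pyramid (n + 1) m) (liftScalars d) := by
  have hsub : pyramid (n + 1) m ⊆ stack n m := by
    rw [pyramid_eq_layer hn]; exact layer_subset_stack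
  exact ⟨fun s t i hts hc => hd.ne_zero s t _ hts (hc.mono hsub).init,
    fun r s t i hts hsr hc => hd.compatible r s t _ hts hsr (hc.mono hsub).init⟩

end Geometry

/-! ### Truncations to convex full subquivers -/

section Truncation

variable {k : Type u} [Field k] {p N : ℕ} {X Y : Set (Fin p → ℤ)}

theorem map_eq_zero_of_mem_idealSpan {A B : Type u} [NonUnitalRing A] [Module k A]
    [IsScalarTower k A A] [SMulCommClass k A A] [NonUnitalRing B] [Module k B] {S : Set A}
    (f : A →ₙₐ[k] B) (hf : ∀ x ∈ S, f x = 0) {x : A} (hx : x ∈ idealSpan k S) : f x = 0 := by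
  have : idealSpan k S ≤ LinearMap.ker (f : A →ₗ[k] B) := by
    refine idealSpan_le (fun x hx => hf x hx) fun a x hx => ?_
    have hx' : f x = 0 := hx
    exact ⟨show f (a * x) = 0 by rw [map_mul, hx', mul_zero],
      show f (x * a) = 0 by rw [map_mul, hx', zero_mul]⟩
  exact this hx

/-- The projection of the path algebra onto that of a full subquiver that kills the other
vertices. -/
abbrev retract (X Y : Set (Fin p → ℤ)) : PathAlg k (Vert N Y) →ₙₐ[k] PathAlg k (Vert N X) :=
  (isCubicRep_generators N X).hom k Y

theorem retract_idemAt {i : Fin p → ℤ} (hi : i ∈ Y) :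
    retract X Y (idemAt N Y i) = (idemAt N X i : PathAlg k (Vert N X)) :=
  (isCubicRep_generators N X).hom_idemAt hi

theorem retract_arrowAt {t : Fin N} {i : Fin p → ℤ} (hi : i ∈ Y) (hi' : i + step p t ∈ Y) :
    retract X Y (arrowAt N Y t i) = (arrowAt N X t i : PathAlg k (Vert N X)) :=
  (isCubicRep_generators N X).hom_arrowAt hi hi'

/-- Since `idemAt` and `arrowAt` vanish off their quiver, one construction is the inclusion when the
vertex set grows and the projection when it shrinks; this makes the inclusion multiplicative and
gives it a left inverse. -/
theorem pathInclusion_eq_retract (h : X ⊆ Y) (x : PathAlg k (Vert N X)) :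
    pathInclusion h x = retract Y X x := by
  induction x using pathAlg_induction with
  | zero => simp
  | add x y hx hy => rw [map_add, map_add, hx, hy]
  | smul c x hx => rw [map_smul, map_smul, hx]
  | path a b p =>
    rw [pathInclusion, pathLift_ofPath]
    refine Eq.trans ?_ (((isCubicRep_generators N Y).isQuiverRep X).freeHom_ofPath p).symm
    induction p with
    | nil => exact (idemAt_of_mem (k := k) ((fullInclusion (N := N) h).obj a)).symm
    | cons p e ih =>
      rw [pathVal, ← ih]
      have := arrowAt_of_hom (k := k) ((fullInclusion (N := N) h).map e)
      exact (ofPath_mul_ofPath k _ _).symm.trans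
        (congrArg (· * ofPath k ((fullInclusion (N := N) h).mapPath p)) this.symm)

theorem retract_pathInclusion (h : X ⊆ Y) (x : PathAlg k (Vert N X)) :
    retract X Y (pathInclusion h x) = x := by
  rw [pathInclusion_eq_retract]
  have : (retract X Y).comp (retract Y X) = NonUnitalAlgHom.id k (PathAlg k (Vert N X)) := by
    refine cubic_hom_ext (fun i hi => ?_) fun t i hi hi' => ?_
    · rw [NonUnitalAlgHom.comp_apply, retract_idemAt hi, retract_idemAt (h hi)]; rfl
    · rw [NonUnitalAlgHom.comp_apply, retract_arrowAt hi hi', retract_arrowAt (h hi) (h hi')]; rfl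
  exact DFunLike.congr_fun this x

variable {d : Fin N → Fin N → (Fin p → ℤ) → k}

theorem arrowAt_mul_arrowAt_eq_zero {s t : Fin N} {i : Fin p → ℤ}
    (h : ¬ (i ∈ X ∧ i + step p s + step p t ∈ X)) :
    (arrowAt N X t (i + step p s) * arrowAt N X s i : PathAlg k (Vert N X)) = 0 := by
  by_cases h0 : i ∈ X
  · rw [arrowAt_of_notMem (i := i + step p s) fun hh => h ⟨h0, hh.2⟩, zero_mul]
  · rw [arrowAt_of_notMem (i := i) fun hh => h0 hh.1, mul_zero]

/-- By convexity a square of `Y` with start and end in `X` has all corners in `X`, so no square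
relation degenerates to a monomial one. If the start or the end is missing, the projection
annihilates both composites. -/
theorem idealSpan_restrictRel (h : X ⊆ Y)
    (hconv : ∀ (s t : Fin N) (i : Fin p → ℤ), i ∈ X → i + step p s ∈ Y →
      i + step p s + step p t ∈ X → i + step p s ∈ X) :
    idealSpan k (restrictRel h (cubicRel N Y d)) = idealSpan k (cubicRel N X d) := by
  apply le_antisymm
  · refine idealSpan_le ?_ fun a x hx => ⟨idealSpan_mul_left a hx, idealSpan_mul_right a hx⟩
    rintro x ⟨r, hr, a, ha, b, hb, hx⟩
    -- The projection undoes the inclusion, so the restricted relation is found by projecting the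
    -- original one.
    have hx' : x = idemAt N X b * retract X Y r * idemAt N X a := by
      rw [← retract_pathInclusion h x, hx, map_mul, map_mul, retract_idemAt (h ha),
        retract_idemAt (h hb)]
    rw [hx']
    refine idealSpan_mul_right _ (idealSpan_mul_left _ ?_)
    obtain ⟨s, t, i, hts, hc, rfl⟩ | ⟨t, i, h0, h1, h2, rfl⟩ := hr
    · obtain ⟨h0, h1, h2, h3⟩ := (cubeIn_pair_iff hts.ne).1 hc
      have h3' : i + step p t + step p s ∈ Y := by rwa [add_right_comm]
      rw [map_sub, map_smul, map_mul, map_mul, retract_arrowAt h1 h3, retract_arrowAt h0 h1,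
        retract_arrowAt h2 h3', retract_arrowAt h0 h2]
      by_cases hX : i ∈ X ∧ i + step p s + step p t ∈ X
      · refine subset_idealSpan _ (Or.inl ⟨s, t, i, hts, (cubeIn_pair_iff hts.ne).2
          ⟨hX.1, hconv s t i hX.1 h1 hX.2, hconv t s i hX.1 h2 ?_, hX.2⟩, rfl⟩)
        rw [add_right_comm]; exact hX.2
      · rw [arrowAt_mul_arrowAt_eq_zero hX, arrowAt_mul_arrowAt_eq_zero
          (by rw [add_right_comm]; exact hX), smul_zero, sub_zero]
        exact Submodule.zero_mem _
    · rw [map_mul, retract_arrowAt h1 h2, retract_arrowAt h0 h1]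
      by_cases hX : i ∈ X ∧ i + step p t + step p t ∈ X
      · exact subset_idealSpan _ (Or.inr ⟨t, i, hX.1, hconv t t i hX.1 h1 hX.2, hX.2, rfl⟩)
      · rw [arrowAt_mul_arrowAt_eq_zero hX]
        exact Submodule.zero_mem _
  · refine idealSpan_le ?_ fun a x hx => ⟨idealSpan_mul_left a hx, idealSpan_mul_right a hx⟩
    rintro r (⟨s, t, i, hts, hc, rfl⟩ | ⟨t, i, h0, h1, h2, rfl⟩)
    · obtain ⟨h0, h1, h2, h3⟩ := (cubeIn_pair_iff hts.ne).1 hc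
      have h3' : i + step p t + step p s ∈ X := by rwa [add_right_comm]
      refine subset_idealSpan _ ⟨_, Or.inl ⟨s, t, i, hts, hc.mono h, rfl⟩, i, h0, _, h3, ?_⟩
      rw [pathInclusion_eq_retract, map_sub, map_smul, map_mul, map_mul, retract_arrowAt h1 h3,
        retract_arrowAt h0 h1, retract_arrowAt h2 h3', retract_arrowAt h0 h2, mul_sub, sub_mul,
        mul_smul_comm, smul_mul_assoc, ← mul_assoc, idemAt_mul_arrowAt, mul_assoc,
        arrowAt_mul_idemAt, add_right_comm, ← mul_assoc, idemAt_mul_arrowAt, mul_assoc,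
        arrowAt_mul_idemAt]
    · refine subset_idealSpan _ ⟨_, Or.inr ⟨t, i, h h0, h h1, h h2, rfl⟩, i, h0, _, h2, ?_⟩
      rw [pathInclusion_eq_retract, map_mul, retract_arrowAt h1 h2, retract_arrowAt h0 h1,
        ← mul_assoc, idemAt_mul_arrowAt, mul_assoc, arrowAt_mul_idemAt]

end Truncation

/-! ### The cuboid truncations -/

section TruncationIso

variable {k : Type u} [Field k]

/-- The quotient map as a homomorphism of algebras. -/
def IdealQuot.mkHom {A : Type u} [NonUnitalRing A] [Module k A] [IsScalarTower k A A]
    [SMulCommClass k A A] (S : Set A) : A →ₙₐ[k] IdealQuot k S :=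
  { IdealQuot.mk k S with
    map_zero' := map_zero (IdealQuot.mk k S)
    map_mul' := IdealQuot.mk_mul k S }

/-- Homomorphisms out of a bound quiver algebra that agree on the vertices and arrows. -/
theorem bound_hom_ext {p N : ℕ} {X : Set (Fin p → ℤ)} {ρ : Set (PathAlg k (Vert N X))} {A : Type u}
    [NonUnitalRing A] [Module k A] {f g : BoundAlg ρ →ₙₐ[k] A}
    (hi : ∀ i ∈ X, f (IdealQuot.mk k ρ (idemAt N X i)) = g (IdealQuot.mk k ρ (idemAt N X i)))
    (ha : ∀ t : Fin N, ∀ i ∈ X, i + step p t ∈ X →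
      f (IdealQuot.mk k ρ (arrowAt N X t i)) = g (IdealQuot.mk k ρ (arrowAt N X t i))) :
    f = g := by
  have : f.comp (IdealQuot.mkHom ρ) = g.comp (IdealQuot.mkHom ρ) := cubic_hom_ext hi ha
  refine NonUnitalAlgHom.ext fun x => ?_
  obtain ⟨x, rfl⟩ := IdealQuot.mk_surjective k ρ x
  exact DFunLike.congr_fun this x

/-- The vertices and arrows of a bound quiver algebra, translated by `c`. -/
theorem isCubicRep_translate {p N : ℕ} {X : Set (Fin p → ℤ)} (ρ : Set (PathAlg k (Vert N X)))
    (c : Fin p → ℤ) :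
    IsCubicRep N (fun i => IdealQuot.mk k ρ (idemAt N X (i + c)))
      (fun t i => IdealQuot.mk k ρ (arrowAt N X t (i + c))) :=
  ((isCubicRep_generators N X).map (IdealQuot.mkHom ρ) (map_zero _)).translate c

theorem translate_comp_translate {p N : ℕ} {X Y : Set (Fin p → ℤ)}
    {ρ : Set (PathAlg k (Vert N X))} {σ : Set (PathAlg k (Vert N Y))} {c : Fin p → ℤ}
    (hXY : ∀ i ∈ X, i + c ∈ Y) (h1 : ∀ r ∈ ρ, (isCubicRep_translate σ c).hom k X r = 0)
    (h2 : ∀ r ∈ σ, (isCubicRep_translate ρ (-c)).hom k Y r = 0) :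
    (IdealQuot.lift σ _ h2).comp (IdealQuot.lift ρ _ h1) = NonUnitalAlgHom.id k (BoundAlg ρ) := by
  refine bound_hom_ext (fun i hi => ?_) fun t i hi hi' => ?_
  · rw [NonUnitalAlgHom.comp_apply, IdealQuot.lift_mk, IsCubicRep.hom_idemAt _ hi,
      IdealQuot.lift_mk, IsCubicRep.hom_idemAt _ (hXY i hi), add_neg_cancel_right]
    rfl
  · have h := hXY _ hi'
    rw [add_right_comm] at h
    rw [NonUnitalAlgHom.comp_apply, IdealQuot.lift_mk, IsCubicRep.hom_arrowAt _ hi hi',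
      IdealQuot.lift_mk, IsCubicRep.hom_arrowAt _ (hXY i hi) h, add_neg_cancel_right]
    rfl

/-- The scalars, hence the relations, are invariant under the translation. Only the ideal generated
by `σ` matters, so the same lemma covers the cubic and the restricted relations. -/
theorem translate_kills {p N : ℕ} {X Y : Set (Fin p → ℤ)} {d : Fin N → Fin N → (Fin p → ℤ) → k}
    {σ : Set (PathAlg k (Vert N Y))} (hσ : idealSpan k σ = idealSpan k (cubicRel N Y d))
    {c : Fin p → ℤ} (hXY : ∀ i ∈ X, i + c ∈ Y) (hd : ∀ s t i, d s t (i + c) = d s t i) :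
    ∀ r ∈ cubicRel N X d, (isCubicRep_translate σ c).hom k X r = 0 := by
  have hz : ∀ r ∈ cubicRel N Y d, IdealQuot.mk k σ r = 0 := fun r hr => by
    rw [IdealQuot.mk_eq_zero, hσ]
    exact subset_idealSpan _ hr
  refine IsCubicRep.hom_cubicRel _ (fun s t i hts hc => ?_) fun t i h0 h1 h2 => ?_
  · rw [← sub_eq_zero, ← IdealQuot.mk_mul, ← IdealQuot.mk_mul, ← map_smul, ← map_sub, ← hd s t i,
      add_right_comm i (step p s) c, add_right_comm i (step p t) c]
    refine hz _ (Or.inl ⟨s, t, i + c, hts, fun S hS => ?_, rfl⟩)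
    have := hXY _ (hc S hS)
    rwa [add_right_comm] at this
  · rw [← IdealQuot.mk_mul, add_right_comm]
    refine hz _ (Or.inr ⟨t, i + c, hXY _ h0, ?_, ?_, rfl⟩)
    · have := hXY _ h1
      rwa [add_right_comm] at this
    · have := hXY _ h2
      rwa [add_right_comm, add_right_comm i] at this

variable {n m : ℕ} (d : Fin (n + 1) → Fin (n + 1) → (Fin n → ℤ) → k)

theorem idealSpan_truncRel (hn : 1 ≤ n) (t : ℤ) : idealSpan k (truncRel n m d t) =
    idealSpan k (cubicRel (n + 1) (completion n m t) (liftScalars d)) := by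
  refine idealSpan_restrictRel _ fun s u i h0 h1 h2 => ?_
  rw [completion_eq_layer hn] at h0 h2 ⊢
  exact layer_convex s u h0 h1 h2

theorem exists_trunc_iso (hn : 1 ≤ n) (t : ℤ) :
    ∃ φ : TruncAlg n m d t →ₙₐ[k] NextAlg n m d, Function.Bijective φ ∧
      (∀ i : Fin (n + 1) → ℤ,
        φ (IdealQuot.mk k (truncRel n m d t) (idemAt (n + 1) (completion n m t) i)) =
          IdealQuot.mk k (pyramidRel (n + 1) m (liftScalars d))
            (idemAt (n + 1) (pyramid (n + 1) m) (shiftLast (1 - t) i))) ∧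
      (∀ (s : Fin (n + 1)) (i : Fin (n + 1) → ℤ),
        φ (IdealQuot.mk k (truncRel n m d t) (arrowAt (n + 1) (completion n m t) s i)) =
          IdealQuot.mk k (pyramidRel (n + 1) m (liftScalars d))
            (arrowAt (n + 1) (pyramid (n + 1) m) s (shiftLast (1 - t) i))) := by
  set c : Fin (n + 1) → ℤ := Pi.single (Fin.last n) (1 - t) with hc
  have hc' : -c = Pi.single (Fin.last n) (t - 1) := by
    rw [hc, ← Pi.single_neg]; congr 1; ring
  have hXY : ∀ i, i + c ∈ pyramid (n + 1) m ↔ i ∈ completion n m t := fun i => by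
    rw [pyramid_eq_layer hn, completion_eq_layer hn, hc, add_single_mem_layer]
    congr! 2; ring
  have hYX : ∀ i ∈ pyramid (n + 1) m, i + -c ∈ completion n m t := fun i hi => by
    rw [← hXY, neg_add_cancel_right]; exact hi
  have h1 : ∀ r ∈ truncRel n m d t, (isCubicRep_translate (pyramidRel (n + 1) m
      (liftScalars d)) c).hom k (completion n m t) r = 0 := fun r hr => by
    refine map_eq_zero_of_mem_idealSpan _ (translate_kills (X := completion n m t) rfl
      (fun i hi => (hXY i).2 hi) (fun s u i => liftScalars_add_single d s u (1 - t) i)) ?_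
    rw [← idealSpan_truncRel d hn]
    exact subset_idealSpan _ hr
  have h2 : ∀ r ∈ pyramidRel (n + 1) m (liftScalars d), (isCubicRep_translate (truncRel n m d t)
      (-c)).hom k (pyramid (n + 1) m) r = 0 :=
    translate_kills (idealSpan_truncRel d hn t) hYX fun s u i => by
      rw [hc']; exact liftScalars_add_single d s u (t - 1) i
  -- The second composite is the lemma for the translation by `-c`, whose inverse is the translation
  -- by `- -c`.
  have h1' : ∀ r ∈ truncRel n m d t, (isCubicRep_translate (pyramidRel (n + 1) m
      (liftScalars d)) (- -c)).hom k (completion n m t) r = 0 := by rwa [neg_neg]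
  have e1 := translate_comp_translate (fun i hi => (hXY i).2 hi) h1 h2
  have e2 := translate_comp_translate hYX h2 h1'
  refine ⟨IdealQuot.lift _ _ h1, ⟨?_, ?_⟩, fun i => ?_, fun s i => ?_⟩
  · exact Function.LeftInverse.injective (g := IdealQuot.lift _ _ h2) (DFunLike.congr_fun e1)
  · simp only [neg_neg] at e2
    exact Function.RightInverse.surjective (g := IdealQuot.lift _ _ h2) (DFunLike.congr_fun e2)
  · rw [IdealQuot.lift_mk, shiftLast_eq, ← hc]
    by_cases hi : i ∈ completion n m t
    · rw [IsCubicRep.hom_idemAt _ hi]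
    · rw [idemAt_of_notMem hi, map_zero, idemAt_of_notMem (fun h => hi ((hXY i).1 h)), map_zero]
  · rw [IdealQuot.lift_mk, shiftLast_eq, ← hc]
    by_cases hi : i ∈ completion n m t ∧ i + step (n + 1) s ∈ completion n m t
    · rw [IsCubicRep.hom_arrowAt _ hi.1 hi.2]
    · rw [arrowAt_of_notMem hi, map_zero, arrowAt_of_notMem, map_zero]
      rw [add_right_comm, hXY, hXY]
      exact hi

end TruncationIso

/-! ### The smash product and its quotients -/

section SmashQuotient

variable {k : Type u} [Field k] {n m : ℕ} {d : Fin (n + 1) → Fin (n + 1) → (Fin n → ℤ) → k}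

theorem pathWeight_nil {V : Type} [Quiver.{0} V] (w : ∀ a b : V, (a ⟶ b) → ℤ) (a : V) :
    pathWeight w (Quiver.Path.nil : Quiver.Path a a) = 0 := by
  simp [pathWeight]

theorem pathWeight_cons {V : Type} [Quiver.{0} V] (w : ∀ a b : V, (a ⟶ b) → ℤ) {a b c : V}
    (p : Quiver.Path a b) (e : b ⟶ c) :
    pathWeight w (p.cons e) = pathWeight w p + w b c e := by
  simp [pathWeight]

theorem component_pathClass (v : ℤ) {a b : Vert (n + 1) (pyramid n m)} (p : Quiver.Path a b) :
    component (stableGrading n m d) v (pathClass (stableRel n m d) p) =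
      if pathWeight (lastWeight n m) p = v then pathClass (stableRel n m d) p else 0 := by
  have hp : pathClass (stableRel n m d) p ∈
      stableGrading n m d (pathWeight (lastWeight n m) p) :=
    Submodule.subset_span ⟨a, b, p, rfl, rfl⟩
  split_ifs with h
  · subst h
    exact DirectSum.decompose_of_mem_same _ hp
  · exact DirectSum.decompose_of_mem_ne _ hp h

theorem component_idemAt (v : ℤ) (i : Fin n → ℤ) :
    component (stableGrading n m d) v (IdealQuot.mk k (stableRel n m d)
      (idemAt (n + 1) (pyramid n m) i)) =
      if v = 0 then IdealQuot.mk k (stableRel n m d) (idemAt (n + 1) (pyramid n m) i) else 0 := by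
  by_cases h : i ∈ pyramid n m
  · rw [idemAt, dif_pos h]
    refine (component_pathClass v _).trans ?_
    rw [pathWeight_nil]
    simp only [eq_comm (a := v)]
    rfl
  · rw [idemAt_of_notMem h, map_zero, map_zero, ite_self]

theorem component_arrowAt (v : ℤ) (t : Fin (n + 1)) (i : Fin n → ℤ) :
    component (stableGrading n m d) v (IdealQuot.mk k (stableRel n m d)
      (arrowAt (n + 1) (pyramid n m) t i)) =
      if v = step (n + 1) t (Fin.last n) then
        IdealQuot.mk k (stableRel n m d) (arrowAt (n + 1) (pyramid n m) t i) else 0 := by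
  by_cases h : i ∈ pyramid n m ∧ i + step n t ∈ pyramid n m
  · rw [arrowAt, dif_pos h, step_last]
    refine (component_pathClass v _).trans ?_
    rw [Quiver.Hom.toPath, pathWeight_cons, pathWeight_nil, zero_add]
    simp only [eq_comm (a := v)]
    rfl
  · rw [arrowAt_of_notMem h, map_zero, map_zero, ite_self]

theorem mem_stack {i : Fin (n + 1) → ℤ} : i ∈ stack n m ↔ Fin.init i ∈ pyramid n m := Iff.rfl

theorem snoc_mem_stack {i : Fin n → ℤ} {v : ℤ} :
    (Fin.snoc i v : Fin (n + 1) → ℤ) ∈ stack n m ↔ i ∈ pyramid n m := by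
  rw [mem_stack, Fin.init_snoc]

variable (n m d) in
/-- The idempotent `e_i p_v` of the smash product at the vertex `(i, v)`. -/
def smashIdem (i : Fin (n + 1) → ℤ) : SmashAlg n m d :=
  Smash.of (stableGrading n m d) (i (Fin.last n))
    (IdealQuot.mk k (stableRel n m d) (idemAt (n + 1) (pyramid n m) (Fin.init i)))

variable (n m d) in
/-- The arrow `γ^t_i p_v` of the smash product at the vertex `(i, v)`. -/
def smashArrow (t : Fin (n + 1)) (i : Fin (n + 1) → ℤ) : SmashAlg n m d :=
  Smash.of (stableGrading n m d) (i (Fin.last n))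
    (IdealQuot.mk k (stableRel n m d) (arrowAt (n + 1) (pyramid n m) t (Fin.init i)))

/-- In `(a p_u)(b p_v)` only the component of `b` of degree `u - v` survives. Idempotents have
degree 0, so heights must agree; the degree of an arrow is its change of the last coordinate, so
arrows compose as in the stack. -/
theorem isCubicRep_smash : IsCubicRep (n + 1) (smashIdem n m d) (smashArrow n m d) where
  idem i := by
    rw [smashIdem, Smash.of_mul_of, component_idemAt, if_pos (sub_self _), ← IdealQuot.mk_mul,
      idemAt_mul_idemAt]
  orth i j hij := by
    rw [smashIdem, smashIdem, Smash.of_mul_of, component_idemAt]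
    split_ifs with h
    · rw [← IdealQuot.mk_mul, idemAt_mul_idemAt_of_ne, map_zero, map_zero]
      intro h'
      apply hij
      rw [← Fin.snoc_init_self i, ← Fin.snoc_init_self j, h', sub_eq_zero.1 h]
    · rw [mul_zero, map_zero]
  left t i := by
    rw [smashIdem, smashArrow, Smash.of_mul_of, component_arrowAt,
      if_pos (by rw [Pi.add_apply]; ring), ← IdealQuot.mk_mul, init_add_step, idemAt_mul_arrowAt]
  right t i := by
    rw [smashIdem, smashArrow, Smash.of_mul_of, component_idemAt, if_pos (sub_self _),
      ← IdealQuot.mk_mul, arrowAt_mul_idemAt]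

theorem smashArrow_mul_smashArrow (s t : Fin (n + 1)) (i : Fin (n + 1) → ℤ) :
    smashArrow n m d t (i + step (n + 1) s) * smashArrow n m d s i =
      Smash.of (stableGrading n m d) (i (Fin.last n))
        (IdealQuot.mk k (stableRel n m d) (arrowAt (n + 1) (pyramid n m) t (Fin.init i + step n s))
          * IdealQuot.mk k (stableRel n m d) (arrowAt (n + 1) (pyramid n m) s (Fin.init i))) := by
  rw [smashArrow, smashArrow, Smash.of_mul_of, component_arrowAt,
    if_pos (by rw [Pi.add_apply]; ring), init_add_step]

theorem smash_comm {s t : Fin (n + 1)} (hts : t < s) {i : Fin (n + 1) → ℤ}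
    (h : CubeIn (stack n m) {s, t} i) :
    liftScalars d s t i • (smashArrow n m d t (i + step (n + 1) s) * smashArrow n m d s i) =
      smashArrow n m d s (i + step (n + 1) t) * smashArrow n m d t i := by
  rw [smashArrow_mul_smashArrow, smashArrow_mul_smashArrow, ← map_smul]
  exact congrArg _ (cubicRel_comm hts h.init)

theorem smash_sq (t : Fin (n + 1)) (i : Fin (n + 1) → ℤ) :
    smashArrow n m d t (i + step (n + 1) t) * smashArrow n m d t i = 0 := by
  rw [smashArrow_mul_smashArrow]
  exact (congrArg _ (cubicRel_sq t _)).trans (map_zero _)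

/-- Homomorphisms out of the smash product that agree on the vertices and arrows. -/
theorem smash_hom_ext {A : Type u} [NonUnitalRing A] [Module k A]
    {f g : SmashAlg n m d →ₙₐ[k] A} (hi : ∀ i ∈ stack n m, f (smashIdem n m d i) =
      g (smashIdem n m d i))
    (ha : ∀ t : Fin (n + 1), ∀ i ∈ stack n m, i + step (n + 1) t ∈ stack n m →
      f (smashArrow n m d t i) = g (smashArrow n m d t i)) : f = g := by
  refine NonUnitalAlgHom.ext fun x => ?_
  induction x using Smash.induction with
  | zero => simp
  | add x y hx hy => rw [map_add, map_add, hx, hy]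
  | of v x =>
    obtain ⟨x, rfl⟩ := IdealQuot.mk_surjective k _ x
    induction x using pathAlg_induction with
    | zero => simp
    | add x y hx hy => simp only [map_add, hx, hy]
    | smul c x hx => simp only [map_smul, hx]
    | path a b p =>
      induction p with
      | nil =>
        have := hi _ (snoc_mem_stack (v := v).2 a.mem)
        rwa [smashIdem, Fin.snoc_last, Fin.init_snoc, idemAt_of_mem] at this
      | @cons b c p e ih =>
        have h1 := ha e.1 (Fin.snoc b.val (v + pathWeight (lastWeight n m) p)) 
          (snoc_mem_stack.2 b.mem) (by
          rw [mem_stack, init_add_step, Fin.init_snoc, ← e.2]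
          exact c.mem)
        rw [smashArrow, Fin.snoc_last, Fin.init_snoc, arrowAt_of_hom] at h1
        -- The final arrow of a path lifted from height `v` starts at height `v` plus the weight of
        -- the path before it.
        have h2 : Smash.of (stableGrading n m d) v (IdealQuot.mk k (stableRel n m d)
            (ofPath k (p.cons e))) =
            Smash.of (stableGrading n m d) (v + pathWeight (lastWeight n m) p)
              (IdealQuot.mk k (stableRel n m d) (ofPath k e.toPath)) *
            Smash.of (stableGrading n m d) v
              (IdealQuot.mk k (stableRel n m d) (ofPath k p)) := by
          rw [Smash.of_mul_of]
          have := component_pathClass (d := d) (v + pathWeight (lastWeight n m) p - v) p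
          rw [if_pos (by ring), pathClass] at this
          rw [this, ← IdealQuot.mk_mul, ofPath_mul_ofPath]
          rfl
        rw [h2, map_mul, map_mul, ih, h1]

/-! ### Homomorphisms out of the smash product by unique lifting of paths -/

section Lifting

variable {B : Type u} [NonUnitalRing B]
  {e : (Fin (n + 1) → ℤ) → B} {f : Fin (n + 1) → (Fin (n + 1) → ℤ) → B}

/-- The value of the lift, starting at height `v`, of a path in the stable quiver. -/
def liftVal (e : (Fin (n + 1) → ℤ) → B) (f : Fin (n + 1) → (Fin (n + 1) → ℤ) → B) (v : ℤ)
    {a : Vert (n + 1) (pyramid n m)} : ∀ {b : Vert (n + 1) (pyramid n m)}, Quiver.Path a b → B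
  | _, Quiver.Path.nil => e (Fin.snoc a.val v)
  | _, @Quiver.Path.cons _ _ _ b _ p a =>
    f a.1 (Fin.snoc b.val (v + pathWeight (lastWeight n m) p)) * liftVal e f v p

theorem snoc_add_step {a b : Vert (n + 1) (pyramid n m)} (x : a ⟶ b) (v : ℤ) :
    (Fin.snoc a.val v : Fin (n + 1) → ℤ) + step (n + 1) x.1 =
      Fin.snoc b.val (v + lastWeight n m a b x) := by
  funext s
  refine Fin.lastCases ?_ (fun s => ?_) s
  · rw [Pi.add_apply, Fin.snoc_last, Fin.snoc_last, step_last, lastWeight]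
  · rw [Pi.add_apply, Fin.snoc_castSucc, Fin.snoc_castSucc]
    exact (congrFun x.2 s).symm

theorem idem_mul_liftVal (h : IsCubicRep (n + 1) e f) (v : ℤ) {a b : Vert (n + 1) (pyramid n m)}
    (p : Quiver.Path a b) :
    e (Fin.snoc b.val (v + pathWeight (lastWeight n m) p)) * liftVal e f v p = liftVal e f v p := by
  cases p with
  | nil => rw [pathWeight_nil, add_zero]; exact h.idem _
  | cons p x => rw [pathWeight_cons, liftVal, ← mul_assoc, ← add_assoc, ← snoc_add_step, h.left]

theorem liftVal_mul_idem (h : IsCubicRep (n + 1) e f) (v : ℤ) {a b : Vert (n + 1) (pyramid n m)}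
    (p : Quiver.Path a b) : liftVal e f v p * e (Fin.snoc a.val v) = liftVal e f v p := by
  induction p with
  | nil => exact h.idem _
  | cons p x ih => rw [liftVal, mul_assoc, ih]

theorem liftVal_comp (h : IsCubicRep (n + 1) e f) (v : ℤ) {a b c : Vert (n + 1) (pyramid n m)}
    (p : Quiver.Path a b) (q : Quiver.Path b c) :
    liftVal e f (v + pathWeight (lastWeight n m) p) q * liftVal e f v p =
      liftVal e f v (p.comp q) := by
  induction q with
  | nil => rw [Quiver.Path.comp_nil, liftVal, idem_mul_liftVal h]
  | cons q x ih =>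
    rw [Quiver.Path.comp_cons, liftVal, liftVal, mul_assoc, ih, pathWeight_comp, add_assoc]

/-- Idempotents at the end of one lift and at the start of the other can be inserted; they are
orthogonal as soon as the vertices or the heights differ. -/
theorem liftVal_mul_of_ne (h : IsCubicRep (n + 1) e f) (u v : ℤ)
    {a b b' c : Vert (n + 1) (pyramid n m)} (p : Quiver.Path a b) (q : Quiver.Path b' c)
    (hne : b ≠ b' ∨ u ≠ v + pathWeight (lastWeight n m) p) :
    liftVal e f u q * liftVal e f v p = 0 := by
  rw [← liftVal_mul_idem h, ← idem_mul_liftVal h v p, mul_assoc, ← mul_assoc (e _), h.orth,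
    zero_mul, mul_zero]
  intro h'
  have h1 := congrFun h' (Fin.last n)
  have h2 := congrArg Fin.init h'
  rw [Fin.snoc_last, Fin.snoc_last] at h1
  rw [Fin.init_snoc, Fin.init_snoc] at h2
  rcases hne with hne | hne
  · apply hne
    cases b; cases b'
    simpa using h2.symm
  · exact hne h1

variable [Module k B] [IsScalarTower k B B] [SMulCommClass k B B]

variable (k) in
/-- The linear extension of `liftVal`. -/
def liftMap (e : (Fin (n + 1) → ℤ) → B) (f : Fin (n + 1) → (Fin (n + 1) → ℤ) → B) (v : ℤ) :
    PathAlg k (Vert (n + 1) (pyramid n m)) →ₗ[k] B :=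
  pathLift (fun x => liftVal e f v x.2.2)

theorem liftMap_ofPath (v : ℤ) {a b : Vert (n + 1) (pyramid n m)} (p : Quiver.Path a b) :
    liftMap k e f v (ofPath k p) = liftVal e f v p := pathLift_ofPath _ p

theorem liftMap_mul_ofPath (h : IsCubicRep (n + 1) e f) (v : ℤ) {a b : Vert (n + 1) (pyramid n m)}
    (p : Quiver.Path a b) (x : PathAlg k (Vert (n + 1) (pyramid n m))) :
    liftMap k e f v (x * ofPath k p) =
      liftMap k e f (v + pathWeight (lastWeight n m) p) x * liftVal e f v p := by
  induction x using pathAlg_induction with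
  | zero => simp
  | add x y hx hy => simp only [add_mul, map_add, hx, hy]
  | smul c x hx => simp only [smul_mul_assoc, map_smul, hx]
  | path a' b' q =>
    by_cases hb : b = a'
    · subst hb
      rw [ofPath_mul_ofPath, liftMap_ofPath, liftMap_ofPath, liftVal_comp h]
    · rw [ofPath_mul_ofPath_of_ne k _ _ hb, map_zero, liftMap_ofPath,
        liftVal_mul_of_ne h _ _ _ _ (Or.inl hb)]

/-- The height at which `p` has to start varies with the weights of the terms of `x`, so no single
lift of `p` can be factored out. A sum of lifts over enough heights can, because every lift from a
wrong height contributes zero. -/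
theorem liftMap_ofPath_mul (h : IsCubicRep (n + 1) e f) (v : ℤ) {a b : Vert (n + 1) (pyramid n m)}
    (p : Quiver.Path a b) (x : PathAlg k (Vert (n + 1) (pyramid n m))) :
    ∃ S : Finset ℤ, ∀ T, S ⊆ T → liftMap k e f v (ofPath k p * x) =
      (∑ u ∈ T, liftVal e f u p) * liftMap k e f v x := by
  induction x using pathAlg_induction with
  | zero => exact ⟨∅, fun T _ => by simp⟩
  | add x y hx hy =>
    obtain ⟨S, hS⟩ := hx
    obtain ⟨S', hS'⟩ := hy
    refine ⟨S ∪ S', fun T hT => ?_⟩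
    rw [mul_add, map_add, map_add, mul_add, hS T (Finset.union_subset_left hT),
      hS' T (Finset.union_subset_right hT)]
  | smul c x hx =>
    obtain ⟨S, hS⟩ := hx
    refine ⟨S, fun T hT => ?_⟩
    rw [mul_smul_comm, map_smul, map_smul, mul_smul_comm, hS T hT]
  | path a' b' q =>
    refine ⟨{v + pathWeight (lastWeight n m) q}, fun T hT => ?_⟩
    rw [Finset.singleton_subset_iff] at hT
    rw [liftMap_ofPath, Finset.sum_mul, Finset.sum_eq_single _ (fun u _ hu =>
      liftVal_mul_of_ne h u v q p (Or.inr hu)) (fun hh => absurd hT hh)]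
    by_cases hb : b' = a
    · subst hb
      rw [ofPath_mul_ofPath, liftMap_ofPath, liftVal_comp h]
    · rw [ofPath_mul_ofPath_of_ne k _ _ hb, map_zero, liftVal_mul_of_ne h _ _ _ _ (Or.inl hb)]

/-- Right multiplication by a path changes the starting height, so the kernels for all heights are
treated together: it is their intersection that is shown to be an ideal. -/
theorem liftMap_idealSpan (h : IsCubicRep (n + 1) e f)
    {ρ : Set (PathAlg k (Vert (n + 1) (pyramid n m)))}
    (hρ : ∀ v, ∀ r ∈ ρ, liftMap k e f v r = 0) (v : ℤ) {x : PathAlg k (Vert (n + 1) (pyramid n m))}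
    (hx : x ∈ idealSpan k ρ) : liftMap k e f v x = 0 := by
  have key : idealSpan k ρ ≤ ⨅ v, LinearMap.ker (liftMap k e f v) := by
    refine idealSpan_le ?_ ?_
    · intro r hr
      simp only [SetLike.mem_coe, Submodule.mem_iInf, LinearMap.mem_ker]
      exact fun v => hρ v r hr
    · intro a x hx
      simp only [Submodule.mem_iInf, LinearMap.mem_ker] at hx ⊢
      rw [← forall_and]
      intro v
      induction a using pathAlg_induction with
      | zero => simp
      | add a b ha hb => simp only [add_mul, mul_add, map_add, ha.1, ha.2, hb.1, hb.2]; simp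
      | smul c a ha => simp only [smul_mul_assoc, mul_smul_comm, map_smul, ha.1, ha.2]; simp
      | path a b p =>
        obtain ⟨S, hS⟩ := liftMap_ofPath_mul h v p x
        rw [hS S subset_rfl, liftMap_mul_ofPath h, hx, hx, mul_zero, zero_mul]
        exact ⟨rfl, rfl⟩
  have := key hx
  simp only [Submodule.mem_iInf, LinearMap.mem_ker] at this
  exact this v

/-- The linear map from the smash product with given values of the vertices and arrows. -/
def smashLin (h : IsCubicRep (n + 1) e f)
    (hρ : ∀ v, ∀ r ∈ stableRel n m d, liftMap k e f v r = 0) : SmashAlg n m d →ₗ[k] B :=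
  (Finsupp.lsum k (fun v : ℤ => (idealSpan k (stableRel n m d)).liftQ (liftMap k e f v)
      fun _ hx => liftMap_idealSpan h hρ v hx) : (ℤ →₀ StableAlg n m d) →ₗ[k] B)

theorem smashLin_of (h : IsCubicRep (n + 1) e f)
    (hρ : ∀ v, ∀ r ∈ stableRel n m d, liftMap k e f v r = 0) (v : ℤ)
    (x : PathAlg k (Vert (n + 1) (pyramid n m))) :
    smashLin h hρ (Smash.of (stableGrading n m d) v (IdealQuot.mk k (stableRel n m d) x)) =
      liftMap k e f v x := by
  unfold smashLin
  exact Finsupp.lsum_single k (M := StableAlg n m d) _ _ _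

/-- The homomorphism from the smash product with given values of the vertices and arrows. -/
def smashHom (h : IsCubicRep (n + 1) e f) (hρ : ∀ v, ∀ r ∈ stableRel n m d, liftMap k e f v r = 0) :
    SmashAlg n m d →ₙₐ[k] B :=
  let g : SmashAlg n m d →ₗ[k] B := smashLin h hρ
  have hg : ∀ v x, g (Smash.of (stableGrading n m d) v (IdealQuot.mk k (stableRel n m d) x)) =
    liftMap k e f v x := smashLin_of h hρ
  { g with
    map_zero' := map_zero g
    map_mul' := fun x y => by
      change g (x * y) = g x * g y
      induction x using Smash.induction with
      | zero => simp
      | add x x' hx hx' => simp only [add_mul, map_add, hx, hx']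
      | of u x =>
        induction y using Smash.induction with
        | zero => simp
        | add x x' hx hx' => simp only [mul_add, map_add, hx, hx']
        | of v y =>
          obtain ⟨x, rfl⟩ := IdealQuot.mk_surjective k _ x
          obtain ⟨y, rfl⟩ := IdealQuot.mk_surjective k _ y
          rw [Smash.of_mul_of, hg, hg]
          induction x using pathAlg_induction with
          | zero => simp
          | add x x' hx hx' => simp only [add_mul, map_add, hx, hx']
          | smul c x hx => simp only [smul_mul_assoc, map_smul, hx]
          | path a b p =>
            induction y using pathAlg_induction with
            | zero => simp
            | add x x' hx hx' => simp only [mul_add, map_add, hx, hx']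
            | smul c x hx => simp only [mul_smul_comm, map_smul, hx]
            | path a' b' q =>
              have := component_pathClass (d := d) (u - v) q
              rw [pathClass] at this
              rw [this, liftMap_ofPath, liftMap_ofPath]
              -- The lift of `q` from height `v` ends at height `u` exactly if the weight of `q` is
              -- `u - v`, which is the condition built into the smash product.
              split_ifs with hw
              · rw [← IdealQuot.mk_mul, hg]
                by_cases hb : b' = a
                · subst hb
                  rw [ofPath_mul_ofPath, liftMap_ofPath, ← liftVal_comp h, hw, add_sub_cancel]
                · rw [ofPath_mul_ofPath_of_ne k _ _ hb, map_zero,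
                    liftVal_mul_of_ne h _ _ _ _ (Or.inl hb)]
              · rw [mul_zero, map_zero, map_zero, liftVal_mul_of_ne h]
                exact Or.inr fun h' => hw (by rw [h']; ring) }

theorem smashHom_of (h : IsCubicRep (n + 1) e f)
    (hρ : ∀ v, ∀ r ∈ stableRel n m d, liftMap k e f v r = 0) (v : ℤ)
    (x : PathAlg k (Vert (n + 1) (pyramid n m))) :
    smashHom h hρ (Smash.of (stableGrading n m d) v (IdealQuot.mk k (stableRel n m d) x)) =
      liftMap k e f v x :=
  smashLin_of h hρ v x

theorem liftMap_idemAt (v : ℤ) {i : Fin n → ℤ} (hi : i ∈ pyramid n m) :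
    liftMap k e f v (idemAt (n + 1) (pyramid n m) i) = e (Fin.snoc i v) := by
  rw [idemAt, dif_pos hi]
  exact liftMap_ofPath v _

theorem liftMap_arrowAt (h : IsCubicRep (n + 1) e f) (v : ℤ) {t : Fin (n + 1)} {i : Fin n → ℤ}
    (hi : i ∈ pyramid n m) (hi' : i + step n t ∈ pyramid n m) :
    liftMap k e f v (arrowAt (n + 1) (pyramid n m) t i) = f t (Fin.snoc i v) := by
  rw [arrowAt, dif_pos ⟨hi, hi'⟩]
  refine (liftMap_ofPath v _).trans ?_
  rw [Quiver.Hom.toPath, liftVal, liftVal, pathWeight_nil, add_zero]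
  exact h.right _ _

theorem smashHom_smashIdem (h : IsCubicRep (n + 1) e f)
    (hρ : ∀ v, ∀ r ∈ stableRel n m d, liftMap k e f v r = 0) {i : Fin (n + 1) → ℤ}
    (hi : i ∈ stack n m) : smashHom h hρ (smashIdem n m d i) = e i := by
  rw [smashIdem, smashHom_of, liftMap_idemAt _ hi, Fin.snoc_init_self]

theorem smashHom_smashArrow (h : IsCubicRep (n + 1) e f)
    (hρ : ∀ v, ∀ r ∈ stableRel n m d, liftMap k e f v r = 0) {t : Fin (n + 1)}
    {i : Fin (n + 1) → ℤ} (hi : i ∈ stack n m) (hi' : i + step (n + 1) t ∈ stack n m) :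
    smashHom h hρ (smashArrow n m d t i) = f t i := by
  rw [smashArrow, smashHom_of, liftMap_arrowAt h _ hi hi', Fin.snoc_init_self]

theorem liftMap_arrowAt_mul_arrowAt (h : IsCubicRep (n + 1) e f) (v : ℤ) {s t : Fin (n + 1)}
    {i : Fin n → ℤ} (h0 : i ∈ pyramid n m) (h1 : i + step n s ∈ pyramid n m)
    (h2 : i + step n s + step n t ∈ pyramid n m) :
    liftMap k e f v (arrowAt (n + 1) (pyramid n m) t (i + step n s) *
      arrowAt (n + 1) (pyramid n m) s i) =
      f t ((Fin.snoc i v : Fin (n + 1) → ℤ) + step (n + 1) s) * f s (Fin.snoc i v) := by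
  have e1 : liftMap k e f v (arrowAt (n + 1) (pyramid n m) s i) = f s (Fin.snoc i v) :=
    liftMap_arrowAt h v h0 h1
  rw [arrowAt, arrowAt, dif_pos ⟨h1, h2⟩, dif_pos ⟨h0, h1⟩, liftMap_mul_ofPath h,
    ← liftMap_ofPath (k := k)]
  rw [arrowAt, dif_pos ⟨h0, h1⟩] at e1
  rw [e1]
  have e2 := liftMap_arrowAt (k := k) (e := e) (f := f) h
    (v + pathWeight (lastWeight n m) (stepArrow s i h0 h1).toPath) h1 h2
  rw [arrowAt, dif_pos ⟨h1, h2⟩] at e2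
  rw [e2]
  have e3 := snoc_add_step (stepArrow s i h0 h1) v
  congr 2
  refine Eq.trans ?_ e3.symm
  rw [Quiver.Hom.toPath, pathWeight_cons, pathWeight_nil, zero_add]

/-- From each starting height a relation of the stable quiver lifts to the relation of the same
shape in the stack, with the same scalar. -/
theorem liftMap_stableRel (h : IsCubicRep (n + 1) e f)
    (comm : ∀ (s t : Fin (n + 1)) (i), t < s → CubeIn (stack n m) {s, t} i →
      liftScalars d s t i • (f t (i + step (n + 1) s) * f s i) = f s (i + step (n + 1) t) * f t i)
    (sq : ∀ (t : Fin (n + 1)) (i), f t (i + step (n + 1) t) * f t i = 0) (v : ℤ) :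
    ∀ r ∈ stableRel n m d, liftMap k e f v r = 0 := by
  have hi : ∀ i : Fin n → ℤ, Fin.init (Fin.snoc i v : Fin (n + 1) → ℤ) = i := fun i =>
    Fin.init_snoc _ _
  rintro r (⟨s, t, i, hts, hc, rfl⟩ | ⟨t, i, h0, h1, h2, rfl⟩)
  · obtain ⟨h0, h1, h2, h3⟩ := (cubeIn_pair_iff hts.ne).1 hc
    have h3' : i + step n t + step n s ∈ pyramid n m := by rwa [add_right_comm]
    rw [map_sub, map_smul, liftMap_arrowAt_mul_arrowAt h v h0 h1 h3,
      liftMap_arrowAt_mul_arrowAt h v h0 h2 h3', sub_eq_zero, ← comm s t _ hts, liftScalars, hi]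
    refine (cubeIn_pair_iff hts.ne).2 ⟨snoc_mem_stack.2 h0, ?_, ?_, ?_⟩ <;>
      rw [mem_stack] <;> simp only [init_add_step, hi] <;> assumption
  · rw [liftMap_arrowAt_mul_arrowAt h v h0 h1 h2, sq]

end Lifting

/-- Each side maps to the other by its values on vertices and arrows, up to translation by `c`. The
map out of the smash product sends generators outside the pyramid to zero, so it kills the outside
idempotents; both composites are then checked on generators. -/
theorem exists_smash_iso (hn : 1 ≤ n) (d : Fin (n + 1) → Fin (n + 1) → (Fin n → ℤ) → k) (t : ℤ) :
    ∃ φ : NextAlg n m d →ₙₐ[k] SmashQuot n m d t, Function.Bijective φ ∧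
      (∀ i : Fin (n + 1) → ℤ,
        φ (IdealQuot.mk k (pyramidRel (n + 1) m (liftScalars d))
            (idemAt (n + 1) (pyramid (n + 1) m) i)) =
          IdealQuot.mk k (outsideIdempotents n m d t)
            (smashIdem n m d (i + Pi.single (Fin.last n) (t - 1)))) ∧
      (∀ (s : Fin (n + 1)) (i : Fin (n + 1) → ℤ),
        φ (IdealQuot.mk k (pyramidRel (n + 1) m (liftScalars d))
            (arrowAt (n + 1) (pyramid (n + 1) m) s i)) =
          IdealQuot.mk k (outsideIdempotents n m d t)
            (smashArrow n m d s (i + Pi.single (Fin.last n) (t - 1)))) := by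
  set c : Fin (n + 1) → ℤ := Pi.single (Fin.last n) (t - 1) with hc
  set X := pyramid (n + 1) m with hX
  have hstack : ∀ i, i + c ∈ stack n m ↔ i ∈ stack n m := fun i => by
    rw [mem_stack, mem_stack, hc, init_add_single_last]
  have hXs : X ⊆ stack n m := by rw [hX, pyramid_eq_layer hn]; exact layer_subset_stack
  have hcX : ∀ i, i + c ∈ completion n m t ↔ i ∈ X := fun i => by
    rw [hX, pyramid_eq_layer hn, completion_eq_layer hn, hc, add_single_mem_layer]
    congr! 2; ring
  have hD : ∀ s u i, liftScalars d s u (i + c) = liftScalars d s u i := fun s u i =>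
    liftScalars_add_single d s u (t - 1) i
  have hD' : ∀ s u i, liftScalars d s u (i + -c) = liftScalars d s u i := fun s u i => by
    rw [← hD, neg_add_cancel_right]
  have hconv : ∀ (s u : Fin (n + 1)) i, i + -c ∈ X → i + step (n + 1) s ∈ stack n m →
      i + step (n + 1) s + step (n + 1) u + -c ∈ X → i + step (n + 1) s + -c ∈ X := by
    intro s u i h0 h1 h2
    rw [← hcX, neg_add_cancel_right, completion_eq_layer hn] at h0 h2 ⊢
    exact layer_convex s u h0 h1 h2
  have r1 := ((isCubicRep_smash (d := d)).map (IdealQuot.mkHom (k := k) (outsideIdempotents n m d t))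
    (map_zero _)).translate c
  have h1 : ∀ r ∈ pyramidRel (n + 1) m (liftScalars d), r1.hom k X r = 0 := by
    refine IsCubicRep.hom_cubicRel _ (fun s u i hus hC => ?_) fun u i _ _ _ => ?_
    · rw [← map_mul, ← map_mul, ← map_smul, ← hD, add_right_comm i (step _ s) c,
        add_right_comm i (step _ u) c]
      refine congrArg _ (smash_comm hus fun S hS => ?_)
      rw [add_right_comm, hstack]
      exact hXs (hC S hS)
    · rw [← map_mul, add_right_comm, smash_sq, map_zero]
  have r2 := isCubicRep_translate (pyramidRel (n + 1) m (liftScalars d)) (-c)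
  have h2 : ∀ v, ∀ r ∈ stableRel n m d, liftMap k _ _ v r = 0 :=
    liftMap_stableRel r2 (fun s u i hus hC => by
      obtain ⟨h0, h1, h2, h3⟩ := (cubeIn_pair_iff hus.ne).1 hC
      rw [← hD', add_right_comm i (step _ s) (-c), add_right_comm i (step _ u) (-c)]
      -- By convexity the whole square lies in the pyramid unless its start or its end is missing;
      -- in that case both composites vanish.
      by_cases hi : i + -c ∈ X ∧ i + -c + step (n + 1) s + step (n + 1) u ∈ X
      · have e1 := hi.2
        rw [add_right_comm i, add_right_comm _ (-c)] at e1
        refine cubicRel_comm hus ((cubeIn_pair_iff hus.ne).2 ⟨hi.1, ?_, ?_, hi.2⟩)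
        · rw [add_right_comm]; exact hconv s u i hi.1 h1 e1
        · rw [add_right_comm]; exact hconv u s i hi.1 h2 (by rwa [add_right_comm i])
      · rw [← IdealQuot.mk_mul, ← IdealQuot.mk_mul, arrowAt_mul_arrowAt_eq_zero hi,
          arrowAt_mul_arrowAt_eq_zero (by rwa [add_right_comm (i + -c)]), map_zero, smul_zero])
      (fun u i => by rw [add_right_comm]; exact cubicRel_sq _ _)
  have hmem : ∀ i ∉ X, IdealQuot.mk k (outsideIdempotents n m d t)
      (smashIdem n m d (i + c)) = 0 := fun i hi => by
    by_cases hs : i + c ∈ stack n m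
    · exact IdealQuot.mk_of_mem ⟨i + c, hs, fun h => hi ((hcX i).1 h), rfl⟩
    · rw [smashIdem, idemAt_of_notMem (fun h => hs (mem_stack.2 h)), map_zero, map_zero, map_zero]
  have v1 : ∀ i, r1.hom k X (idemAt (n + 1) X i) = IdealQuot.mk k (outsideIdempotents n m d t)
      (smashIdem n m d (i + c)) := fun i => by
    by_cases hi : i ∈ X
    · exact r1.hom_idemAt hi
    · rw [idemAt_of_notMem hi, map_zero, hmem i hi]
  have v2 : ∀ s i, r1.hom k X (arrowAt (n + 1) X s i) =
      IdealQuot.mk k (outsideIdempotents n m d t) (smashArrow n m d s (i + c)) := fun s i => by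
    by_cases hi : i ∈ X ∧ i + step (n + 1) s ∈ X
    · exact r1.hom_arrowAt hi.1 hi.2
    · rw [arrowAt_of_notMem hi, map_zero]
      -- An arrow with a missing end factors through the idempotent there, which is zero in the
      -- quotient.
      by_cases h0 : i ∈ X
      · rw [← isCubicRep_smash.left, IdealQuot.mk_mul, add_right_comm,
          hmem _ fun h => hi ⟨h0, h⟩, zero_mul]
      · rw [← isCubicRep_smash.right, IdealQuot.mk_mul, hmem _ h0, mul_zero]
  have h3 : ∀ x ∈ outsideIdempotents n m d t, smashHom r2 h2 x = 0 := by
    rintro _ ⟨i, hi, hi', rfl⟩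
    refine (smashHom_smashIdem r2 h2 hi).trans ?_
    rw [idemAt_of_notMem, map_zero]
    rw [← hX, ← hcX, neg_add_cancel_right]
    exact hi'
  have e1 : (IdealQuot.lift _ _ h3).comp (IdealQuot.lift _ _ h1) =
      NonUnitalAlgHom.id k (NextAlg n m d) := by
    refine bound_hom_ext (fun i hi => ?_) fun s i hi hi' => ?_
    · rw [NonUnitalAlgHom.comp_apply, IdealQuot.lift_mk, v1, IdealQuot.lift_mk,
        smashHom_smashIdem r2 h2 ((hstack i).2 (hXs hi)), add_neg_cancel_right]
      rfl
    · rw [NonUnitalAlgHom.comp_apply, IdealQuot.lift_mk, v2, IdealQuot.lift_mk,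
        smashHom_smashArrow r2 h2 ((hstack i).2 (hXs hi))
          (by rw [add_right_comm, hstack]; exact hXs hi'), add_neg_cancel_right]
      rfl
  -- Stated on the smash product before passing to the quotient; together with the surjectivity of
  -- the quotient map this gives surjectivity.
  have e2 : (IdealQuot.lift _ _ h1).comp (smashHom r2 h2) =
      IdealQuot.mkHom (outsideIdempotents n m d t) := by
    refine smash_hom_ext (fun i hi => ?_) fun s i hi hi' => ?_
    · rw [NonUnitalAlgHom.comp_apply, smashHom_smashIdem r2 h2 hi, IdealQuot.lift_mk, v1,
        neg_add_cancel_right]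
      rfl
    · rw [NonUnitalAlgHom.comp_apply, smashHom_smashArrow r2 h2 hi hi', IdealQuot.lift_mk, v2,
        neg_add_cancel_right]
      rfl
  refine ⟨IdealQuot.lift _ _ h1, ⟨?_, ?_⟩, v1, v2⟩
  · exact Function.LeftInverse.injective (g := IdealQuot.lift _ _ h3) (DFunLike.congr_fun e1)
  · intro x
    obtain ⟨x, rfl⟩ := IdealQuot.mk_surjective k _ x
    exact ⟨_, DFunLike.congr_fun e2 x⟩

end SmashQuotient

/-! ### Coordinates of the pyramid by partitions -/

section Partitions

variable {n : ℕ}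

/-- The partitions with `n + 1` parts of size at most `M`. -/
def Part (n : ℕ) (M : ℤ) : Set (Fin (n + 1) → ℤ) := {a | Antitone a ∧ ∀ t, 0 ≤ a t ∧ a t ≤ M}

/-- The point of the pyramid that is reached from its source by `a t` arrows of each type `t`. -/
def point (a : Fin (n + 1) → ℤ) : Fin (n + 1) → ℤ := move (fun _ => 1) a

/-- In these coordinates all steps are unit vectors, so the pyramid quiver becomes the Young lattice
of partitions inside a rectangle. -/
theorem point_add_single (a : Fin (n + 1) → ℤ) (t : Fin (n + 1)) :
    point (a + Pi.single t 1) = point a + step (n + 1) t := by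
  funext s
  simp only [point, move, step, Pi.add_apply, Pi.single_apply, Fin.ext_iff]
  by_cases h : (s : ℕ) + 1 < n + 1
  · rw [dif_pos h, dif_pos h]; ring
  · have h' : ¬ (s : ℕ) + 1 = t := by omega
    rw [dif_neg h, dif_neg h, if_neg h']; ring

theorem point_add_sum (a : Fin (n + 1) → ℤ) (S : Finset (Fin (n + 1))) :
    point (a + ∑ u ∈ S, Pi.single u 1) = point a + ∑ u ∈ S, step (n + 1) u := by
  induction S using Finset.induction_on with
  | empty => simp
  | insert u S hu ih =>
    rw [Finset.sum_insert hu, Finset.sum_insert hu, add_comm (Pi.single u 1), ← add_assoc,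
      point_add_single, ih, add_assoc, add_comm (step (n + 1) u)]

theorem point_castSucc (a : Fin (n + 1) → ℤ) (s : Fin n) :
    point a s.castSucc = 1 + a s.castSucc - a s.succ := by
  simp only [point, move, Fin.val_castSucc]
  rw [dif_pos (by omega)]
  rfl

theorem point_last (a : Fin (n + 1) → ℤ) : point a (Fin.last n) = 1 + a (Fin.last n) := by
  simp [point, move]

theorem point_injective : Function.Injective (point (n := n)) := by
  intro a b h
  funext s
  induction s using Fin.reverseInduction with
  | last =>
    have := congrFun h (Fin.last n)
    rw [point_last, point_last] at this
    omega
  | cast s ih =>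
    have := congrFun h s.castSucc
    rw [point_castSucc, point_castSucc] at this
    omega

theorem point_surjective : Function.Surjective (point (n := n)) := by
  intro x
  -- The entry `x s - 1` is the difference of two consecutive entries of `a`, so `a` consists of the
  -- tail sums of `x - 1`.
  refine ⟨fun t => ∑ u ∈ Finset.Ici t, (x u - 1), ?_⟩
  funext s
  refine Fin.lastCases ?_ (fun s => ?_) s
  · rw [point_last]
    have : Finset.Ici (Fin.last n) = {Fin.last n} := by
      ext u; simp [Fin.last_le_iff]
    rw [this, Finset.sum_singleton]; ring
  · rw [point_castSucc]
    have h : Finset.Ici s.castSucc = insert s.castSucc (Finset.Ici s.succ) := by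
      ext u
      simp only [Finset.mem_Ici, Finset.mem_insert, Fin.le_def, Fin.ext_iff, Fin.val_castSucc,
        Fin.val_succ]
      omega
    rw [h, Finset.sum_insert (by simp [Fin.le_def])]
    ring

/-- Coordinates at least 1 mean that `a` is weakly decreasing with nonnegative last entry. The
coordinate sum is `n + 1 + a 0`, so the bound `m + n` on it reads `a 0 ≤ m - 1`. -/
theorem point_mem_pyramid {m : ℕ} {a : Fin (n + 1) → ℤ} :
    point a ∈ pyramid (n + 1) m ↔ a ∈ Part n ((m : ℤ) - 1) := by
  rw [mem_pyramid_succ, point, sum_move]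
  have e : (∀ t, 1 ≤ point a t) ↔ Antitone a ∧ 0 ≤ a (Fin.last n) := by
    rw [Fin.forall_fin_succ' (n := n), Fin.antitone_iff_succ_le, point_last]
    refine and_congr (forall_congr' fun s => ?_) ?_
    · rw [point_castSucc]; omega
    · omega
  refine (and_congr_left' e).trans ?_
  simp only [Finset.sum_const, Finset.card_univ, Fintype.card_fin, nsmul_eq_mul, mul_one]
  constructor
  · rintro ⟨⟨h1, h2⟩, h3⟩
    refine ⟨h1, fun t => ⟨h2.trans (h1 (Fin.le_last t)), (h1 (Fin.zero_le t)).trans ?_⟩⟩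
    push_cast at h3
    omega
  · rintro ⟨h1, h2⟩
    refine ⟨⟨h1, (h2 _).1⟩, ?_⟩
    have := (h2 0).2
    push_cast
    omega

variable {M : ℤ}

theorem Part.sup {a b : Fin (n + 1) → ℤ} (ha : a ∈ Part n M) (hb : b ∈ Part n M) :
    a ⊔ b ∈ Part n M :=
  ⟨ha.1.sup hb.1, fun t => ⟨le_sup_of_le_left (ha.2 t).1, sup_le (ha.2 t).2 (hb.2 t).2⟩⟩

theorem Part.inf {a b : Fin (n + 1) → ℤ} (ha : a ∈ Part n M) (hb : b ∈ Part n M) :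
    a ⊓ b ∈ Part n M :=
  ⟨ha.1.inf hb.1, fun t => ⟨le_inf (ha.2 t).1 (hb.2 t).1, inf_le_of_left_le (ha.2 t).2⟩⟩

theorem Part.finite (n : ℕ) (M : ℤ) : (Part n M).Finite :=
  (Set.finite_Icc (fun _ => (0 : ℤ)) (fun _ => M)).subset fun _ h =>
    ⟨fun t => (h.2 t).1, fun t => (h.2 t).2⟩

/-- `t` is the largest index at which `a` does not vanish. -/
def IsTop (a : Fin (n + 1) → ℤ) (t : Fin (n + 1)) : Prop := a t ≠ 0 ∧ ∀ u, t < u → a u = 0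

theorem IsTop.unique {a : Fin (n + 1) → ℤ} {s t : Fin (n + 1)} (hs : IsTop a s)
    (ht : IsTop a t) : s = t := by
  rcases lt_trichotomy s t with h | h | h
  · exact absurd (hs.2 t h) ht.1
  · exact h
  · exact absurd (ht.2 s h) hs.1

theorem exists_isTop {a : Fin (n + 1) → ℤ} {s : Fin (n + 1)} (h : a s ≠ 0) :
    ∃ t, IsTop a t ∧ s ≤ t := by
  classical
  have hne : (Finset.univ.filter fun t => a t ≠ 0).Nonempty := ⟨s, by simpa using h⟩
  refine ⟨Finset.max' _ hne, ⟨?_, fun u hu => ?_⟩, Finset.le_max' _ _ (by simpa using h)⟩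
  · simpa using Finset.max'_mem _ hne
  · by_contra hu'
    exact absurd (Finset.le_max' _ u (by simpa using hu')) (not_le.2 hu)

/-- In the lowest row where `c` exceeds `a` the last box can be removed: the rows below are those of
`a`, hence at most `a r`, which is less than `c r`. -/
theorem Part.sub_top {a c : Fin (n + 1) → ℤ} (ha : a ∈ Part n M) (hc : c ∈ Part n M) (hac : a ≤ c)
    {r : Fin (n + 1)} (hr : IsTop (c - a) r) : c - Pi.single r 1 ∈ Part n M := by
  have hr1 : a r < c r := lt_of_le_of_ne (hac r) fun h => hr.1 (by simp [h])
  have hr2 : ∀ u, r < u → c u = a u := fun u hu => by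
    have := hr.2 u hu
    simp only [Pi.sub_apply] at this
    omega
  refine ⟨fun s t hst => ?_, fun t => ?_⟩
  · have h1 := hc.1 hst
    have h2 := ha.1 hst
    simp only [Pi.sub_apply, Pi.single_apply]
    by_cases h : s = r
    · subst h
      by_cases h' : t = s
      · subst h'; omega
      · have := hr2 t (lt_of_le_of_ne hst (Ne.symm h'))
        rw [if_neg h', if_pos rfl]
        omega
    · rw [if_neg h]
      split_ifs <;> omega
  · have h1 := hc.2 t
    have h2 := (ha.2 t).1
    simp only [Pi.sub_apply, Pi.single_apply]
    split_ifs with h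
    · subst h; omega
    · omega

theorem Part.zero_mem (hM : 0 ≤ M) : (0 : Fin (n + 1) → ℤ) ∈ Part n M :=
  ⟨fun _ _ _ => le_rfl, fun _ => ⟨le_rfl, hM⟩⟩

theorem Part.nonneg {a : Fin (n + 1) → ℤ} (ha : a ∈ Part n M) : 0 ≤ M :=
  (ha.2 0).1.trans (ha.2 0).2

theorem Part.sub_top_zero {a : Fin (n + 1) → ℤ} (ha : a ∈ Part n M) {r : Fin (n + 1)}
    (hr : IsTop a r) : a - Pi.single r 1 ∈ Part n M :=
  Part.sub_top (Part.zero_mem (Part.nonneg ha)) ha (fun t => (ha.2 t).1) (by rwa [sub_zero])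

theorem Part.add_sum {a : Fin (n + 1) → ℤ} (ha : a ∈ Part n M) (S : Finset (Fin (n + 1)))
    (hS : ∀ u ∈ S, a + Pi.single u 1 ∈ Part n M) : a + ∑ u ∈ S, Pi.single u 1 ∈ Part n M := by
  induction S using Finset.induction_on with
  | empty => simpa using ha
  | insert u S hu ih =>
    have h1 := ih fun v hv => hS v (Finset.mem_insert_of_mem hv)
    have h2 := hS u (Finset.mem_insert_self u S)
    -- Adding boxes in distinct rows is a join, and partitions are closed under joins.
    have e : a + ∑ v ∈ insert u S, Pi.single v 1 =
        (a + ∑ v ∈ S, Pi.single v 1) ⊔ (a + Pi.single u 1) := by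
      funext t
      have h0 : ∀ v, (0 : ℤ) ≤ (Pi.single v 1 : Fin (n + 1) → ℤ) t := fun v => by
        rw [Pi.single_apply]; split_ifs <;> simp
      simp only [Finset.sum_insert hu, Pi.add_apply, Pi.sup_apply, Finset.sum_apply]
      by_cases ht : t = u
      · subst ht
        rw [Finset.sum_eq_zero (s := S)]
        · have := h0 t
          rw [sup_eq_right.2] <;> omega
        · intro v hv
          rw [Pi.single_eq_of_ne]
          rintro rfl
          exact hu hv
      · have := Finset.sum_nonneg (s := S) fun v _ => h0 v
        rw [Pi.single_eq_of_ne ht, sup_eq_left.2] <;> omega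
    rw [e]
    exact Part.sup h1 h2

/-- Every corner of a cube is a join of the start and its neighbours, so only these have to be
tested. -/
theorem cubeIn_point {m : ℕ} {a : Fin (n + 1) → ℤ} {T : Finset (Fin (n + 1))}
    (ha : a ∈ Part n ((m : ℤ) - 1)) (hT : ∀ u ∈ T, a + Pi.single u 1 ∈ Part n ((m : ℤ) - 1)) :
    CubeIn (pyramid (n + 1) m) T (point a) := by
  intro S hS
  rw [← point_add_sum, point_mem_pyramid]
  exact Part.add_sum ha S fun u hu => hT u (hS hu)

theorem IsTop.add_single {a : Fin (n + 1) → ℤ} {r s : Fin (n + 1)} (hr : IsTop a r) (hs : s < r) :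
    IsTop (a + Pi.single s 1) r := by
  refine ⟨?_, fun u hu => ?_⟩
  · rw [Pi.add_apply, Pi.single_eq_of_ne hs.ne', add_zero]; exact hr.1
  · rw [Pi.add_apply, Pi.single_eq_of_ne (hs.trans hu).ne', add_zero]; exact hr.2 u hu

theorem Part.sub_top_add {a : Fin (n + 1) → ℤ} {r s : Fin (n + 1)} (hr : IsTop a r) (hs : s < r)
    (h : a + Pi.single s 1 ∈ Part n M) : a - Pi.single r 1 + Pi.single s 1 ∈ Part n M := by
  have := Part.sub_top_zero h (hr.add_single hs)
  rwa [add_sub_right_comm] at this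

theorem sum_single (t : Fin (n + 1)) : ∑ s, (Pi.single t 1 : Fin (n + 1) → ℤ) s = 1 := by
  rw [Finset.sum_pi_single']; simp

end Partitions

/-! ### Untwisting -/

section Gauge

variable {k : Type u} [Field k] {n m : ℕ} (D : Fin (n + 1) → Fin (n + 1) → (Fin (n + 1) → ℤ) → k)

open Classical in
/-- Auxiliary recursion for `gauge`. -/
def gaugeAux : ℕ → Fin (n + 1) → (Fin (n + 1) → ℤ) → k
  | 0, _, _ => 1
  | f + 1, t, a =>
    if h : ∃ r, IsTop a r ∧ t < r then
      D h.choose t (point (a - Pi.single h.choose 1)) *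
        gaugeAux f t (a - Pi.single h.choose 1)
    else 1

/-- Factors by which the arrows are multiplied to make all squares commute. -/
def gauge (t : Fin (n + 1)) (a : Fin (n + 1) → ℤ) : k := gaugeAux D (∑ s, a s).toNat t a

/-- The recursion has as much fuel as `a` has boxes and uses one unit for each box it removes; the
row it chooses is the lowest nonempty one, which is unique. -/
theorem gauge_of_top {M : ℤ} {a : Fin (n + 1) → ℤ} (ha : a ∈ Part n M) {r t : Fin (n + 1)}
    (hr : IsTop a r) (htr : t < r) : gauge D t a =
      D r t (point (a - Pi.single r 1)) * gauge D t (a - Pi.single r 1) := by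
  have hex : ∃ r, IsTop a r ∧ t < r := ⟨r, hr, htr⟩
  have hpos := Finset.sum_nonneg fun s (_ : s ∈ Finset.univ) => ((Part.sub_top_zero ha hr).2 s).1
  have hsum : ∑ s, (a - Pi.single r 1 : Fin (n + 1) → ℤ) s = ∑ s, a s - 1 := by
    simp only [Pi.sub_apply, Finset.sum_sub_distrib, sum_single]
  rw [hsum] at hpos
  have e : (∑ s, a s).toNat = (∑ s, (a - Pi.single r 1 : Fin (n + 1) → ℤ) s).toNat + 1 := by rw [hsum]; omega
  rw [gauge, e, gaugeAux, dif_pos hex, hex.choose_spec.1.unique hr]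
  rfl

theorem gauge_eq_one {t : Fin (n + 1)} {a : Fin (n + 1) → ℤ} (h : ∀ u, t < u → a u = 0) :
    gauge D t a = 1 := by
  rw [gauge]
  cases (∑ s, a s).toNat with
  | zero => rfl
  | succ f =>
    rw [gaugeAux, dif_neg]
    rintro ⟨r, hr, htr⟩
    exact hr.1 (h r htr)

/-- Induction on the number of boxes that removes boxes in the order in which `gauge` does. -/
theorem part_induction {M : ℤ} {C : (Fin (n + 1) → ℤ) → Prop}
    (h : ∀ a ∈ Part n M, (∀ r, IsTop a r → C (a - Pi.single r 1)) → C a) :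
    ∀ a ∈ Part n M, C a := by
  have key : ∀ (f : ℕ) (a : Fin (n + 1) → ℤ), a ∈ Part n M → (∑ s, a s) < f → C a := by
    intro f
    induction f with
    | zero =>
      intro a ha hf
      have := Finset.sum_nonneg fun s (_ : s ∈ Finset.univ) => (ha.2 s).1
      push_cast at hf
      omega
    | succ f ih =>
      intro a ha hf
      refine h a ha fun r hr => ih _ (Part.sub_top_zero ha hr) ?_
      simp only [Pi.sub_apply, Finset.sum_sub_distrib, sum_single]
      push_cast at hf
      omega
  intro a ha
  have h0 := Finset.sum_nonneg fun s (_ : s ∈ Finset.univ) => (ha.2 s).1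
  exact key ((∑ s, a s).toNat + 1) a ha (by push_cast; omega)

variable {D}

theorem gauge_ne_zero (hD : IsTwist (pyramid (n + 1) m) D) (t : Fin (n + 1)) :
    ∀ a ∈ Part n ((m : ℤ) - 1), a + Pi.single t 1 ∈ Part n ((m : ℤ) - 1) → gauge D t a ≠ 0 := by
  refine part_induction fun a ha ih hat => ?_
  by_cases h : ∃ r, IsTop a r ∧ t < r
  · obtain ⟨r, hr, htr⟩ := h
    have h2 := Part.sub_top_add hr htr hat
    rw [gauge_of_top D ha hr htr]
    refine mul_ne_zero (hD.ne_zero r t _ htr (cubeIn_point (Part.sub_top_zero ha hr) ?_)) (ih r hr h2)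
    intro u hu
    rw [Finset.mem_insert, Finset.mem_singleton] at hu
    rcases hu with rfl | rfl
    · rwa [sub_add_cancel]
    · exact h2
  · rw [gauge_eq_one]
    · exact one_ne_zero
    · intro u hu
      by_contra hu'
      obtain ⟨r, hr, hur⟩ := exists_isTop hu'
      exact h ⟨r, hr, hu.trans_le hur⟩

/-- This is the commutation of the rescaled arrows. If a row `r > s` is the lowest nonempty one,
removing a box from it changes the four factors by scalars of type `r`, which the cube condition at
`a - e_r` compares. If all rows below `s` are empty, then `D s t` is exactly the factor that the
recursion produces when the last box of row `s` is removed from `a + e_s`. -/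
theorem gauge_square (hD : IsTwist (pyramid (n + 1) m) D) {s t : Fin (n + 1)} (hts : t < s) :
    ∀ a ∈ Part n ((m : ℤ) - 1), a + Pi.single t 1 ∈ Part n ((m : ℤ) - 1) →
      a + Pi.single s 1 ∈ Part n ((m : ℤ) - 1) →
      gauge D t (a + Pi.single s 1) * gauge D s a =
        gauge D s (a + Pi.single t 1) * gauge D t a * D s t (point a) := by
  refine part_induction fun a ha ih hat has => ?_
  by_cases h : ∃ r, IsTop a r ∧ s < r
  · obtain ⟨r, hr, hsr⟩ := h
    have htr := hts.trans hsr
    have h1 := Part.sub_top_add hr htr hat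
    have h2 := Part.sub_top_add hr hsr has
    have ih := ih r hr h1 h2
    have hc : CubeIn (pyramid (n + 1) m) {r, s, t} (point (a - Pi.single r 1)) := by
      refine cubeIn_point (Part.sub_top_zero ha hr) fun u hu => ?_
      rw [Finset.mem_insert, Finset.mem_insert, Finset.mem_singleton] at hu
      rcases hu with rfl | rfl | rfl
      · rwa [sub_add_cancel]
      · exact h2
      · exact h1
    have hcomp := hD.compatible r s t _ hts hsr hc
    rw [← point_add_single, ← point_add_single, ← point_add_single, sub_add_cancel] at hcomp
    have hne : D s t (point (a - Pi.single r 1)) ≠ 0 :=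
      hD.ne_zero s t _ hts (cubeIn_point (Part.sub_top_zero ha hr) (by simp [h1, h2]))
    rw [gauge_of_top D has (hr.add_single hsr) htr, gauge_of_top D ha hr hsr,
      gauge_of_top D hat (hr.add_single htr) hsr, gauge_of_top D ha hr htr, add_sub_right_comm,
      add_sub_right_comm]
    -- The induction hypothesis and the cube condition both carry the factor `D s t` at `a - e_r`,
    -- so the identity is proved after multiplication by it.
    refine mul_left_cancel₀ hne ?_
    linear_combination (gauge D s (a - Pi.single r 1 + Pi.single t 1) *
      gauge D t (a - Pi.single r 1) * D s t (point (a - Pi.single r 1))) * (-hcomp) +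
      D s t (point (a - Pi.single r 1)) * D r t (point (a - Pi.single r 1 + Pi.single s 1)) *
        D r s (point (a - Pi.single r 1)) * ih
  · have h0 : ∀ u, s < u → a u = 0 := by
      intro u hu
      by_contra hu'
      obtain ⟨r, hr, hur⟩ := exists_isTop hu'
      exact h ⟨r, hr, hu.trans_le hur⟩
    have hs : IsTop (a + Pi.single s 1) s := by
      refine ⟨?_, fun u hu => ?_⟩
      · rw [Pi.add_apply, Pi.single_eq_same]
        have := (ha.2 s).1
        omega
      · rw [Pi.add_apply, Pi.single_eq_of_ne hu.ne', h0 u hu, add_zero]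
    rw [gauge_of_top D has hs hts, gauge_eq_one D h0, gauge_eq_one D (t := s) (a := a + _),
      add_sub_cancel_right]
    · ring
    · intro u hu
      rw [Pi.add_apply, Pi.single_eq_of_ne (hts.trans hu).ne', h0 u hu, add_zero]

end Gauge

/-! ### A multiplicative basis of a pyramid algebra -/

section Basis

/-- The pairs `(c, a)` of partitions such that `c - a` has entries `0` and `1` only. -/
def Cub {n : ℕ} (M : ℤ) (c a : Fin (n + 1) → ℤ) : Prop :=
  a ∈ Part n M ∧ c ∈ Part n M ∧ ∀ t, a t ≤ c t ∧ c t ≤ a t + 1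

variable {k : Type u} [Field k] {n m : ℕ}
  {D : Fin (n + 1) → Fin (n + 1) → (Fin (n + 1) → ℤ) → k}

/-- The vertex of the pyramid quiver with given partition. -/
def vertex {a : Fin (n + 1) → ℤ} (ha : a ∈ Part n ((m : ℤ) - 1)) :
    Vert (n + 1) (pyramid (n + 1) m) := ⟨point a, point_mem_pyramid.2 ha⟩

/-- The partition of a vertex of the pyramid quiver. -/
def co (v : Vert (n + 1) (pyramid (n + 1) m)) : Fin (n + 1) → ℤ := (point_surjective v.val).choose

theorem point_co (v : Vert (n + 1) (pyramid (n + 1) m)) : point (co v) = v.val :=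
  (point_surjective v.val).choose_spec

theorem co_mem (v : Vert (n + 1) (pyramid (n + 1) m)) : co v ∈ Part n ((m : ℤ) - 1) := by
  rw [← point_mem_pyramid, point_co]; exact v.mem

theorem co_vertex {a : Fin (n + 1) → ℤ} (ha : a ∈ Part n ((m : ℤ) - 1)) : co (vertex ha) = a :=
  point_injective (point_co _)

theorem co_injective {v w : Vert (n + 1) (pyramid (n + 1) m)} (h : co v = co w) : v = w := by
  have : v.val = w.val := by rw [← point_co, ← point_co, h]
  cases v; cases w
  simpa using this

theorem vertex_co (v : Vert (n + 1) (pyramid (n + 1) m)) : vertex (co_mem v) = v :=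
  co_injective (co_vertex _)

theorem co_hom {v w : Vert (n + 1) (pyramid (n + 1) m)} (e : v ⟶ w) :
    co w = co v + Pi.single e.1 1 := by
  apply point_injective
  rw [point_add_single, point_co, point_co]
  exact e.2

/-- The arrow of type `t` between two vertices. -/
def homOf {v w : Vert (n + 1) (pyramid (n + 1) m)} (t : Fin (n + 1))
    (h : co w = co v + Pi.single t 1) : v ⟶ w :=
  ⟨t, by rw [← point_co, ← point_co, h, point_add_single]⟩

theorem length_path {v w : Vert (n + 1) (pyramid (n + 1) m)} (p : Quiver.Path v w) :
    (p.length : ℤ) = ∑ t, (co w t - co v t) := by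
  induction p with
  | nil => simp
  | cons p e ih =>
    rw [Quiver.Path.length_cons, co_hom e]
    simp only [Pi.add_apply, add_sub_right_comm, Finset.sum_add_distrib, sum_single]
    push_cast
    rw [ih]

theorem le_of_path {v w : Vert (n + 1) (pyramid (n + 1) m)} (p : Quiver.Path v w) :
    co v ≤ co w := by
  induction p with
  | nil => exact le_rfl
  | cons p e ih =>
    rw [co_hom e]
    exact ih.trans (le_add_of_nonneg_right (Pi.single_nonneg.2 zero_le_one))

/-- The box in the lowest row where the ends differ can be added last; this normal form of paths
drives the inductions below. -/
theorem exists_last_arrow {v w : Vert (n + 1) (pyramid (n + 1) m)} (h : co v ≤ co w) {r}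
    (hr : IsTop (co w - co v) r) :
    ∃ z : Vert (n + 1) (pyramid (n + 1) m), co w = co z + Pi.single r 1 ∧ co v ≤ co z := by
  refine ⟨vertex (Part.sub_top (co_mem v) (co_mem w) h hr), ?_, fun t => ?_⟩
  · rw [co_vertex, sub_add_cancel]
  · rw [co_vertex, Pi.sub_apply, Pi.single_apply]
    have h1 : co v t ≤ co w t := h t
    change co v t ≤ _
    split_ifs with ht
    · have := hr.1
      subst ht
      simp only [Pi.sub_apply] at this
      omega
    · omega

theorem nonempty_path {v : Vert (n + 1) (pyramid (n + 1) m)} (f : ℕ) :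
    ∀ w : Vert (n + 1) (pyramid (n + 1) m), co v ≤ co w → ∑ t, (co w t - co v t) ≤ f →
      Nonempty (Quiver.Path v w) := by
  induction f with
  | zero =>
    intro w h hf
    have h0 := (Finset.sum_eq_zero_iff_of_nonneg (s := Finset.univ)
      (f := fun t => co w t - co v t) (fun t _ => sub_nonneg.2 (h t))).1
      (le_antisymm hf (Finset.sum_nonneg fun t _ => sub_nonneg.2 (h t)))
    have : v = w := co_injective (funext fun t => by have := h0 t (Finset.mem_univ t); omega)
    subst this
    exact ⟨Quiver.Path.nil⟩
  | succ f ih =>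
    intro w h hf
    by_cases hvw : v = w
    · subst hvw; exact ⟨Quiver.Path.nil⟩
    · have : ∃ s, (co w - co v) s ≠ 0 := by
        by_contra hs
        push Not at hs
        exact hvw (co_injective (funext fun t => by
          have := hs t; simp only [Pi.sub_apply] at this; omega))
      obtain ⟨s, hs⟩ := this
      obtain ⟨r, hr, -⟩ := exists_isTop hs
      obtain ⟨z, hz, hvz⟩ := exists_last_arrow h hr
      obtain ⟨p⟩ := ih z hvz (by
        rw [hz] at hf
        simp only [Pi.add_apply, add_sub_right_comm, Finset.sum_add_distrib, sum_single] at hf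
        push_cast at hf
        omega)
      exact ⟨p.cons (homOf r hz)⟩

theorem exists_path {v w : Vert (n + 1) (pyramid (n + 1) m)} (h : co v ≤ co w) :
    Nonempty (Quiver.Path v w) :=
  nonempty_path (∑ t, (co w t - co v t)).toNat w h (Int.self_le_toNat _)

variable (D) in
/-- The factor by which a path differs from the product of the rescaled arrows. -/
def weight {v : Vert (n + 1) (pyramid (n + 1) m)} :
    ∀ {w : Vert (n + 1) (pyramid (n + 1) m)}, Quiver.Path v w → k
  | _, Quiver.Path.nil => 1
  | _, @Quiver.Path.cons _ _ _ b _ p e => (gauge D e.1 (co b))⁻¹ * weight p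

theorem weight_comp {u v w : Vert (n + 1) (pyramid (n + 1) m)} (p : Quiver.Path u v)
    (q : Quiver.Path v w) : weight D (p.comp q) = weight D q * weight D p := by
  induction q with
  | nil => rw [Quiver.Path.comp_nil, weight, one_mul]
  | cons q e ih => rw [Quiver.Path.comp_cons, weight, weight, ih, mul_assoc]

theorem weight_ne_zero (hD : IsTwist (pyramid (n + 1) m) D) {v w : Vert (n + 1) (pyramid (n + 1) m)} (p : Quiver.Path v w) :
    weight D p ≠ 0 := by
  induction p with
  | nil => exact one_ne_zero
  | @cons b c p e ih =>
    refine mul_ne_zero (inv_ne_zero (gauge_ne_zero hD _ _ (co_mem b) ?_)) ih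
    rw [← co_hom e]; exact co_mem c

variable (m D) in
/-- The rescaled arrow of type `t`. -/
def rescaled (t : Fin (n + 1)) (a : Fin (n + 1) → ℤ) : PyramidAlg (n + 1) m D :=
  gauge D t a • IdealQuot.mk k (pyramidRel (n + 1) m D)
    (arrowAt (n + 1) (pyramid (n + 1) m) t (point a))

theorem rescaled_comm_of_lt (hD : IsTwist (pyramid (n + 1) m) D) {s t : Fin (n + 1)} (hts : t < s)
    {a : Fin (n + 1) → ℤ} (ha : a ∈ Part n ((m : ℤ) - 1))
    (has : a + Pi.single s 1 ∈ Part n ((m : ℤ) - 1))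
    (hat : a + Pi.single t 1 ∈ Part n ((m : ℤ) - 1)) :
    rescaled m D t (a + Pi.single s 1) * rescaled m D s a =
      rescaled m D s (a + Pi.single t 1) * rescaled m D t a := by
  have h : CubeIn (pyramid (n + 1) m) {s, t} (point a) := cubeIn_point ha (by simp [has, hat])
  have hc : D s t (point a) • _ = _ := cubicRel_comm hts h
  simp only [rescaled, smul_mul_smul_comm, point_add_single]
  rw [gauge_square hD hts a ha hat has, mul_smul]
  exact congrArg _ hc

theorem rescaled_comm (hD : IsTwist (pyramid (n + 1) m) D) {s t : Fin (n + 1)} (hst : s ≠ t)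
    {a : Fin (n + 1) → ℤ} (ha : a ∈ Part n ((m : ℤ) - 1))
    (has : a + Pi.single s 1 ∈ Part n ((m : ℤ) - 1))
    (hat : a + Pi.single t 1 ∈ Part n ((m : ℤ) - 1)) :
    rescaled m D t (a + Pi.single s 1) * rescaled m D s a =
      rescaled m D s (a + Pi.single t 1) * rescaled m D t a := by
  rcases lt_or_gt_of_ne hst with h | h
  · exact (rescaled_comm_of_lt hD h ha hat has).symm
  · exact rescaled_comm_of_lt hD h ha has hat

theorem rescaled_sq (t : Fin (n + 1)) (a : Fin (n + 1) → ℤ) :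
    rescaled m D t (a + Pi.single t 1) * rescaled m D t a = 0 := by
  simp only [rescaled, smul_mul_smul_comm, point_add_single]
  have h : IdealQuot.mk k (pyramidRel (n + 1) m D) _ * IdealQuot.mk k (pyramidRel (n + 1) m D) _ =
    0 := cubicRel_sq t (point a)
  rw [h, smul_zero]

variable (D) in
/-- The product of the rescaled arrows of a path. -/
def monomial {v w : Vert (n + 1) (pyramid (n + 1) m)} (p : Quiver.Path v w) :
    PyramidAlg (n + 1) m D := (weight D p)⁻¹ • pathClass (pyramidRel (n + 1) m D) p

theorem pathClass_comp {V : Type} [Quiver.{0} V] (ρ : Set (PathAlg k V)) {a b c : V}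
    (p : Quiver.Path a b) (q : Quiver.Path b c) :
    pathClass ρ (p.comp q) = pathClass ρ q * pathClass ρ p := by
  rw [pathClass, pathClass, pathClass, ← IdealQuot.mk_mul, ofPath_mul_ofPath]

theorem pathClass_mul_of_ne {V : Type} [Quiver.{0} V] (ρ : Set (PathAlg k V)) {a b c d : V}
    (p : Quiver.Path a b) (q : Quiver.Path c d) (h : b ≠ c) :
    pathClass ρ q * pathClass ρ p = 0 := by
  rw [pathClass, pathClass, ← IdealQuot.mk_mul, ofPath_mul_ofPath_of_ne k _ _ h, map_zero]

theorem monomial_comp {u v w : Vert (n + 1) (pyramid (n + 1) m)} (p : Quiver.Path u v)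
    (q : Quiver.Path v w) : monomial D (p.comp q) = monomial D q * monomial D p := by
  rw [monomial, monomial, monomial, weight_comp, pathClass_comp, smul_mul_smul_comm, mul_inv]

theorem monomial_cons {u v w : Vert (n + 1) (pyramid (n + 1) m)} (p : Quiver.Path u v)
    (e : v ⟶ w) : monomial D (p.cons e) = rescaled m D e.1 (co v) * monomial D p := by
  have : p.cons e = p.comp e.toPath := rfl
  rw [this, monomial_comp, monomial]
  congr 1
  rw [rescaled, point_co, arrowAt_of_hom, Quiver.Hom.toPath, weight, weight, mul_one, inv_inv]
  rfl

/-- Induction on the length. If the last arrows have different types, the meet of their sources is a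
partition above the start. By induction both paths may be rerouted through it, and then they differ
by one commuting square. -/
theorem monomial_unique (hD : IsTwist (pyramid (n + 1) m) D) (f : ℕ) :
    ∀ {v w : Vert (n + 1) (pyramid (n + 1) m)} (p q : Quiver.Path v w), p.length = f →
      monomial D p = monomial D q := by
  induction f with
  | zero =>
    intro v w p q hp
    have hq : q.length = 0 := by
      have h1 := length_path p
      have h2 := length_path q
      omega
    have hvw := Quiver.Path.eq_of_length_zero p hp
    subst hvw
    rw [Quiver.Path.eq_nil_of_length_zero p hp, Quiver.Path.eq_nil_of_length_zero q hq]
  | succ f ih =>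
    intro v w p q hp
    have hq : q.length = f + 1 := by
      have h1 := length_path p
      have h2 := length_path q
      omega
    cases p with
    | nil => simp at hp
    | @cons b _ p e =>
      cases q with
      | nil => simp at hq
      | @cons b' _ q e' =>
        simp only [Quiver.Path.length_cons, add_left_inj] at hp hq
        have h1 := co_hom e
        have h2 := co_hom e'
        rw [monomial_cons, monomial_cons]
        by_cases hee : e.1 = e'.1
        · have hb : b = b' := co_injective (by
            rw [h1, hee] at h2
            exact add_right_cancel h2)
          subst hb
          rw [ih p q hp, hee]
        · have hne : e.1 ≠ e'.1 := hee
          -- Each source lacks one box of the common end, in different rows; their meet lacks both.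
          have hz : co b - Pi.single e'.1 1 = co b ⊓ co b' := by
            funext t
            have ht : co b t + (Pi.single e.1 1 : Fin (n + 1) → ℤ) t =
              co b' t + (Pi.single e'.1 1 : Fin (n + 1) → ℤ) t := congrFun (h1.symm.trans h2) t
            simp only [Pi.sub_apply, Pi.inf_apply, Pi.single_apply] at ht ⊢
            split_ifs at ht ⊢ with h3 h4 h4
            · exact absurd (h4.symm.trans h3) hne
            all_goals
              first
              | (rw [inf_eq_left.2] <;> omega)
              | (rw [inf_eq_right.2] <;> omega)
          have hzP : co b - Pi.single e'.1 1 ∈ Part n ((m : ℤ) - 1) := by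
            rw [hz]; exact Part.inf (co_mem b) (co_mem b')
          obtain ⟨z, hcz⟩ : ∃ z : Vert (n + 1) (pyramid (n + 1) m), co z = co b - Pi.single e'.1 1 :=
            ⟨_, co_vertex hzP⟩
          have hvz : co v ≤ co z := by
            rw [hcz, hz]; exact le_inf (le_of_path p) (le_of_path q)
          obtain ⟨r⟩ := exists_path hvz
          have hzb : co b = co z + Pi.single e'.1 1 := by rw [hcz, sub_add_cancel]
          have hzb' : co b' = co z + Pi.single e.1 1 := by
            refine add_right_cancel (b := Pi.single e'.1 1) ?_
            rw [← h2, h1, hzb]; abel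
          rw [ih p (r.cons (homOf _ hzb)) hp, ih q (r.cons (homOf _ hzb')) hq, monomial_cons,
            monomial_cons, ← mul_assoc, ← mul_assoc, hzb, hzb']
          congr 1
          refine rescaled_comm hD (Ne.symm hne) (co_mem _) ?_ ?_
          · rw [← hzb]; exact co_mem _
          · rw [← hzb']; exact co_mem _

theorem monomial_eq (hD : IsTwist (pyramid (n + 1) m) D)
    {v w : Vert (n + 1) (pyramid (n + 1) m)} (p q : Quiver.Path v w) :
    monomial D p = monomial D q := monomial_unique hD _ p q rfl

/-- By uniqueness the path may be chosen to fill the lowest differing row last. Either it is already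
zero before its last arrow, by induction, or that row is the one that grows by two, and the path can
be chosen to end in two arrows of the same type. -/
theorem monomial_eq_zero (hD : IsTwist (pyramid (n + 1) m) D) {v : Vert (n + 1) (pyramid (n + 1) m)}
    (f : ℕ) : ∀ {w : Vert (n + 1) (pyramid (n + 1) m)} (p : Quiver.Path v w), p.length = f →
      ¬ Cub ((m : ℤ) - 1) (co w) (co v) → monomial D p = 0 := by
  induction f with
  | zero =>
    intro w p hp hc
    have := Quiver.Path.eq_of_length_zero p hp
    subst this
    exact absurd ⟨co_mem v, co_mem v, fun t => ⟨le_rfl, by omega⟩⟩ hc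
  | succ f ih =>
    intro w p hp hc
    have hle := le_of_path p
    have : ∃ s, co v s + 1 < co w s := by
      by_contra h
      push Not at h
      exact hc ⟨co_mem v, co_mem w, fun t => ⟨hle t, h t⟩⟩
    obtain ⟨s, hs⟩ := this
    obtain ⟨r, hr, hsr⟩ := exists_isTop (a := co w - co v) (s := s) (by
      simp only [Pi.sub_apply]; omega)
    obtain ⟨z, hz, hvz⟩ := exists_last_arrow hle hr
    obtain ⟨q⟩ := exists_path hvz
    rw [monomial_eq hD p (q.cons (homOf r hz)), monomial_cons]
    change rescaled m D r (co z) * _ = 0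
    by_cases hcz : Cub ((m : ℤ) - 1) (co z) (co v)
    -- The last arrow changes row `r` only, so a row that becomes overfull with this arrow must be
    -- `r`.
    · have hrs : s = r := by
        by_contra hne
        have h1 := (hcz.2.2 s).2
        rw [hz, Pi.add_apply, Pi.single_eq_of_ne hne] at hs
        omega
      subst hrs
      have htop : IsTop (co z - co v) s := by
        have e : co z - co v = co w - co v - Pi.single s 1 := by rw [hz]; abel
        rw [e]
        refine ⟨?_, fun u hu => ?_⟩
        · simp only [Pi.sub_apply, Pi.single_eq_same]; omega
        · rw [Pi.sub_apply, Pi.single_eq_of_ne hu.ne', hr.2 u hu, sub_zero]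
      obtain ⟨z', hz', hvz'⟩ := exists_last_arrow hvz htop
      obtain ⟨q'⟩ := exists_path hvz'
      rw [monomial_eq hD q (q'.cons (homOf s hz')), monomial_cons, ← mul_assoc, hz']
      change rescaled m D s _ * rescaled m D s _ * _ = 0
      rw [rescaled_sq, zero_mul]
    · have hq : q.length = f := by
        have h1 := length_path p
        have h2 := length_path q
        rw [hz] at h1
        simp only [Pi.add_apply, add_sub_right_comm, Finset.sum_add_distrib, sum_single] at h1
        omega
      rw [ih q hq hcz, mul_zero]

open Classical in
variable (m D) in
/-- The basis element of the pyramid algebra from the vertex `a` to the vertex `c`. -/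
def basisElt (c a : Fin (n + 1) → ℤ) : PyramidAlg (n + 1) m D :=
  if h : Cub ((m : ℤ) - 1) c a then
    monomial D (exists_path (v := vertex h.1) (w := vertex h.2.1) (by
      rw [co_vertex, co_vertex]; exact fun t => (h.2.2 t).1)).some
  else 0

theorem basisElt_eq_zero {c a : Fin (n + 1) → ℤ} (h : ¬ Cub ((m : ℤ) - 1) c a) :
    basisElt m D c a = 0 := dif_neg h

theorem monomial_eq_basisElt (hD : IsTwist (pyramid (n + 1) m) D)
    {v w : Vert (n + 1) (pyramid (n + 1) m)} (p : Quiver.Path v w) :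
    monomial D p = basisElt m D (co w) (co v) := by
  by_cases h : Cub ((m : ℤ) - 1) (co w) (co v)
  · rw [basisElt, dif_pos h]
    have key : ∀ {v' w' : Vert (n + 1) (pyramid (n + 1) m)} (q : Quiver.Path v' w'), v' = v →
        w' = w → monomial D p = monomial D q := by
      rintro v' w' q rfl rfl
      exact monomial_eq hD p q
    exact key _ (vertex_co v) (vertex_co w)
  · rw [basisElt_eq_zero h, monomial_eq_zero hD _ p rfl h]

theorem pathClass_eq (hD : IsTwist (pyramid (n + 1) m) D)
    {v w : Vert (n + 1) (pyramid (n + 1) m)} (p : Quiver.Path v w) :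
    pathClass (pyramidRel (n + 1) m D) p = weight D p • basisElt m D (co w) (co v) := by
  rw [← monomial_eq_basisElt hD p, monomial, smul_inv_smul₀ (weight_ne_zero hD p)]

theorem basisElt_self (hD : IsTwist (pyramid (n + 1) m) D)
    (v : Vert (n + 1) (pyramid (n + 1) m)) : basisElt m D (co v) (co v) =
      pathClass (pyramidRel (n + 1) m D) (Quiver.Path.nil : Quiver.Path v v) := by
  rw [pathClass_eq hD, weight, one_smul]

theorem exists_basisElt_eq (hD : IsTwist (pyramid (n + 1) m) D) {c a : Fin (n + 1) → ℤ}
    (h : Cub ((m : ℤ) - 1) c a) : ∃ (v w : Vert (n + 1) (pyramid (n + 1) m))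
      (p : Quiver.Path v w), co v = a ∧ co w = c ∧ basisElt m D c a = monomial D p := by
  obtain ⟨p⟩ := exists_path (v := vertex h.1) (w := vertex h.2.1) (by
    rw [co_vertex, co_vertex]; exact fun t => (h.2.2 t).1)
  refine ⟨_, _, p, co_vertex _, co_vertex _, ?_⟩
  rw [monomial_eq_basisElt hD, co_vertex, co_vertex]

/-- If the two strips meet in a row, the composite grows there by two and the right-hand side is
zero by definition. -/
theorem basisElt_mul (hD : IsTwist (pyramid (n + 1) m) D) {c b a : Fin (n + 1) → ℤ}
    (hcb : Cub ((m : ℤ) - 1) c b) (hba : Cub ((m : ℤ) - 1) b a) :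
    basisElt m D c b * basisElt m D b a = basisElt m D c a := by
  obtain ⟨v, w, p, rfl, rfl, h⟩ := exists_basisElt_eq hD hcb
  obtain ⟨u, v', q, rfl, hv, h'⟩ := exists_basisElt_eq hD hba
  obtain rfl := co_injective hv
  rw [h, h', ← monomial_comp, monomial_eq_basisElt hD]

theorem basisElt_mul_of_ne (hD : IsTwist (pyramid (n + 1) m) D) (c a : Fin (n + 1) → ℤ)
    {b b' : Fin (n + 1) → ℤ} (hb : b ≠ b') : basisElt m D c b * basisElt m D b' a = 0 := by
  by_cases hcb : Cub ((m : ℤ) - 1) c b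
  · by_cases hba : Cub ((m : ℤ) - 1) b' a
    · obtain ⟨v, w, p, rfl, rfl, h⟩ := exists_basisElt_eq hD hcb
      obtain ⟨u, v', q, rfl, rfl, h'⟩ := exists_basisElt_eq hD hba
      rw [h, h', monomial, monomial, smul_mul_smul_comm, pathClass_mul_of_ne, smul_zero]
      rintro rfl
      exact hb rfl
    · rw [basisElt_eq_zero hba, mul_zero]
  · rw [basisElt_eq_zero hcb, zero_mul]

open Classical in
variable (D) in
/-- The coefficient of a path at the basis elements. -/
def freeCoef : PathAlg k (Vert (n + 1) (pyramid (n + 1) m)) →ₗ[k]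
    ((Fin (n + 1) → ℤ) × (Fin (n + 1) → ℤ) →₀ k) :=
  pathLift (fun x => if Cub ((m : ℤ) - 1) (co x.2.1) (co x.1) then
    Finsupp.single (co x.2.1, co x.1) (weight D x.2.2) else 0)

open Classical in
theorem freeCoef_ofPath {v w : Vert (n + 1) (pyramid (n + 1) m)} (p : Quiver.Path v w) :
    freeCoef D (ofPath k p) = if Cub ((m : ℤ) - 1) (co w) (co v) then
      Finsupp.single (co w, co v) (weight D p) else 0 := pathLift_ofPath _ p

theorem freeCoef_of_forall {x : PathAlg k (Vert (n + 1) (pyramid (n + 1) m))}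
    (h : ∀ (a b c d : Vert (n + 1) (pyramid (n + 1) m)) (p : Quiver.Path a b)
      (q : Quiver.Path c d), freeCoef D (ofPath k q * x * ofPath k p) = 0) : freeCoef D x = 0 := by
  let _ := Fintype.ofFinite (Vert (n + 1) (pyramid (n + 1) m))
  rw [← sum_idem_mul x, ← mul_sum_idem ((∑ a, idem k a) * x), Finset.mul_sum, map_sum]
  refine Finset.sum_eq_zero fun a _ => ?_
  rw [Finset.sum_mul, Finset.sum_mul, map_sum]
  exact Finset.sum_eq_zero fun b _ => h _ _ _ _ _ _

theorem exists_arrow_pair {s t : Fin (n + 1)} {i : Fin (n + 1) → ℤ}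
    (h0 : i ∈ pyramid (n + 1) m) (h1 : i + step (n + 1) s ∈ pyramid (n + 1) m)
    (h2 : i + step (n + 1) s + step (n + 1) t ∈ pyramid (n + 1) m) :
    ∃ p : Quiver.Path (⟨i, h0⟩ : Vert (n + 1) (pyramid (n + 1) m)) ⟨_, h2⟩,
      arrowAt (n + 1) (pyramid (n + 1) m) t (i + step (n + 1) s) *
        arrowAt (n + 1) (pyramid (n + 1) m) s i = ofPath k p ∧
      weight D p = (gauge D t (co (⟨_, h1⟩ : Vert (n + 1) (pyramid (n + 1) m))))⁻¹ *
        (gauge D s (co (⟨_, h0⟩ : Vert (n + 1) (pyramid (n + 1) m))))⁻¹ := by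
  refine ⟨(stepArrow s i h0 h1).toPath.comp (stepArrow t _ h1 h2).toPath, ?_, ?_⟩
  · rw [arrowAt, arrowAt, dif_pos ⟨h1, h2⟩, dif_pos ⟨h0, h1⟩, ofPath_mul_ofPath]
  · rw [weight_comp]
    simp only [Quiver.Hom.toPath, weight, mul_one]
    rfl

/-- This is the linear independence of the basis. The weights of the two sides of a square have the
ratio prescribed by the twist, by `gauge_square`, and a path with two consecutive arrows of one type
has ends that are not a basis pair. Demanding zero coefficients after multiplication by paths on
both sides defines an ideal. -/
theorem freeCoef_eq_zero (hD : IsTwist (pyramid (n + 1) m) D)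
    {x : PathAlg k (Vert (n + 1) (pyramid (n + 1) m))}
    (hx : x ∈ idealSpan k (pyramidRel (n + 1) m D)) : freeCoef D x = 0 := by
  let J : Submodule k (PathAlg k (Vert (n + 1) (pyramid (n + 1) m))) :=
    { carrier := {x | ∀ (a b c d : Vert (n + 1) (pyramid (n + 1) m)) (p : Quiver.Path a b)
        (q : Quiver.Path c d), freeCoef D (ofPath k q * x * ofPath k p) = 0}
      zero_mem' := by intro a b c d p q; simp
      add_mem' := by
        intro x y hx hy a b c d p q
        rw [mul_add, add_mul, map_add, hx, hy, add_zero]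
      smul_mem' := by
        intro r x hx a b c d p q
        rw [mul_smul_comm, smul_mul_assoc, map_smul, hx, smul_zero] }
  have hJ : ∀ a, ∀ x ∈ J, a * x ∈ J ∧ x * a ∈ J := by
    intro y x hx
    induction y using pathAlg_induction with
    | zero => simp
    | add y z hy hz =>
      rw [add_mul, mul_add]
      exact ⟨J.add_mem hy.1 hz.1, J.add_mem hy.2 hz.2⟩
    | smul c y hy =>
      rw [smul_mul_assoc, mul_smul_comm]
      exact ⟨J.smul_mem c hy.1, J.smul_mem c hy.2⟩
    | path a' b' r =>
      constructor
      · intro a b c d p q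
        by_cases h : b' = c
        · subst h
          rw [← mul_assoc, ofPath_mul_ofPath]
          exact hx _ _ _ _ _ _
        · rw [← mul_assoc, ofPath_mul_ofPath_of_ne k _ _ h, zero_mul, zero_mul, map_zero]
      · intro a b c d p q
        by_cases h : b = a'
        · subst h
          rw [mul_assoc, mul_assoc, ofPath_mul_ofPath, ← mul_assoc]
          exact hx _ _ _ _ _ _
        · rw [mul_assoc, mul_assoc, ofPath_mul_ofPath_of_ne k _ _ h, mul_zero, mul_zero, map_zero]
  have hρ : pyramidRel (n + 1) m D ⊆ J := by
    have hmul : ∀ {a b c d u v : Vert (n + 1) (pyramid (n + 1) m)} (p : Quiver.Path a b)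
        (q : Quiver.Path c d) (r : Quiver.Path u v), (b ≠ u ∨ v ≠ c) →
        ofPath k q * ofPath k r * ofPath k p = 0 := by
      intro a b c d u v p q r h
      rcases h with h | h
      · rw [mul_assoc, ofPath_mul_ofPath_of_ne k _ _ h, mul_zero]
      · rw [ofPath_mul_ofPath_of_ne k _ _ h, zero_mul]
    rintro r (⟨s, t, i, hts, hc, rfl⟩ | ⟨t, i, h0, h1, h2, rfl⟩)
    · obtain ⟨h0, h1, h2, h3⟩ := (cubeIn_pair_iff hts.ne).1 hc
      have h3' : i + step (n + 1) t + step (n + 1) s ∈ pyramid (n + 1) m := by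
        rwa [add_right_comm]
      obtain ⟨p1, e1, w1⟩ := exists_arrow_pair (k := k) (D := D) h0 h1 h3
      obtain ⟨p2, e2, w2⟩ := exists_arrow_pair (k := k) (D := D) h0 h2 h3'
      -- The two composites of a square end at the same vector with its summands in different order;
      -- keeping the ends as variables allows the equation to be substituted.
      have key : ∀ {v w w' : Vert (n + 1) (pyramid (n + 1) m)} (p1 : Quiver.Path v w)
          (p2 : Quiver.Path v w'), w = w' → D s t i * weight D p1 = weight D p2 →
          D s t i • ofPath k p1 - ofPath k p2 ∈ J := by
        rintro v w _ p1 p2 rfl hw a b c d p q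
        rw [mul_sub, sub_mul, mul_smul_comm, smul_mul_assoc]
        by_cases hh : b ≠ v ∨ w ≠ c
        · rw [hmul p q p1 hh, hmul p q p2 hh, smul_zero, sub_zero, map_zero]
        · push Not at hh
          obtain ⟨rfl, rfl⟩ := hh
          rw [ofPath_mul_ofPath, ofPath_mul_ofPath, ofPath_mul_ofPath, ofPath_mul_ofPath, map_sub,
            map_smul, freeCoef_ofPath, freeCoef_ofPath]
          split_ifs with hcub
          · rw [Finsupp.smul_single, ← Finsupp.single_sub, weight_comp, weight_comp, weight_comp,
              weight_comp, ← hw, smul_eq_mul]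
            rw [show D s t i * (weight D q * weight D p1 * weight D p) -
              weight D q * (D s t i * weight D p1) * weight D p = 0 by ring, Finsupp.single_zero]
          · rw [smul_zero, sub_zero]
      rw [e1, e2]
      refine key p1 p2 (by simp only [add_right_comm]) ?_
      have v0 := point_co (⟨i, h0⟩ : Vert (n + 1) (pyramid (n + 1) m))
      have v1 : co (⟨_, h1⟩ : Vert (n + 1) (pyramid (n + 1) m)) = _ :=
        co_hom (stepArrow s i h0 h1)
      have v2 : co (⟨_, h2⟩ : Vert (n + 1) (pyramid (n + 1) m)) = _ :=
        co_hom (stepArrow t i h0 h2)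
      have hm := co_mem (⟨i, h0⟩ : Vert (n + 1) (pyramid (n + 1) m))
      have hm1 := co_mem (⟨_, h1⟩ : Vert (n + 1) (pyramid (n + 1) m))
      have hm2 := co_mem (⟨_, h2⟩ : Vert (n + 1) (pyramid (n + 1) m))
      have hm3 := co_mem (⟨_, h3⟩ : Vert (n + 1) (pyramid (n + 1) m))
      have v3 : co (⟨_, h3⟩ : Vert (n + 1) (pyramid (n + 1) m)) = _ :=
        co_hom (stepArrow t _ h1 h3)
      rw [v3, v1] at hm3
      rw [v1] at hm1
      rw [v2] at hm2
      simp only [stepArrow] at hm1 hm2 hm3 v1 v2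
      have hg := gauge_square hD hts _ hm hm2 hm1
      have g1 := gauge_ne_zero hD s _ hm hm1
      have g2 := gauge_ne_zero hD t _ hm hm2
      have g3 := gauge_ne_zero hD t _ hm1 hm3
      have g4 := gauge_ne_zero hD s _ hm2 (by rwa [add_right_comm])
      rw [w1, w2, v1, v2]
      rw [v0] at hg
      field_simp
      linear_combination -hg
    · obtain ⟨p, e, -⟩ := exists_arrow_pair (k := k) (D := D) h0 h1 h2
      rw [e]
      intro a b c d p' q
      by_cases hh : b ≠ ⟨i, h0⟩ ∨ ⟨_, h2⟩ ≠ c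
      · rw [hmul p' q p hh, map_zero]
      · push Not at hh
        obtain ⟨rfl, rfl⟩ := hh
        rw [ofPath_mul_ofPath, ofPath_mul_ofPath, freeCoef_ofPath, if_neg]
        rintro ⟨-, -, hcub⟩
        -- The two arrows raise row `t` by two, and the paths around them cannot lower it again.
        have l1 : co a t ≤ co (⟨i, h0⟩ : Vert (n + 1) (pyramid (n + 1) m)) t := le_of_path p' t
        have l2 := le_of_path q t
        have v1 : co (⟨_, h1⟩ : Vert (n + 1) (pyramid (n + 1) m)) = _ :=
          co_hom (stepArrow t i h0 h1)
        have v2 : co (⟨_, h2⟩ : Vert (n + 1) (pyramid (n + 1) m)) = _ :=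
          co_hom (stepArrow t _ h1 h2)
        rw [v2, v1] at l2
        simp only [stepArrow, Pi.add_apply, Pi.single_eq_same] at l2
        have := (hcub t).2
        omega
  exact freeCoef_of_forall (idealSpan_le hρ hJ hx)

/-- The coefficients at the basis elements. -/
def coef (hD : IsTwist (pyramid (n + 1) m) D) : PyramidAlg (n + 1) m D →ₗ[k]
    ((Fin (n + 1) → ℤ) × (Fin (n + 1) → ℤ) →₀ k) :=
  (idealSpan k (pyramidRel (n + 1) m D)).liftQ (freeCoef D) fun _ hx => freeCoef_eq_zero hD hx

open Classical in
theorem coef_pathClass (hD : IsTwist (pyramid (n + 1) m) D)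
    {v w : Vert (n + 1) (pyramid (n + 1) m)} (p : Quiver.Path v w) :
    coef hD (pathClass (pyramidRel (n + 1) m D) p) = if Cub ((m : ℤ) - 1) (co w) (co v) then
      Finsupp.single (co w, co v) (weight D p) else 0 := freeCoef_ofPath p

theorem coef_basisElt (hD : IsTwist (pyramid (n + 1) m) D) {c a : Fin (n + 1) → ℤ}
    (h : Cub ((m : ℤ) - 1) c a) : coef hD (basisElt m D c a) = Finsupp.single (c, a) 1 := by
  obtain ⟨v, w, p, rfl, rfl, e⟩ := exists_basisElt_eq hD h
  rw [e, monomial, map_smul, coef_pathClass, if_pos h, Finsupp.smul_single, smul_eq_mul,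
    inv_mul_cancel₀ (weight_ne_zero hD p)]

theorem sum_coef (hD : IsTwist (pyramid (n + 1) m) D) (x : PyramidAlg (n + 1) m D) :
    Finsupp.linearCombination k (fun q : (Fin (n + 1) → ℤ) × (Fin (n + 1) → ℤ) =>
      basisElt m D q.1 q.2) (coef hD x) = x := by
  obtain ⟨x, rfl⟩ := IdealQuot.mk_surjective k _ x
  induction x using pathAlg_induction with
  | zero => simp
  | add x y hx hy => rw [map_add, map_add, map_add, hx, hy]
  | smul c x hx => rw [map_smul, map_smul, map_smul, hx]
  | path v w p =>
    have h1 := coef_pathClass hD p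
    have h2 := pathClass_eq hD p
    change Finsupp.linearCombination k _ (coef hD (pathClass _ p)) = pathClass _ p
    rw [h1, h2]
    split_ifs with h
    · rw [Finsupp.linearCombination_single]
    · rw [map_zero, basisElt_eq_zero h, smul_zero]

end Basis

/-! ### Subspaces defined by the support with respect to the basis -/

section Support

variable {k : Type u} [Field k] {n m : ℕ}
  {D : Fin (n + 1) → Fin (n + 1) → (Fin (n + 1) → ℤ) → k} (hD : IsTwist (pyramid (n + 1) m) D)

theorem coef_injective : Function.Injective (coef hD) := fun x y h => by
  rw [← sum_coef hD x, ← sum_coef hD y, h]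

theorem basisElt_ne_zero (hD : IsTwist (pyramid (n + 1) m) D) {c a : Fin (n + 1) → ℤ}
    (h : Cub ((m : ℤ) - 1) c a) : basisElt m D c a ≠ 0 := fun h0 => by
  have := coef_basisElt hD h
  rw [h0, map_zero] at this
  exact one_ne_zero (Finsupp.single_eq_zero.1 this.symm)

/-- The elements with coefficients only at the pairs that satisfy `S`. -/
def suppSub (S : (Fin (n + 1) → ℤ) → (Fin (n + 1) → ℤ) → Prop) :
    Submodule k (PyramidAlg (n + 1) m D) :=
  (Finsupp.supported k k {q | S q.1 q.2}).comap (coef hD)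

variable {S T : (Fin (n + 1) → ℤ) → (Fin (n + 1) → ℤ) → Prop}

theorem mem_suppSub {x : PyramidAlg (n + 1) m D} :
    x ∈ suppSub hD S ↔ ∀ c a, coef hD x (c, a) ≠ 0 → S c a := by
  rw [suppSub, Submodule.mem_comap, Finsupp.mem_supported]
  constructor
  · intro h c a hca
    exact h (Finsupp.mem_support_iff.2 hca)
  · rintro h ⟨c, a⟩ hca
    exact h c a (Finsupp.mem_support_iff.1 hca)

theorem basisElt_mem_suppSub {c a : Fin (n + 1) → ℤ} (h : Cub ((m : ℤ) - 1) c a → S c a) :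
    basisElt m D c a ∈ suppSub hD S := by
  by_cases hc : Cub ((m : ℤ) - 1) c a
  · rw [mem_suppSub, coef_basisElt hD hc]
    intro c' a' h'
    rw [Finsupp.single_apply] at h'
    split_ifs at h' with he
    · obtain ⟨rfl, rfl⟩ := Prod.mk.inj he
      exact h hc
    · exact absurd rfl h'
  · rw [basisElt_eq_zero hc]; exact Submodule.zero_mem _

theorem suppSub_induction {C : PyramidAlg (n + 1) m D → Prop} {x : PyramidAlg (n + 1) m D}
    (hx : x ∈ suppSub hD S) (zero : C 0) (add : ∀ x y, C x → C y → C (x + y))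
    (basis : ∀ (r : k) c a, Cub ((m : ℤ) - 1) c a → S c a → C (r • basisElt m D c a)) : C x := by
  rw [← sum_coef hD x, Finsupp.linearCombination_apply, Finsupp.sum]
  refine Finset.sum_induction _ C add zero ?_
  rintro ⟨c, a⟩ hq
  by_cases hc : Cub ((m : ℤ) - 1) c a
  · exact basis _ c a hc ((mem_suppSub hD).1 hx c a (Finsupp.mem_support_iff.1 hq))
  · rw [basisElt_eq_zero hc, smul_zero]; exact zero

theorem mem_suppSub_cub (x : PyramidAlg (n + 1) m D) :
    x ∈ suppSub hD (Cub ((m : ℤ) - 1)) := by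
  rw [← sum_coef hD x, Finsupp.linearCombination_apply]
  exact Submodule.sum_mem _ fun q _ => Submodule.smul_mem _ _ (basisElt_mem_suppSub hD id)

theorem cub_of_coef_ne_zero {x : PyramidAlg (n + 1) m D} {c a : Fin (n + 1) → ℤ}
    (h : coef hD x (c, a) ≠ 0) : Cub ((m : ℤ) - 1) c a :=
  (mem_suppSub hD).1 (mem_suppSub_cub hD x) c a h

theorem basis_induction (hD : IsTwist (pyramid (n + 1) m) D)
    {C : PyramidAlg (n + 1) m D → Prop} (x : PyramidAlg (n + 1) m D)
    (zero : C 0) (add : ∀ x y, C x → C y → C (x + y))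
    (basis : ∀ (r : k) c a, Cub ((m : ℤ) - 1) c a → C (r • basisElt m D c a)) : C x :=
  suppSub_induction hD (mem_suppSub_cub hD x) zero add fun r c a h _ => basis r c a h

theorem degreePart_le (hD : IsTwist (pyramid (n + 1) m) D) (l : ℕ) :
    degreePart (pyramidRel (n + 1) m D) l ≤
      suppSub hD (fun c a => ∑ t, c t = ∑ t, a t + l) := by
  refine Submodule.span_le.2 ?_
  rintro _ ⟨v, w, p, rfl, rfl⟩
  rw [SetLike.mem_coe, pathClass_eq hD]
  refine Submodule.smul_mem _ _ (basisElt_mem_suppSub hD fun _ => ?_)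
  rw [length_path, Finset.sum_sub_distrib]
  ring

theorem basisElt_mem_degreePart (hD : IsTwist (pyramid (n + 1) m) D) {c a : Fin (n + 1) → ℤ}
    (h : Cub ((m : ℤ) - 1) c a) {l : ℕ} (hl : ∑ t, c t = ∑ t, a t + l) :
    basisElt m D c a ∈ degreePart (pyramidRel (n + 1) m D) l := by
  obtain ⟨v, w, p, rfl, rfl, e⟩ := exists_basisElt_eq hD h
  rw [e, monomial]
  refine Submodule.smul_mem _ _ (Submodule.subset_span ⟨v, w, p, ?_, rfl⟩)
  have := length_path p
  rw [Finset.sum_sub_distrib] at this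
  omega

theorem Cub.sum_le {M : ℤ} {c a : Fin (n + 1) → ℤ} (h : Cub M c a) :
    ∑ t, a t ≤ ∑ t, c t ∧ ∑ t, c t ≤ ∑ t, a t + (n + 1) := by
  constructor
  · exact Finset.sum_le_sum fun t _ => (h.2.2 t).1
  · have := Finset.sum_le_sum fun t (_ : t ∈ Finset.univ) => (h.2.2 t).2
    rw [Finset.sum_add_distrib] at this
    simpa using this

theorem degreePart_eq_bot (hD : IsTwist (pyramid (n + 1) m) D) {l : ℕ} (hl : n + 1 < l) :
    degreePart (pyramidRel (n + 1) m D) l = ⊥ := by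
  rw [eq_bot_iff]
  refine (degreePart_le hD l).trans fun x hx => ?_
  refine suppSub_induction hD (C := fun x => x ∈ (⊥ : Submodule k _)) hx (Submodule.zero_mem _)
    (fun _ _ => Submodule.add_mem _) fun r c a h hs => ?_
  have := h.sum_le.2
  omega

end Support

/-! ### The translation quiver -/

section TranslationQuiver

variable {k : Type u} [Field k] {n m : ℕ}
  {D : Fin (n + 1) → Fin (n + 1) → (Fin (n + 1) → ℤ) → k}

/-- All paths between two vertices are multiples of one basis element, and their length is the
difference of the numbers of boxes. -/
theorem homPart_eq (hD : IsTwist (pyramid (n + 1) m) D)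
    {v w : Vert (n + 1) (pyramid (n + 1) m)} {l : ℕ} {x : PyramidAlg (n + 1) m D}
    (hx : x ∈ homPart (pyramidRel (n + 1) m D) v w l) (h0 : x ≠ 0) :
    Cub ((m : ℤ) - 1) (co w) (co v) ∧ (∑ t, co w t = ∑ t, co v t + l) ∧
      ∃ r : k, r ≠ 0 ∧ x = r • basisElt m D (co w) (co v) := by
  have key : ∃ r : k, x = r • basisElt m D (co w) (co v) ∧
      (r ≠ 0 → ∑ t, co w t = ∑ t, co v t + l) := by
    refine Submodule.span_induction (p := fun x _ => ∃ r : k,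
      x = r • basisElt m D (co w) (co v) ∧ (r ≠ 0 → ∑ t, co w t = ∑ t, co v t + l))
      ?_ ?_ ?_ ?_ hx
    · rintro _ ⟨p, rfl, rfl⟩
      refine ⟨weight D p, pathClass_eq hD p, fun _ => ?_⟩
      rw [length_path, Finset.sum_sub_distrib]
      ring
    · exact ⟨0, (zero_smul k _).symm, fun h => absurd rfl h⟩
    · rintro _ _ _ _ ⟨r, rfl, hr⟩ ⟨s, rfl, hs⟩
      refine ⟨r + s, (add_smul r s _).symm, fun h => ?_⟩
      by_cases hr0 : r = 0
      · exact hs fun hs0 => h (by rw [hr0, hs0, add_zero])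
      · exact hr hr0
    · rintro s _ _ ⟨r, rfl, hr⟩
      refine ⟨s * r, (mul_smul s r _).symm, fun h => hr fun hr0 => h (by rw [hr0, mul_zero])⟩
  obtain ⟨r, rfl, hr⟩ := key
  have hr0 : r ≠ 0 := by rintro rfl; exact h0 (zero_smul k _)
  refine ⟨?_, hr hr0, r, hr0, rfl⟩
  by_contra hc
  exact h0 (by rw [basisElt_eq_zero hc, smul_zero])

variable (n m) in
/-- The vertices without translate. -/
def projectives : Set (Vert (n + 1) (pyramid (n + 1) m)) := {v | co v - 1 ∉ Part n ((m : ℤ) - 1)}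

variable (n m) in
/-- The vertices without inverse translate. -/
def injectives : Set (Vert (n + 1) (pyramid (n + 1) m)) := {v | co v + 1 ∉ Part n ((m : ℤ) - 1)}

variable (n m) in
/-- The translation of the pyramid quiver. -/
def translation : {v // v ∉ projectives n m} ≃ {v // v ∉ injectives n m} where
  toFun v := ⟨vertex (not_not.1 v.2), not_not.2 (by
    rw [co_vertex, sub_add_cancel]; exact co_mem _)⟩
  invFun v := ⟨vertex (not_not.1 v.2), not_not.2 (by
    rw [co_vertex, add_sub_cancel_right]; exact co_mem _)⟩
  left_inv v := Subtype.ext (co_injective (by simp only [co_vertex, sub_add_cancel]))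
  right_inv v := Subtype.ext (co_injective (by simp only [co_vertex, add_sub_cancel_right]))

theorem co_translation (v : {v // v ∉ projectives n m}) :
    co (translation n m v : Vert (n + 1) (pyramid (n + 1) m)) = co v.1 - 1 :=
  co_vertex (not_not.1 v.2)

theorem co_translation_symm (v : {v // v ∉ injectives n m}) :
    co ((translation n m).symm v : Vert (n + 1) (pyramid (n + 1) m)) = co v.1 + 1 :=
  co_vertex (not_not.1 v.2)

theorem cub_add_one {M : ℤ} {a : Fin (n + 1) → ℤ} (h : a ∈ Part n M) (h' : a + 1 ∈ Part n M) :
    Cub M (a + 1) a := ⟨h, h', fun t => ⟨by simp, by simp⟩⟩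

theorem isBoundPath_of_cub (hD : IsTwist (pyramid (n + 1) m) D)
    {v w : Vert (n + 1) (pyramid (n + 1) m)} (p : Quiver.Path v w)
    (h : Cub ((m : ℤ) - 1) (co w) (co v)) : IsBoundPath (pyramidRel (n + 1) m D) p := by
  rw [IsBoundPath, pathClass_eq hD]
  exact smul_ne_zero (weight_ne_zero hD p) (basisElt_ne_zero hD h)

theorem cub_of_isBoundPath (hD : IsTwist (pyramid (n + 1) m) D)
    {v w : Vert (n + 1) (pyramid (n + 1) m)} {p : Quiver.Path v w}
    (h : IsBoundPath (pyramidRel (n + 1) m D) p) : Cub ((m : ℤ) - 1) (co w) (co v) := by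
  by_contra hc
  exact h (by rw [pathClass_eq hD, basisElt_eq_zero hc, smul_zero])

/-- A vertical strip that starts or ends at one end of a full column strip can be completed to that
column on the other side. The product is a nonzero multiple of the basis element of the column, and
a column has `n + 1` boxes. -/
theorem isTranslationQuiver (hm : 2 ≤ m) (hD : IsTwist (pyramid (n + 1) m) D) :
    IsTranslationQuiver n (pyramidRel (n + 1) m D) (projectives n m) (injectives n m)
      (translation n m) where
  maximal := by
    intro a b p ⟨hb, hmax⟩
    have hc := cub_of_isBoundPath hD hb
    -- One column is removed from the end of the path; the join with 0 takes care of empty rows.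
    -- Adding a full column to the result gives a partition above the end, so the path extends to a
    -- bound path of length `n + 1`, and maximality makes both extensions trivial.
    have hα : (co b - 1) ⊔ 0 ∈ Part n ((m : ℤ) - 1) := by
      refine ⟨fun s t hst => ?_, fun t => ?_⟩
      · have := (co_mem b).1 hst
        simp only [Pi.sup_apply, Pi.sub_apply, Pi.one_apply, Pi.zero_apply]
        omega
      · have := (co_mem b).2 t
        simp only [Pi.sup_apply, Pi.sub_apply, Pi.one_apply, Pi.zero_apply]
        omega
    have hβ : (co b - 1) ⊔ 0 + 1 ∈ Part n ((m : ℤ) - 1) := by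
      refine ⟨fun s t hst => ?_, fun t => ?_⟩
      · have := (co_mem b).1 hst
        simp only [Pi.add_apply, Pi.sup_apply, Pi.sub_apply, Pi.one_apply, Pi.zero_apply]
        omega
      · have := (co_mem b).2 t
        simp only [Pi.add_apply, Pi.sup_apply, Pi.sub_apply, Pi.one_apply, Pi.zero_apply]
        omega
    have l1 : co (vertex hα) ≤ co a := by
      rw [co_vertex]
      intro t
      have h1 := (hc.2.2 t).2
      have h2 := ((co_mem a).2 t).1
      simp only [Pi.sup_apply, Pi.sub_apply, Pi.one_apply, Pi.zero_apply]
      omega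
    have l2 : co b ≤ co (vertex hβ) := by
      rw [co_vertex]
      intro t
      simp only [Pi.add_apply, Pi.sup_apply, Pi.sub_apply, Pi.one_apply, Pi.zero_apply]
      omega
    obtain ⟨q⟩ := exists_path l1
    obtain ⟨r⟩ := exists_path l2
    obtain ⟨hq, hr⟩ := hmax _ _ q r (isBoundPath_of_cub hD _ (by
      rw [co_vertex, co_vertex]; exact cub_add_one hα hβ))
    have e1 := congrArg co (Quiver.Path.eq_of_length_zero q hq)
    have e2 := congrArg co (Quiver.Path.eq_of_length_zero r hr)
    rw [co_vertex] at e1 e2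
    rw [e1] at e2
    constructor
    · have := length_path p
      rw [e2] at this
      simp only [Pi.add_apply, Pi.one_apply, add_sub_cancel_left, Finset.sum_const,
        Finset.card_univ, Fintype.card_fin, nsmul_eq_mul, mul_one] at this
      exact_mod_cast this
    · have hmem : b ∉ projectives n m := not_not.2 (by
        rw [e2, add_sub_cancel_right]; exact co_mem a)
      refine ⟨⟨b, hmem⟩, co_injective ?_, rfl⟩
      rw [co_translation, e2, add_sub_cancel_right]
  dependent := by
    intro i p q _ hq _ _ hli
    rw [LinearIndependent.pair_iff] at hli
    have := (hli (weight D q) (-weight D p) (by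
      rw [pathClass_eq hD p, pathClass_eq hD q, smul_smul, smul_smul, ← add_smul]
      rw [show weight D q * weight D p + -weight D p * weight D q = 0 by ring, zero_smul])).1
    exact weight_ne_zero hD q this
  extend_start := by
    intro i j t _ x hx h0
    obtain ⟨hc, hl, r, hr, rfl⟩ := homPart_eq hD hx h0
    have hi : co i.1 - 1 ∈ Part n ((m : ℤ) - 1) := not_not.1 i.2
    have hcj : Cub ((m : ℤ) - 1) (co j) (co (translation n m i).1) := by
      rw [co_translation]
      refine ⟨hi, co_mem j, fun s => ?_⟩
      have := hc.2.2 s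
      simp only [Pi.sub_apply, Pi.one_apply]
      omega
    have hci : Cub ((m : ℤ) - 1) (co i.1) (co (translation n m i).1) := by
      rw [co_translation]
      have := cub_add_one hi (by rw [sub_add_cancel]; exact co_mem _)
      rwa [sub_add_cancel] at this
    obtain ⟨q⟩ := exists_path (v := (translation n m i).1) (w := j) fun s => (hcj.2.2 s).1
    refine ⟨q, ?_, ?_⟩
    · have := length_path q
      rw [co_translation] at this
      simp only [Pi.sub_apply, Pi.one_apply, sub_sub_eq_add_sub, Finset.sum_sub_distrib,
        Finset.sum_add_distrib, Finset.sum_const, Finset.card_univ, Fintype.card_fin,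
        nsmul_eq_mul, mul_one] at this
      push_cast at this
      omega
    · rw [pathClass_eq hD, smul_mul_smul_comm, basisElt_mul hD hc hcj]
      exact smul_ne_zero (mul_ne_zero hr (weight_ne_zero hD q)) (basisElt_ne_zero hD hci)
  extend_end := by
    intro i j t _ x hx h0
    obtain ⟨hc, hl, r, hr, rfl⟩ := homPart_eq hD hx h0
    have hi : co i.1 + 1 ∈ Part n ((m : ℤ) - 1) := not_not.1 i.2
    have hcj : Cub ((m : ℤ) - 1) (co ((translation n m).symm i).1) (co j) := by
      rw [co_translation_symm]
      refine ⟨co_mem j, hi, fun s => ?_⟩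
      have := hc.2.2 s
      simp only [Pi.add_apply, Pi.one_apply]
      omega
    have hci : Cub ((m : ℤ) - 1) (co ((translation n m).symm i).1) (co i.1) := by
      rw [co_translation_symm]
      exact cub_add_one (co_mem _) hi
    obtain ⟨q⟩ := exists_path (w := ((translation n m).symm i).1) (v := j) fun s => (hcj.2.2 s).1
    refine ⟨q, ?_, ?_⟩
    · have := length_path q
      rw [co_translation_symm] at this
      simp only [Pi.add_apply, Pi.one_apply, Finset.sum_sub_distrib,
        Finset.sum_add_distrib, Finset.sum_const, Finset.card_univ, Fintype.card_fin,
        nsmul_eq_mul, mul_one] at this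
      push_cast at this
      omega
    · rw [pathClass_eq hD, smul_mul_smul_comm, basisElt_mul hD hcj hc]
      exact smul_ne_zero (mul_ne_zero (weight_ne_zero hD q) hr) (basisElt_ne_zero hD hci)

end TranslationQuiver

/-! ### The Koszul complex of a vertex -/

section Complex

variable {k : Type u} [Field k] {n m : ℕ}
  {D : Fin (n + 1) → Fin (n + 1) → (Fin (n + 1) → ℤ) → k} (hD : IsTwist (pyramid (n + 1) m) D)
  {o : Fin (n + 1) → ℤ}

/-- The cuboid at `o`, in partition coordinates: the partitions interlacing with `o`. -/
def Box (M : ℤ) (o v : Fin (n + 1) → ℤ) : Prop :=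
  ∀ t, o t ≤ v t ∧ v t ≤ M ∧ ∀ u, u < t → v t ≤ o u

theorem Box.mem {M : ℤ} {v : Fin (n + 1) → ℤ} (ho : o ∈ Part n M) (h : Box M o v) :
    v ∈ Part n M := by
  refine ⟨fun s t hst => ?_, fun t => ⟨(ho.2 t).1.trans (h t).1, (h t).2.1⟩⟩
  rcases hst.eq_or_lt with rfl | hst
  · exact le_rfl
  · exact ((h t).2.2 s hst).trans (h s).1

theorem Box.self {M : ℤ} (ho : o ∈ Part n M) : Box M o o :=
  fun t => ⟨le_rfl, (ho.2 t).2, fun _ hu => ho.1 hu.le⟩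

/-- The conditions on an entry of `v` involve that entry and `o` only: a cuboid is a product of
intervals. -/
theorem Box.of_forall {M : ℤ} {v : Fin (n + 1) → ℤ}
    (h : ∀ t, ∃ w, Box M o w ∧ w t = v t) : Box M o v := by
  intro t
  obtain ⟨w, hw, e⟩ := h t
  rw [← e]
  exact hw t

/-- The first entry of `v` is at most `M` and every later one is at most the preceding entry of `o`;
the last entry of `o` is nonnegative and is left over. This bounds the length of the resolution. -/
theorem Box.sum_le {M : ℤ} {v : Fin (n + 1) → ℤ} (ho : o ∈ Part n M) (h : Box M o v) :
    ∑ t, v t ≤ ∑ t, o t + M := by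
  rw [Fin.sum_univ_succ v, Fin.sum_univ_castSucc o]
  have h0 := (h 0).2.1
  have h1 := (ho.2 (Fin.last n)).1
  have h2 := Finset.sum_le_sum fun s (_ : s ∈ Finset.univ) =>
    (h (Fin.succ s)).2.2 (Fin.castSucc s) (Fin.castSucc_lt_succ)
  linarith

open Classical in
/-- The points of the cuboid at `o` at distance `l` from `o`. -/
def boxLevel (M : ℤ) (o : Fin (n + 1) → ℤ) (l : ℕ) : Finset (Fin (n + 1) → ℤ) :=
  (Part.finite n M).toFinset.filter fun v => Box M o v ∧ ∑ t, v t = ∑ t, o t + l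

open Classical in
theorem mem_boxLevel {M : ℤ} (ho : o ∈ Part n M) {l : ℕ} {v : Fin (n + 1) → ℤ} :
    v ∈ boxLevel M o l ↔ Box M o v ∧ ∑ t, v t = ∑ t, o t + l := by
  rw [boxLevel, Finset.mem_filter, Set.Finite.mem_toFinset]
  exact ⟨fun h => h.2, fun h => ⟨h.1.mem ho, h⟩⟩

variable (m D) in
/-- The sum of the idempotents of the points of the cuboid at distance `l`. -/
def levelIdem (o : Fin (n + 1) → ℤ) (l : ℕ) : PyramidAlg (n + 1) m D :=
  ∑ v ∈ boxLevel ((m : ℤ) - 1) o l, basisElt m D v v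

theorem Cub.self {M : ℤ} {a : Fin (n + 1) → ℤ} (ha : a ∈ Part n M) : Cub M a a :=
  ⟨ha, ha, fun t => ⟨le_rfl, by omega⟩⟩

theorem basisElt_mul_self (hD : IsTwist (pyramid (n + 1) m) D) (c a : Fin (n + 1) → ℤ) :
    basisElt m D c a * basisElt m D a a = basisElt m D c a := by
  by_cases h : Cub ((m : ℤ) - 1) c a
  · exact basisElt_mul hD h (Cub.self h.1)
  · rw [basisElt_eq_zero h, zero_mul]

open Classical in
theorem basisElt_mul_levelIdem (hD : IsTwist (pyramid (n + 1) m) D)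
    (c a : Fin (n + 1) → ℤ) (l : ℕ) :
    basisElt m D c a * levelIdem m D o l =
      if a ∈ boxLevel ((m : ℤ) - 1) o l then basisElt m D c a else 0 := by
  rw [levelIdem, Finset.mul_sum]
  split_ifs with h
  · rw [Finset.sum_eq_single a, basisElt_mul_self hD]
    · exact fun b _ hb => basisElt_mul_of_ne hD _ _ hb.symm
    · exact fun h' => absurd h h'
  · refine Finset.sum_eq_zero fun b hb => basisElt_mul_of_ne hD _ _ ?_
    rintro rfl
    exact h hb

variable (m D) in
/-- The projective module `⨁ Λ e_v`, `v` in the cuboid at distance `l` from `o`. -/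
def levelMod (o : Fin (n + 1) → ℤ) (l : ℕ) :
    Submodule (PyramidAlg (n + 1) m D) (PyramidAlg (n + 1) m D) where
  carrier := {x | x * levelIdem m D o l = x}
  zero_mem' := zero_mul _
  add_mem' := fun {x y} hx hy => by
    have hx : x * _ = x := hx
    have hy : y * _ = y := hy
    change (x + y) * _ = _
    rw [add_mul, hx, hy]
  smul_mem' := fun r x hx => by
    have hx : x * _ = x := hx
    change r * x * _ = r * x
    rw [mul_assoc, hx]

theorem mem_levelMod {l : ℕ} {x : PyramidAlg (n + 1) m D} :
    x ∈ levelMod m D o l ↔ x * levelIdem m D o l = x := Iff.rfl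

theorem mem_levelMod_iff {l : ℕ} {x : PyramidAlg (n + 1) m D} :
    x ∈ levelMod m D o l ↔ x ∈ suppSub hD (fun _ a => a ∈ boxLevel ((m : ℤ) - 1) o l) := by
  classical
  constructor
  · intro h
    rw [← mem_levelMod.1 h]
    refine basis_induction hD (C := fun x => x * levelIdem m D o l ∈ suppSub hD _) x ?_ ?_ ?_
    · rw [zero_mul]; exact Submodule.zero_mem _
    · intro x y hx hy
      rw [add_mul]; exact Submodule.add_mem _ hx hy
    · intro r c a _
      rw [smul_mul_assoc, basisElt_mul_levelIdem hD]
      split_ifs with ha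
      · exact Submodule.smul_mem _ _ (basisElt_mem_suppSub hD fun _ => ha)
      · rw [smul_zero]; exact Submodule.zero_mem _
  · intro h
    refine suppSub_induction hD (C := fun x => x ∈ levelMod m D o l) h (Submodule.zero_mem _)
      (fun _ _ => Submodule.add_mem _) fun r c a _ ha => ?_
    rw [mem_levelMod, smul_mul_assoc, basisElt_mul_levelIdem hD, if_pos ha]

theorem mul_levelIdem_mem (hD : IsTwist (pyramid (n + 1) m) D) (l : ℕ)
    (x : PyramidAlg (n + 1) m D) : x * levelIdem m D o l ∈ levelMod m D o l := by
  classical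
  refine basis_induction hD (C := fun x => x * levelIdem m D o l ∈ levelMod m D o l) x ?_ ?_ ?_
  · rw [zero_mul]; exact Submodule.zero_mem _
  · intro x y hx hy
    rw [add_mul]; exact Submodule.add_mem _ hx hy
  · intro r c a _
    rw [smul_mul_assoc, basisElt_mul_levelIdem hD]
    split_ifs with ha
    · rw [mem_levelMod, smul_mul_assoc, basisElt_mul_levelIdem hD, if_pos ha]
    · rw [smul_zero]; exact Submodule.zero_mem _

/-- Right multiplication by the idempotent `levelIdem` retracts the free module of rank one onto
this submodule. -/
theorem levelMod_projective (hD : IsTwist (pyramid (n + 1) m) D) (l : ℕ) :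
    Module.Projective (PyramidAlg (n + 1) m D) (levelMod m D o l) := by
  refine Module.Projective.of_split (levelMod m D o l).subtype
    ((LinearMap.toSpanSingleton (PyramidAlg (n + 1) m D) (PyramidAlg (n + 1) m D)
      (levelIdem m D o l)).codRestrict _ fun x => mul_levelIdem_mem hD l x) ?_
  ext x
  exact mem_levelMod.1 x.2

/-- The sign of the arrow of type `t` at `v` in the Koszul complex. -/
def koszulSign (k : Type u) [Field k] (o v : Fin (n + 1) → ℤ) (t : Fin (n + 1)) : k :=
  (-1) ^ (∑ u ∈ Finset.Iio t, (v u - o u))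

theorem koszulSign_add_of_lt (v : Fin (n + 1) → ℤ) {s t : Fin (n + 1)} (h : s < t) :
    koszulSign k o (v + Pi.single s 1) t = -koszulSign k o v t := by
  have : ∑ u ∈ Finset.Iio t, ((v + Pi.single s 1 : Fin (n + 1) → ℤ) u - o u) =
      ∑ u ∈ Finset.Iio t, (v u - o u) + 1 := by
    simp only [Pi.add_apply, add_sub_right_comm, Finset.sum_add_distrib, Finset.sum_pi_single',
      Finset.mem_Iio, h, if_true]
  rw [koszulSign, this, zpow_add₀ (neg_ne_zero.2 one_ne_zero), zpow_one, koszulSign]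
  ring

theorem koszulSign_add_of_le (v : Fin (n + 1) → ℤ) {s t : Fin (n + 1)} (h : t ≤ s) :
    koszulSign k o (v + Pi.single s 1) t = koszulSign k o v t := by
  have : ∑ u ∈ Finset.Iio t, ((v + Pi.single s 1 : Fin (n + 1) → ℤ) u - o u) =
      ∑ u ∈ Finset.Iio t, (v u - o u) := by
    simp only [Pi.add_apply, add_sub_right_comm, Finset.sum_add_distrib, Finset.sum_pi_single',
      Finset.mem_Iio, not_lt.2 h, if_false, add_zero]
  rw [koszulSign, this, koszulSign]

theorem koszulSign_eq_one {v : Fin (n + 1) → ℤ} {t : Fin (n + 1)} (h : ∀ u < t, v u = o u) :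
    koszulSign k o v t = 1 := by
  rw [koszulSign, Finset.sum_eq_zero, zpow_zero]
  intro u hu
  rw [h u (Finset.mem_Iio.1 hu), sub_self]

open Classical in
variable (m D) in
/-- The element by which one multiplies in the Koszul complex. -/
def koszulElt (o : Fin (n + 1) → ℤ) : PyramidAlg (n + 1) m D :=
  ∑ t : Fin (n + 1), ∑ v ∈ (Part.finite n ((m : ℤ) - 1)).toFinset,
    if Box ((m : ℤ) - 1) o v ∧ Box ((m : ℤ) - 1) o (v + Pi.single t 1) then
      koszulSign k o v t • basisElt m D (v + Pi.single t 1) v else 0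

open Classical in
variable (m D) in
/-- The term of type `t` of the differential of a basis element. -/
def koszulTerm (o c a : Fin (n + 1) → ℤ) (t : Fin (n + 1)) : PyramidAlg (n + 1) m D :=
  if Box ((m : ℤ) - 1) o (a - Pi.single t 1) ∧ Box ((m : ℤ) - 1) o a ∧ Cub ((m : ℤ) - 1) c a then
    koszulSign k o (a - Pi.single t 1) t • basisElt m D c (a - Pi.single t 1) else 0

theorem cub_add_single {M : ℤ} {v : Fin (n + 1) → ℤ} {t : Fin (n + 1)} (h : v ∈ Part n M)
    (h' : v + Pi.single t 1 ∈ Part n M) : Cub M (v + Pi.single t 1) v := by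
  refine ⟨h, h', fun s => ?_⟩
  rw [Pi.add_apply, Pi.single_apply]
  split_ifs <;> omega

theorem basisElt_mul_koszulElt (hD : IsTwist (pyramid (n + 1) m) D)
    (ho : o ∈ Part n ((m : ℤ) - 1)) (c a : Fin (n + 1) → ℤ) :
    basisElt m D c a * koszulElt m D o = ∑ t, koszulTerm m D o c a t := by
  classical
  rw [koszulElt, Finset.mul_sum]
  refine Finset.sum_congr rfl fun t _ => ?_
  by_cases hc : Cub ((m : ℤ) - 1) c a
  swap
  · rw [basisElt_eq_zero hc, zero_mul, koszulTerm, if_neg fun h => hc h.2.2]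
  rw [Finset.mul_sum, Finset.sum_eq_single (a - Pi.single t 1), sub_add_cancel, koszulTerm]
  · by_cases h : Box ((m : ℤ) - 1) o (a - Pi.single t 1) ∧ Box ((m : ℤ) - 1) o a
    · rw [if_pos h, if_pos ⟨h.1, h.2, hc⟩, mul_smul_comm, basisElt_mul hD hc]
      have := cub_add_single (t := t) (h.1.mem ho) (by rw [sub_add_cancel]; exact hc.1)
      rwa [sub_add_cancel] at this
    · rw [if_neg h, if_neg fun h' => h ⟨h'.1, h'.2.1⟩, mul_zero]
  · intro v _ hv
    split_ifs
    · rw [mul_smul_comm, basisElt_mul_of_ne hD, smul_zero]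
      rintro rfl
      exact hv (add_sub_cancel_right _ _).symm
    · rw [mul_zero]
  · intro h
    rw [if_neg fun h' => h ((Part.finite n _).mem_toFinset.2 (h'.1.mem ho)), mul_zero]

/-- The cuboid and strip conditions are both tested row by row, and each entry of an intermediate
point is an entry of `a` or of the point reached at the end. So both intermediate points are present
as soon as the two extremes are. -/
theorem koszulTerm_koszulTerm_comm (ho : o ∈ Part n ((m : ℤ) - 1)) (c a : Fin (n + 1) → ℤ)
    {s t : Fin (n + 1)} (hst : s < t) (h1 : Box ((m : ℤ) - 1) o a) (h2 : Cub ((m : ℤ) - 1) c a)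
    (h3 : Box ((m : ℤ) - 1) o (a - Pi.single s 1 - Pi.single t 1))
    (h4 : Cub ((m : ℤ) - 1) c (a - Pi.single s 1 - Pi.single t 1)) :
    (Box ((m : ℤ) - 1) o (a - Pi.single s 1) ∧ Cub ((m : ℤ) - 1) c (a - Pi.single s 1)) ∧
    (Box ((m : ℤ) - 1) o (a - Pi.single t 1) ∧ Cub ((m : ℤ) - 1) c (a - Pi.single t 1)) := by
  have hb : ∀ s t : Fin (n + 1), s ≠ t →
      Box ((m : ℤ) - 1) o (a - Pi.single s 1 - Pi.single t 1) →
      Cub ((m : ℤ) - 1) c (a - Pi.single s 1 - Pi.single t 1) →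
      Box ((m : ℤ) - 1) o (a - Pi.single s 1) ∧ Cub ((m : ℤ) - 1) c (a - Pi.single s 1) := by
    intro s t hst h3 h4
    have hb : Box ((m : ℤ) - 1) o (a - Pi.single s 1) := by
      refine Box.of_forall fun u => ?_
      by_cases hu : u = s
      · subst hu
        exact ⟨_, h3, by simp [hst]⟩
      · exact ⟨_, h1, by simp [hu]⟩
    refine ⟨hb, hb.mem ho, h2.2.1, fun u => ?_⟩
    have e1 := h2.2.2 u
    have e2 := h4.2.2 u
    simp only [Pi.sub_apply, Pi.single_apply] at e2 ⊢
    split_ifs at e2 ⊢ <;> omega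
  refine ⟨hb s t hst.ne h3 h4, hb t s hst.ne' ?_ ?_⟩
  · rwa [sub_right_comm]
  · rwa [sub_right_comm]

open Classical in
-- Removing boxes from two different rows in either order leads to the same basis element. The sign
-- counts boxes in earlier rows, so it changes for exactly one of the orders and the two terms
-- cancel; two boxes of one row cannot be removed, as `c` would exceed the result by two.
theorem basisElt_mul_koszulElt_sq (hD : IsTwist (pyramid (n + 1) m) D)
    (ho : o ∈ Part n ((m : ℤ) - 1)) (c a : Fin (n + 1) → ℤ) :
    basisElt m D c a * koszulElt m D o * koszulElt m D o = 0 := by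
  by_cases h1 : Box ((m : ℤ) - 1) o a ∧ Cub ((m : ℤ) - 1) c a
  swap
  · rw [basisElt_mul_koszulElt hD ho, Finset.sum_eq_zero, zero_mul]
    intro t _
    rw [koszulTerm, if_neg fun h => h1 h.2]
  -- The term that removes a box of row `s`, then one of row `t`, without the conditions on the
  -- intermediate point.
  let P : Fin (n + 1) → Fin (n + 1) → PyramidAlg (n + 1) m D := fun s t =>
    if Box ((m : ℤ) - 1) o (a - Pi.single s 1 - Pi.single t 1) ∧
      Cub ((m : ℤ) - 1) c (a - Pi.single s 1 - Pi.single t 1) then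
    (koszulSign k o (a - Pi.single s 1) s * koszulSign k o (a - Pi.single s 1 - Pi.single t 1) t) •
      basisElt m D c (a - Pi.single s 1 - Pi.single t 1) else 0
  have hdiag : ∀ t, P t t = 0 := by
    intro t
    refine if_neg fun h => ?_
    have e1 := (h1.2.2.2 t).1
    have e2 := (h.2.2.2 t).2
    simp only [Pi.sub_apply, Pi.single_eq_same] at e2
    omega
  have hanti : ∀ s t, s < t → P s t + P t s = 0 := by
    intro s t hst
    simp only [P, sub_right_comm a (Pi.single t 1)]
    split_ifs with h
    · have e1 := koszulSign_add_of_lt (k := k) (o := o) (a - Pi.single s 1 - Pi.single t 1) hst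
      have e2 := koszulSign_add_of_le (k := k) (o := o) (a - Pi.single s 1 - Pi.single t 1) hst.le
      rw [sub_right_comm, sub_add_cancel] at e1
      rw [sub_add_cancel] at e2
      rw [← add_smul, sub_right_comm, e1, e2, sub_right_comm a (Pi.single t 1)]
      rw [show ∀ x y : k, x * y + -y * x = 0 by intros; ring, zero_smul]
    · rw [add_zero]
  have hP : ∀ s t, P s t ≠ 0 → s ≠ t ∧
      Box ((m : ℤ) - 1) o (a - Pi.single s 1 - Pi.single t 1) ∧
      Cub ((m : ℤ) - 1) c (a - Pi.single s 1 - Pi.single t 1) := by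
    intro s t h
    refine ⟨fun hst => h (by rw [hst, hdiag]), ?_⟩
    by_contra hh
    exact h (if_neg hh)
  have key : basisElt m D c a * koszulElt m D o * koszulElt m D o = ∑ s, ∑ t, P s t := by
    rw [basisElt_mul_koszulElt hD ho, Finset.sum_mul]
    refine Finset.sum_congr rfl fun s _ => ?_
    rw [koszulTerm]
    split_ifs with hs
    · rw [smul_mul_assoc, basisElt_mul_koszulElt hD ho, Finset.smul_sum]
      refine Finset.sum_congr rfl fun t _ => ?_
      simp only [koszulTerm, P]
      by_cases h : Box ((m : ℤ) - 1) o (a - Pi.single s 1 - Pi.single t 1) ∧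
        Cub ((m : ℤ) - 1) c (a - Pi.single s 1 - Pi.single t 1)
      · rw [if_pos h]
        have hne : s ≠ t := by
          rintro rfl
          have e1 := (h1.2.2.2 s).1
          have e2 := (h.2.2.2 s).2
          simp only [Pi.sub_apply, Pi.single_eq_same] at e2
          omega
        have hc : Cub ((m : ℤ) - 1) c (a - Pi.single s 1) := by
          rcases lt_or_gt_of_ne hne with hlt | hlt
          · exact (koszulTerm_koszulTerm_comm ho c a hlt h1.1 h1.2 h.1 h.2).1.2
          · refine (koszulTerm_koszulTerm_comm ho c a hlt h1.1 h1.2 ?_ ?_).2.2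
            · rw [sub_right_comm]; exact h.1
            · rw [sub_right_comm]; exact h.2
        rw [if_pos ⟨h.1, hs.1, hc⟩, smul_smul]
      · rw [if_neg h]
        by_cases hc : Cub ((m : ℤ) - 1) c (a - Pi.single s 1 - Pi.single t 1)
        · rw [if_neg fun h' => h ⟨h'.1, hc⟩, smul_zero]
        · rw [basisElt_eq_zero hc, smul_zero, ite_self, smul_zero]
    -- A missing intermediate point forces a missing end point, so the unconditional terms vanish as
    -- well.
    · rw [zero_mul]
      refine (Finset.sum_eq_zero fun t _ => ?_).symm
      by_contra hne
      obtain ⟨hst, h3, h4⟩ := hP s t hne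
      apply hs
      rcases lt_or_gt_of_ne hst with hlt | hlt
      · exact ⟨(koszulTerm_koszulTerm_comm ho c a hlt h1.1 h1.2 h3 h4).1.1, h1⟩
      · refine ⟨(koszulTerm_koszulTerm_comm ho c a hlt h1.1 h1.2 ?_ ?_).2.1, h1⟩
        · rw [sub_right_comm]; exact h3
        · rw [sub_right_comm]; exact h4
  rw [key, ← Finset.sum_product']
  refine Finset.sum_involution (fun x _ => (x.2, x.1)) ?_ ?_ (by simp) (by simp)
  · rintro ⟨s, t⟩ _
    rcases lt_trichotomy s t with h | h | h
    · exact hanti s t h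
    · subst h; simp [hdiag]
    · exact (add_comm _ _).trans (hanti t s h)
  · rintro ⟨s, t⟩ _ hne he
    obtain ⟨h, -⟩ := Prod.mk.inj he
    exact (hP s t hne).1 h.symm

theorem mul_koszulElt_sq (hD : IsTwist (pyramid (n + 1) m) D) (ho : o ∈ Part n ((m : ℤ) - 1))
    (x : PyramidAlg (n + 1) m D) : x * koszulElt m D o * koszulElt m D o = 0 := by
  refine basis_induction hD (C := fun x => x * koszulElt m D o * koszulElt m D o = 0) x ?_ ?_ ?_
  · rw [zero_mul, zero_mul]
  · intro x y hx hy
    rw [add_mul, add_mul, hx, hy, add_zero]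
  · intro r c a _
    rw [smul_mul_assoc, smul_mul_assoc, basisElt_mul_koszulElt_sq hD ho, smul_zero]

theorem koszulTerm_mem {S : (Fin (n + 1) → ℤ) → (Fin (n + 1) → ℤ) → Prop}
    {c a : Fin (n + 1) → ℤ} {t : Fin (n + 1)}
    (h : Box ((m : ℤ) - 1) o (a - Pi.single t 1) → Cub ((m : ℤ) - 1) c a →
      S c (a - Pi.single t 1)) :
    koszulTerm m D o c a t ∈ suppSub hD S := by
  classical
  rw [koszulTerm]
  split_ifs with hh
  · exact Submodule.smul_mem _ _ (basisElt_mem_suppSub hD fun _ => h hh.1 hh.2.2)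
  · exact Submodule.zero_mem _

/-- Right multiplication by `koszulElt` maps elements with support in `S` to elements with support
in `T`, if `T` contains the pairs obtained from those in `S`. -/
theorem mul_koszulElt_mem {S T : (Fin (n + 1) → ℤ) → (Fin (n + 1) → ℤ) → Prop}
    (ho : o ∈ Part n ((m : ℤ) - 1))
    (h : ∀ c a t, S c a → Cub ((m : ℤ) - 1) c a → Box ((m : ℤ) - 1) o (a - Pi.single t 1) →
      T c (a - Pi.single t 1)) {x : PyramidAlg (n + 1) m D} (hx : x ∈ suppSub hD S) :
    x * koszulElt m D o ∈ suppSub hD T := by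
  refine suppSub_induction hD (C := fun x => x * koszulElt m D o ∈ suppSub hD T) hx ?_ ?_ ?_
  · rw [zero_mul]; exact Submodule.zero_mem _
  · intro x y hx hy
    rw [add_mul]; exact Submodule.add_mem _ hx hy
  · intro r c a hc hs
    rw [smul_mul_assoc, basisElt_mul_koszulElt hD ho]
    exact Submodule.smul_mem _ _ (Submodule.sum_mem _ fun t _ =>
      koszulTerm_mem hD fun hb hc => h c a t hs hc hb)

theorem sum_sub_single (a : Fin (n + 1) → ℤ) (t : Fin (n + 1)) :
    ∑ s, (a - Pi.single t 1 : Fin (n + 1) → ℤ) s = ∑ s, a s - 1 := by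
  simp only [Pi.sub_apply, Finset.sum_sub_distrib, sum_single]

theorem sum_add_single (a : Fin (n + 1) → ℤ) (t : Fin (n + 1)) :
    ∑ s, (a + Pi.single t 1 : Fin (n + 1) → ℤ) s = ∑ s, a s + 1 := by
  simp only [Pi.add_apply, Finset.sum_add_distrib, sum_single]

theorem mul_koszulElt_mem_levelMod (hD : IsTwist (pyramid (n + 1) m) D)
    (ho : o ∈ Part n ((m : ℤ) - 1)) {l : ℕ} {x : PyramidAlg (n + 1) m D}
    (hx : x ∈ levelMod m D o (l + 1)) : x * koszulElt m D o ∈ levelMod m D o l := by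
  rw [mem_levelMod_iff hD] at hx ⊢
  refine mul_koszulElt_mem hD ho (fun c a t ha _ hb => ?_) hx
  rw [mem_boxLevel ho] at ha ⊢
  refine ⟨hb, ?_⟩
  rw [sum_sub_single, ha.2]
  push_cast
  ring

variable (m D) in
/-- The differential of the Koszul complex. -/
def koszulDiff (hD : IsTwist (pyramid (n + 1) m) D) (ho : o ∈ Part n ((m : ℤ) - 1)) (l : ℕ) :
    levelMod m D o (l + 1) →ₗ[PyramidAlg (n + 1) m D] levelMod m D o l :=
  (LinearMap.toSpanSingleton (PyramidAlg (n + 1) m D) (PyramidAlg (n + 1) m D)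
    (koszulElt m D o)).restrict fun _ hx => mul_koszulElt_mem_levelMod hD ho hx

/-- `f` is the first index at which `c` and `o` differ. -/
def IsFirst (o c : Fin (n + 1) → ℤ) (f : Fin (n + 1)) : Prop := c f ≠ o f ∧ ∀ u < f, c u = o u

theorem IsFirst.unique {c : Fin (n + 1) → ℤ} {s t : Fin (n + 1)} (hs : IsFirst o c s)
    (ht : IsFirst o c t) : s = t := by
  rcases lt_trichotomy s t with h | h | h
  · exact absurd (ht.2 s h) hs.1
  · exact h
  · exact absurd (hs.2 t h) ht.1

theorem exists_isFirst {c : Fin (n + 1) → ℤ} (h : c ≠ o) : ∃ f, IsFirst o c f := by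
  classical
  have hne : (Finset.univ.filter fun t => c t ≠ o t).Nonempty := by
    obtain ⟨t, ht⟩ := Function.ne_iff.1 h
    exact ⟨t, by simpa using ht⟩
  refine ⟨Finset.min' _ hne, by simpa using Finset.min'_mem _ hne, fun u hu => ?_⟩
  by_contra hu'
  exact absurd (Finset.min'_le _ u (by simpa using hu')) (not_le.2 hu)

open Classical in
variable (m D) in
/-- The contracting homotopy of the Koszul complex on basis elements. -/
def homotopyElt (o c a : Fin (n + 1) → ℤ) : PyramidAlg (n + 1) m D :=
  if h : Cub ((m : ℤ) - 1) c a ∧ ∃ f, IsFirst o c f ∧ c f = a f + 1 then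
    basisElt m D c (a + Pi.single h.2.choose 1) else 0

theorem homotopyElt_of_eq {c a : Fin (n + 1) → ℤ} {f : Fin (n + 1)} (hf : IsFirst o c f)
    (h : Cub ((m : ℤ) - 1) c a) (hc : c f = a f + 1) :
    homotopyElt m D o c a = basisElt m D c (a + Pi.single f 1) := by
  have hex : Cub ((m : ℤ) - 1) c a ∧ ∃ f, IsFirst o c f ∧ c f = a f + 1 := ⟨h, f, hf, hc⟩
  rw [homotopyElt, dif_pos hex, hex.2.choose_spec.1.unique hf]

theorem homotopyElt_of_ne {c a : Fin (n + 1) → ℤ} {f : Fin (n + 1)} (hf : IsFirst o c f)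
    (hc : c f ≠ a f + 1) : homotopyElt m D o c a = 0 := by
  rw [homotopyElt, dif_neg]
  rintro ⟨-, f', hf', hc'⟩
  rw [hf'.unique hf] at hc'
  exact hc hc'

theorem homotopyElt_eq_zero {c a : Fin (n + 1) → ℤ} (h : ¬ Cub ((m : ℤ) - 1) c a) :
    homotopyElt m D o c a = 0 := by
  rw [homotopyElt, dif_neg fun hh => h hh.1]

/-- The contracting homotopy of the Koszul complex. -/
def homotopy (o : Fin (n + 1) → ℤ) : PyramidAlg (n + 1) m D →ₗ[k] PyramidAlg (n + 1) m D :=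
  (Finsupp.linearCombination k fun q : (Fin (n + 1) → ℤ) × (Fin (n + 1) → ℤ) =>
    homotopyElt m D o q.1 q.2) ∘ₗ coef hD

theorem homotopy_basisElt (c a : Fin (n + 1) → ℤ) :
    homotopy hD o (basisElt m D c a) = homotopyElt m D o c a := by
  by_cases h : Cub ((m : ℤ) - 1) c a
  · rw [homotopy, LinearMap.comp_apply, coef_basisElt hD h, Finsupp.linearCombination_single,
      one_smul]
  · rw [basisElt_eq_zero h, map_zero, homotopyElt_eq_zero h]

open Classical in
theorem homotopy_koszulTerm (c a : Fin (n + 1) → ℤ) (t : Fin (n + 1)) :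
    homotopy hD o (koszulTerm m D o c a t) =
      if Box ((m : ℤ) - 1) o (a - Pi.single t 1) ∧ Box ((m : ℤ) - 1) o a ∧ Cub ((m : ℤ) - 1) c a
      then koszulSign k o (a - Pi.single t 1) t • homotopyElt m D o c (a - Pi.single t 1)
      else 0 := by
  rw [koszulTerm]
  split_ifs
  · rw [map_smul, homotopy_basisElt]
  · exact map_zero _

/-- Let `f` be the first row where `c` differs from `o`. The last box of row `f` of `c` belongs
either to `c/a` or to `a/o`, and the homotopy moves it from the former to the latter. The move stays
in the cuboid because the rows of `c` before `f` are those of `o`; for the same reason its sign is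
1. The moves in later rows cancel. -/
theorem homotopy_identity (ho : o ∈ Part n ((m : ℤ) - 1)) {c a : Fin (n + 1) → ℤ}
    (hc : Cub ((m : ℤ) - 1) c a) (ha : Box ((m : ℤ) - 1) o a) (hco : c ≠ o) :
    homotopy hD o (basisElt m D c a) * koszulElt m D o +
      homotopy hD o (basisElt m D c a * koszulElt m D o) = basisElt m D c a := by
  classical
  obtain ⟨f, hf⟩ := exists_isFirst hco
  have hau : ∀ u < f, a u = o u := fun u hu => by
    have h1 := (ha u).1
    have h2 := (hc.2.2 u).1
    have h3 := hf.2 u hu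
    omega
  have hfo : o f < c f := by
    have h1 := (ha f).1
    have h2 := (hc.2.2 f).1
    have h3 := hf.1
    omega
  rw [homotopy_basisElt, basisElt_mul_koszulElt hD ho, map_sum]
  simp only [homotopy_koszulTerm]
  by_cases hcf : c f = a f + 1
  · have haf : Box ((m : ℤ) - 1) o (a + Pi.single f 1) := by
      intro t
      have h1 := ha t
      rw [Pi.add_apply]
      by_cases ht : t = f
      · subst ht
        rw [Pi.single_eq_same, ← hcf]
        refine ⟨hfo.le, (hc.2.1.2 t).2, fun u hu => ?_⟩
        rw [← hf.2 u hu]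
        exact hc.2.1.1 hu.le
      · rwa [Pi.single_eq_of_ne ht, add_zero]
    have hcaf : Cub ((m : ℤ) - 1) c (a + Pi.single f 1) := by
      refine ⟨haf.mem ho, hc.2.1, fun t => ?_⟩
      have h1 := hc.2.2 t
      rw [Pi.add_apply]
      by_cases ht : t = f
      · subst ht
        rw [Pi.single_eq_same]
        omega
      · rwa [Pi.single_eq_of_ne ht, add_zero]
    rw [homotopyElt_of_eq hf hc hcf, basisElt_mul_koszulElt hD ho, ← Finset.sum_add_distrib,
      Finset.sum_eq_single f]
    -- The term of type `f` returns the original element; on the other side row `f` of `c` would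
    -- exceed the new point by two.
    · rw [koszulTerm, add_sub_cancel_right, if_pos ⟨ha, haf, hcaf⟩, koszulSign_eq_one hau, one_smul,
        homotopyElt_of_ne hf, smul_zero, ite_self, add_zero]
      rw [Pi.sub_apply, Pi.single_eq_same]
      omega
    · intro t _ htf
      rcases lt_or_gt_of_ne htf with ht | ht
      -- Rows before `f` agree with `o`, so removing a box there leaves the cuboid.
      · have h1 : ¬ Box ((m : ℤ) - 1) o (a - Pi.single t 1) := fun h => by
          have := (h t).1
          rw [Pi.sub_apply, Pi.single_eq_same, hau t ht] at this
          omega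
        have h2 : ¬ Box ((m : ℤ) - 1) o (a + Pi.single f 1 - Pi.single t 1) := fun h => by
          have := (h t).1
          rw [Pi.sub_apply, Pi.single_eq_same, Pi.add_apply, Pi.single_eq_of_ne htf,
            hau t ht] at this
          omega
        rw [koszulTerm, if_neg fun h => h2 h.1, if_neg fun h => h1 h.1, add_zero]
      -- The box added in row `f` comes before row `t`, so it flips the sign and the two terms
      -- cancel.
      · have e : a + Pi.single f 1 - Pi.single t 1 = a - Pi.single t 1 + Pi.single f 1 := by abel
        have hsgn := koszulSign_add_of_lt (k := k) (o := o) (a - Pi.single t 1) ht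
        rw [koszulTerm, e, hsgn]
        by_cases hB : Box ((m : ℤ) - 1) o (a - Pi.single t 1)
        · have hB' : Box ((m : ℤ) - 1) o (a - Pi.single t 1 + Pi.single f 1) := by
            refine Box.of_forall fun u => ?_
            by_cases hu : u = f
            · subst hu
              exact ⟨_, haf, by simp [Ne.symm htf]⟩
            · exact ⟨_, hB, by simp [hu]⟩
          rw [if_pos ⟨hB', haf, hcaf⟩, if_pos ⟨hB, ha, hc⟩]
          by_cases hC : Cub ((m : ℤ) - 1) c (a - Pi.single t 1)
          · rw [homotopyElt_of_eq hf hC, neg_smul, neg_add_cancel]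
            rw [Pi.sub_apply, Pi.single_eq_of_ne htf.symm, sub_zero, hcf]
          · rw [homotopyElt_eq_zero hC, smul_zero, add_zero, basisElt_eq_zero, smul_zero]
            intro h
            refine hC ⟨hB.mem ho, hc.2.1, fun u => ?_⟩
            have h1 := h.2.2 u
            have h2 := hc.2.2 u
            simp only [Pi.add_apply, Pi.sub_apply, Pi.single_apply] at h1 ⊢
            split_ifs at h1 ⊢ <;> omega
        · have hB' : ¬ Box ((m : ℤ) - 1) o (a - Pi.single t 1 + Pi.single f 1) := by
            intro h
            refine hB (Box.of_forall fun u => ?_)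
            by_cases hu : u = t
            · subst hu
              exact ⟨_, h, by simp [htf]⟩
            · exact ⟨_, ha, by simp [hu]⟩
          rw [if_neg fun h => hB' h.1, if_neg fun h => hB h.1, add_zero]
    · simp
  -- Here the last box of row `f` already lies in `a/o`: the homotopy kills the element and only
  -- restores the term of type `f` of its differential.
  · have hcf' : c f = a f := by
      have := hc.2.2 f
      omega
    rw [homotopyElt_of_ne hf hcf, zero_mul, zero_add, Finset.sum_eq_single f]
    · have hB : Box ((m : ℤ) - 1) o (a - Pi.single f 1) := by
        intro t
        have h1 := ha t
        rw [Pi.sub_apply]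
        by_cases ht : t = f
        · subst ht
          rw [Pi.single_eq_same]
          exact ⟨by omega, by omega, fun u hu => by have := h1.2.2 u hu; omega⟩
        · rwa [Pi.single_eq_of_ne ht, sub_zero]
      have hC : Cub ((m : ℤ) - 1) c (a - Pi.single f 1) := by
        refine ⟨hB.mem ho, hc.2.1, fun t => ?_⟩
        have h1 := hc.2.2 t
        rw [Pi.sub_apply]
        by_cases ht : t = f
        · subst ht
          rw [Pi.single_eq_same]
          omega
        · rwa [Pi.single_eq_of_ne ht, sub_zero]
      rw [if_pos ⟨hB, ha, hc⟩, homotopyElt_of_eq hf hC, sub_add_cancel, koszulSign_eq_one, one_smul]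
      · intro u hu
        rw [Pi.sub_apply, Pi.single_eq_of_ne hu.ne, sub_zero, hau u hu]
      · rw [Pi.sub_apply, Pi.single_eq_same]
        omega
    · intro t _ htf
      rw [homotopyElt_of_ne hf, smul_zero, ite_self]
      rw [Pi.sub_apply, Pi.single_eq_of_ne htf.symm]
      omega
    · simp

/-- In the cuboid `c = o` forces `a = o`, so the only pair excluded is `(o, o)`, the class that
survives as the simple module. -/
theorem homotopy_mul_add {l : ℕ} (ho : o ∈ Part n ((m : ℤ) - 1)) {x : PyramidAlg (n + 1) m D}
    (hx : x ∈ suppSub hD (fun c a => a ∈ boxLevel ((m : ℤ) - 1) o l ∧ c ≠ o)) :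
    homotopy hD o x * koszulElt m D o + homotopy hD o (x * koszulElt m D o) = x ∧
      homotopy hD o x ∈ levelMod m D o (l + 1) := by
  refine suppSub_induction hD (C := fun x => homotopy hD o x * koszulElt m D o +
    homotopy hD o (x * koszulElt m D o) = x ∧ homotopy hD o x ∈ levelMod m D o (l + 1)) hx ?_ ?_ ?_
  · rw [zero_mul, map_zero, zero_mul, add_zero]
    exact ⟨rfl, Submodule.zero_mem _⟩
  · rintro x y ⟨hx, hx'⟩ ⟨hy, hy'⟩
    rw [map_add, add_mul, add_mul, map_add, add_add_add_comm, hx, hy]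
    exact ⟨rfl, Submodule.add_mem _ hx' hy'⟩
  · rintro r c a hc ⟨ha, hco⟩
    rw [mem_boxLevel ho] at ha
    rw [map_smul, smul_mul_assoc, smul_mul_assoc, map_smul, ← smul_add,
      homotopy_identity hD ho hc ha.1 hco]
    refine ⟨rfl, ?_⟩
    rw [mem_levelMod_iff hD, homotopy_basisElt]
    refine Submodule.smul_mem _ _ ?_
    obtain ⟨f, hf⟩ := exists_isFirst hco
    by_cases hcf : c f = a f + 1
    · rw [homotopyElt_of_eq hf hc hcf]
      refine basisElt_mem_suppSub hD fun _ => ?_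
      rw [mem_boxLevel ho]
      refine ⟨fun t => ?_, by rw [sum_add_single, ha.2]; push_cast; ring⟩
      have h1 := ha.1 t
      rw [Pi.add_apply]
      by_cases ht : t = f
      · subst ht
        rw [Pi.single_eq_same, ← hcf]
        refine ⟨by omega, (hc.2.1.2 t).2, fun u hu => ?_⟩
        rw [← hf.2 u hu]
        exact hc.2.1.1 hu.le
      · rwa [Pi.single_eq_of_ne ht, add_zero]
    · rw [homotopyElt_of_ne hf hcf]
      exact Submodule.zero_mem _

end Complex

/-! ### The minimal resolutions of the simple modules -/

section Resolution

variable {k : Type u} [Field k] {n m : ℕ}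
  {D : Fin (n + 1) → Fin (n + 1) → (Fin (n + 1) → ℤ) → k} (hD : IsTwist (pyramid (n + 1) m) D)
  {o : Fin (n + 1) → ℤ}

theorem suppSub_mono {S T : (Fin (n + 1) → ℤ) → (Fin (n + 1) → ℤ) → Prop}
    {x : PyramidAlg (n + 1) m D} (hx : x ∈ suppSub hD S)
    (h : ∀ c a, Cub ((m : ℤ) - 1) c a → S c a → T c a) : x ∈ suppSub hD T := by
  rw [mem_suppSub] at hx ⊢
  exact fun c a hca => h c a (cub_of_coef_ne_zero hD hca) (hx c a hca)

theorem suppSub_inf {S T : (Fin (n + 1) → ℤ) → (Fin (n + 1) → ℤ) → Prop}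
    {x : PyramidAlg (n + 1) m D} (hx : x ∈ suppSub hD S) (hx' : x ∈ suppSub hD T) :
    x ∈ suppSub hD (fun c a => S c a ∧ T c a) := by
  rw [mem_suppSub] at hx hx' ⊢
  exact fun c a h => ⟨hx c a h, hx' c a h⟩

theorem mem_suppSub_true (x : PyramidAlg (n + 1) m D) :
    x ∈ suppSub hD (fun _ _ => True) :=
  (mem_suppSub hD).2 fun _ _ _ => trivial

theorem eq_zero_of_mem_suppSub {S : (Fin (n + 1) → ℤ) → (Fin (n + 1) → ℤ) → Prop}
    {x : PyramidAlg (n + 1) m D} (hx : x ∈ suppSub hD S)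
    (h : ∀ c a, Cub ((m : ℤ) - 1) c a → ¬ S c a) : x = 0 := by
  refine suppSub_induction hD (C := fun x => x = 0) hx rfl ?_ fun r c a hc hs => ?_
  · rintro _ _ rfl rfl
    exact add_zero _
  · exact absurd hs (h c a hc)

theorem mul_mem_suppSub {S T U : (Fin (n + 1) → ℤ) → (Fin (n + 1) → ℤ) → Prop}
    {x y : PyramidAlg (n + 1) m D} (hx : x ∈ suppSub hD S) (hy : y ∈ suppSub hD T)
    (h : ∀ c b a, Cub ((m : ℤ) - 1) c b → Cub ((m : ℤ) - 1) b a → S c b → T b a → U c a) :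
    x * y ∈ suppSub hD U := by
  refine suppSub_induction hD (C := fun x => x * y ∈ suppSub hD U) hx ?_ ?_ ?_
  · rw [zero_mul]; exact Submodule.zero_mem _
  · intro x y hx hy
    rw [add_mul]; exact Submodule.add_mem _ hx hy
  · intro r c b hc hs
    refine suppSub_induction hD (C := fun y => r • basisElt m D c b * y ∈ suppSub hD U) hy ?_ ?_ ?_
    · rw [mul_zero]; exact Submodule.zero_mem _
    · intro x y hx hy
      rw [mul_add]; exact Submodule.add_mem _ hx hy
    · intro s b' a hb ht
      rw [smul_mul_smul_comm]
      refine Submodule.smul_mem _ _ ?_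
      by_cases hbb : b = b'
      · subst hbb
        rw [basisElt_mul hD hc hb]
        exact basisElt_mem_suppSub hD fun _ => h c b a hc hb hs ht
      · rw [basisElt_mul_of_ne hD _ _ hbb]
        exact Submodule.zero_mem _

theorem Cub.eq_of_sum_eq {M : ℤ} {c a : Fin (n + 1) → ℤ} (h : Cub M c a)
    (hs : ∑ t, c t = ∑ t, a t) : c = a := by
  funext t
  exact ((Finset.sum_eq_sum_iff_of_le fun t _ => (h.2.2 t).1).1 hs.symm t (Finset.mem_univ t)).symm

theorem Cub.exists_degree {M : ℤ} {c a : Fin (n + 1) → ℤ} (h : Cub M c a) (hne : c ≠ a) :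
    ∃ l : ℕ, 1 ≤ l ∧ ∑ t, c t = ∑ t, a t + l := by
  have h1 := h.sum_le.1
  have h2 : ∑ t, c t ≠ ∑ t, a t := fun hs => hne (h.eq_of_sum_eq hs)
  exact ⟨(∑ t, c t - ∑ t, a t).toNat, by omega, by omega⟩

theorem smul_basisElt_eq (hD : IsTwist (pyramid (n + 1) m) D) (r : k) (c a : Fin (n + 1) → ℤ) :
    r • basisElt m D c a = (r • basisElt m D c a) • basisElt m D a a := by
  rw [smul_eq_mul, smul_mul_assoc, basisElt_mul_self hD]

/-- A basis element `(c, a)` with `a` different from the vertex is a multiple of another idempotent;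
one that starts at the vertex and ends elsewhere has positive degree. Since products only move
upwards, nothing returns to the excluded pair. -/
theorem mem_simpleKer_iff (v : Vert (n + 1) (pyramid (n + 1) m)) (x : PyramidAlg (n + 1) m D) :
    x ∈ simpleKer (pyramidRel (n + 1) m D) v ↔
      x ∈ suppSub hD (fun c a => ¬ (c = co v ∧ a = co v)) := by
  constructor
  · intro hx
    refine Submodule.span_induction (p := fun x _ => x ∈ suppSub hD _) ?_ ?_ ?_ ?_ hx
    · rintro x (⟨w, hw, rfl⟩ | ⟨l, hl, hx⟩)
      · rw [← basisElt_self hD]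
        exact basisElt_mem_suppSub hD fun _ h => hw (co_injective h.1)
      · refine suppSub_mono hD (degreePart_le hD l hx) ?_
        rintro c a - h ⟨rfl, rfl⟩
        omega
    · exact Submodule.zero_mem _
    · exact fun _ _ _ _ => Submodule.add_mem _
    · intro y x _ hx
      refine mul_mem_suppSub hD (mem_suppSub_true hD y) hx ?_
      rintro c b a hcb hba - h ⟨rfl, rfl⟩
      refine h ⟨le_antisymm ?_ ?_, rfl⟩
      · exact fun t => (hcb.2.2 t).1
      · exact fun t => (hba.2.2 t).1
  · intro hx
    refine suppSub_induction hD (C := fun x => x ∈ simpleKer (pyramidRel (n + 1) m D) v) hx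
      (Submodule.zero_mem _) (fun _ _ => Submodule.add_mem _) fun r c a hc h => ?_
    by_cases ha : a = co v
    · obtain ⟨l, hl, hs⟩ := hc.exists_degree fun hca => h ⟨hca.trans ha, ha⟩
      exact Submodule.subset_span (Or.inr ⟨l, hl,
        Submodule.smul_mem _ r (basisElt_mem_degreePart hD hc hs)⟩)
    · rw [smul_basisElt_eq hD]
      refine Submodule.smul_mem _ _ (Submodule.subset_span (Or.inl ⟨vertex hc.1, ?_, ?_⟩))
      · rintro rfl
        exact ha (co_vertex _).symm
      · rw [← basisElt_self hD, co_vertex]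

/-- The part of degree `l` of a term of the Koszul complex. -/
def levelDeg (o : Fin (n + 1) → ℤ) (t l : ℕ) : AddSubgroup (levelMod m D o t) :=
  (suppSub hD (fun c _ => ∑ s, c s = ∑ s, o s + l)).toAddSubgroup.comap
    (levelMod m D o t).subtype.toAddMonoidHom

theorem mem_levelDeg {t l : ℕ} {x : levelMod m D o t} :
    x ∈ levelDeg hD o t l ↔ x.1 ∈ suppSub hD (fun c _ => ∑ s, c s = ∑ s, o s + l) := Iff.rfl

theorem levelMod_induction (t : ℕ) {S : (Fin (n + 1) → ℤ) → (Fin (n + 1) → ℤ) → Prop}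
    {C : levelMod m D o t → Prop} (x : levelMod m D o t) (hx : x.1 ∈ suppSub hD S) (zero : C 0)
    (add : ∀ x y, C x → C y → C (x + y))
    (basis : ∀ (r : k) c a (h : r • basisElt m D c a ∈ levelMod m D o t), Cub ((m : ℤ) - 1) c a →
      a ∈ boxLevel ((m : ℤ) - 1) o t → S c a → C ⟨r • basisElt m D c a, h⟩) : C x := by
  obtain ⟨x, h⟩ := x
  suffices ∃ h, C ⟨x, h⟩ from this.2
  refine suppSub_induction hD (C := fun x => ∃ h, C ⟨x, h⟩)
    (suppSub_inf hD ((mem_levelMod_iff hD).1 h) hx) ⟨Submodule.zero_mem _, zero⟩ ?_ ?_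
  · rintro x y ⟨hx, cx⟩ ⟨hy, cy⟩
    exact ⟨Submodule.add_mem _ hx hy, add _ _ cx cy⟩
  · rintro r c a hc ⟨ha, hs⟩
    exact ⟨_, basis r c a ((mem_levelMod_iff hD).2
      (Submodule.smul_mem _ _ (basisElt_mem_suppSub hD fun _ => ha))) hc ha hs⟩

theorem basisElt_self_mem_levelMod (hD : IsTwist (pyramid (n + 1) m) D) {a : Fin (n + 1) → ℤ} {t : ℕ}
    (h : a ∈ boxLevel ((m : ℤ) - 1) o t) : basisElt m D a a ∈ levelMod m D o t :=
  (mem_levelMod_iff hD).2 (basisElt_mem_suppSub hD fun _ => h)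

/-- The degree of a basis element can be read off from `c`, so a coefficient of a sum comes from the
component of one degree. -/
theorem coef_coeAddMonoidHom (t l : ℕ) (y : DirectSum ℕ fun l => levelDeg hD o t l)
    {c a : Fin (n + 1) → ℤ} (h : ∑ s, c s = ∑ s, o s + l) :
    coef hD (DirectSum.coeAddMonoidHom (levelDeg hD o t) y).1 (c, a) =
      coef hD (y l).1.1 (c, a) := by
  classical
  induction y using DirectSum.induction_on with
  | zero => simp
  | add x y hx hy =>
    rw [map_add, Submodule.coe_add, map_add, Finsupp.add_apply, hx, hy, DirectSum.add_apply,
      AddSubgroup.coe_add, Submodule.coe_add, map_add, Finsupp.add_apply]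
  | of i x =>
    rw [DirectSum.coeAddMonoidHom_of]
    by_cases hi : i = l
    · subst hi
      rw [DirectSum.of_eq_same]
    · rw [DirectSum.of_eq_of_ne _ _ _ (Ne.symm hi)]
      by_contra hne
      have hne' : coef hD x.1.1 (c, a) ≠ 0 := fun h0 => hne (by rw [h0]; simp)
      have := (mem_suppSub hD).1 ((mem_levelDeg hD).1 x.2) c a hne'
      exact hi (by omega)

theorem levelDeg_isInternal (ho : o ∈ Part n ((m : ℤ) - 1)) (t : ℕ) :
    DirectSum.IsInternal (levelDeg (m := m) (D := D) hD o t) := by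
  classical
  constructor
  · rw [injective_iff_map_eq_zero]
    intro y hy
    refine DFinsupp.ext fun l => Subtype.ext (Subtype.ext (coef_injective hD (Finsupp.ext ?_)))
    rintro ⟨c, a⟩
    by_cases h : ∑ s, c s = ∑ s, o s + (l : ℤ)
    · have e := coef_coeAddMonoidHom hD t l y (a := a) h
      rw [hy] at e
      exact e.symm
    · have : coef hD (y l).1.1 (c, a) = 0 := by
        by_contra hne
        exact h ((mem_suppSub hD).1 ((mem_levelDeg hD).1 (y l).2) c a hne)
      refine this.trans ?_
      change _ = coef hD 0 (c, a)
      rw [map_zero, Finsupp.zero_apply]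
  · intro x
    change x ∈ AddMonoidHom.range (DirectSum.coeAddMonoidHom (levelDeg hD o t))
    refine levelMod_induction hD t (C := fun x => x ∈ AddMonoidHom.range
      (DirectSum.coeAddMonoidHom (levelDeg hD o t))) x (mem_suppSub_true hD x.1)
      (AddSubgroup.zero_mem _) (fun _ _ => AddSubgroup.add_mem _) fun r c a h hc ha _ => ?_
    have h1 := hc.sum_le.1
    have h2 := ((mem_boxLevel ho).1 ha).2
    refine ⟨DirectSum.of (fun l => levelDeg hD o t l) (∑ s, c s - ∑ s, o s).toNat ⟨⟨_, h⟩, ?_⟩,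
      DirectSum.coeAddMonoidHom_of _ _ _⟩
    rw [mem_levelDeg]
    exact Submodule.smul_mem _ _ (basisElt_mem_suppSub hD fun _ => by omega)

theorem mem_radSubmodule {t : ℕ} (x : levelMod m D o t)
    (hx : x.1 ∈ suppSub hD (fun c a => c ≠ a)) :
    x ∈ radSubmodule (pyramidRel (n + 1) m D) (levelMod m D o t) := by
  refine levelMod_induction hD t (C := fun x => x ∈ radSubmodule _ _) x hx (Submodule.zero_mem _)
    (fun _ _ => Submodule.add_mem _) fun r c a h hc ha hca => ?_
  obtain ⟨l, hl, hs⟩ := hc.exists_degree hca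
  exact Submodule.subset_span ⟨l, r • basisElt m D c a, ⟨_, basisElt_self_mem_levelMod hD ha⟩, hl,
    Submodule.smul_mem _ _ (basisElt_mem_degreePart hD hc hs),
    Subtype.ext (smul_basisElt_eq hD r c a)⟩

/-- The idempotents at the points of level `t` generate, and they have degree `t` because these
points have `t` boxes more than `o`. -/
theorem span_levelDeg (ho : o ∈ Part n ((m : ℤ) - 1)) (t : ℕ) :
    Submodule.span (PyramidAlg (n + 1) m D) (levelDeg hD o t t : Set (levelMod m D o t)) = ⊤ := by
  rw [eq_top_iff]
  rintro x -
  refine levelMod_induction hD t (C := fun x => x ∈ Submodule.span _ _) x (mem_suppSub_true hD x.1)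
    (Submodule.zero_mem _) (fun _ _ => Submodule.add_mem _) fun r c a h hc ha _ => ?_
  have e : (⟨r • basisElt m D c a, h⟩ : levelMod m D o t) =
      (r • basisElt m D c a) • ⟨_, basisElt_self_mem_levelMod hD ha⟩ :=
    Subtype.ext (smul_basisElt_eq hD r c a)
  rw [e]
  refine Submodule.smul_mem _ _ (Submodule.subset_span ?_)
  exact (mem_levelDeg hD).2 (basisElt_mem_suppSub hD fun _ => ((mem_boxLevel ho).1 ha).2)

variable (m D) in
/-- The augmentation of the Koszul complex. -/
def koszulAug (v : Vert (n + 1) (pyramid (n + 1) m)) :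
    levelMod m D (co v) 0 →ₗ[PyramidAlg (n + 1) m D] SimpleMod (pyramidRel (n + 1) m D) v :=
  (simpleKer (pyramidRel (n + 1) m D) v).mkQ ∘ₗ (levelMod m D (co v) 0).subtype

theorem koszulAug_eq_zero_iff {v : Vert (n + 1) (pyramid (n + 1) m)}
    (x : levelMod m D (co v) 0) : koszulAug m D v x = 0 ↔
      x.1 ∈ suppSub hD (fun c a => ¬ (c = co v ∧ a = co v)) := by
  rw [← mem_simpleKer_iff]
  exact Submodule.Quotient.mk_eq_zero _

theorem Box.eq_of_sum_le {M : ℤ} {v : Fin (n + 1) → ℤ} (h : Box M o v)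
    (hs : ∑ t, v t ≤ ∑ t, o t) : v = o := by
  funext t
  have h1 : ∀ t ∈ Finset.univ, o t ≤ v t := fun t _ => (h t).1
  exact ((Finset.sum_eq_sum_iff_of_le h1).1 (le_antisymm (Finset.sum_le_sum h1) hs) t
    (Finset.mem_univ t)).symm

theorem mem_boxLevel_zero {M : ℤ} (ho : o ∈ Part n M) {a : Fin (n + 1) → ℤ} :
    a ∈ boxLevel M o 0 ↔ a = o := by
  rw [mem_boxLevel ho]
  constructor
  · exact fun h => h.1.eq_of_sum_le (by simpa using h.2.le)
  · rintro rfl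
    exact ⟨Box.self ho, by simp⟩

theorem koszulAug_surjective (hD : IsTwist (pyramid (n + 1) m) D)
    (v : Vert (n + 1) (pyramid (n + 1) m)) :
    Function.Surjective (koszulAug m D v) := by
  classical
  intro y
  obtain ⟨y, rfl⟩ := Submodule.mkQ_surjective _ y
  refine ⟨⟨y * levelIdem m D (co v) 0, mul_levelIdem_mem hD 0 y⟩, ?_⟩
  refine (Submodule.Quotient.eq _).2 ((mem_simpleKer_iff hD v _).2 ?_)
  refine basis_induction hD (C := fun y => y * levelIdem m D (co v) 0 - y ∈ suppSub hD _) y ?_ ?_ ?_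
  · rw [zero_mul, sub_zero]; exact Submodule.zero_mem _
  · intro x y hx hy
    rw [add_mul, add_sub_add_comm]; exact Submodule.add_mem _ hx hy
  · intro r c a _
    rw [smul_mul_assoc, ← smul_sub, basisElt_mul_levelIdem hD]
    refine Submodule.smul_mem _ _ ?_
    split_ifs with h
    · rw [sub_self]; exact Submodule.zero_mem _
    · rw [zero_sub]
      exact Submodule.neg_mem _ (basisElt_mem_suppSub hD fun _ h' =>
        h ((mem_boxLevel_zero (co_mem v)).2 h'.2))

/-- Each term of the differential lowers a row of `a` below that of `c`, so idempotents never occur;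
this is the minimality of the complex. -/
theorem mul_koszulElt_mem_ne (ho : o ∈ Part n ((m : ℤ) - 1)) (x : PyramidAlg (n + 1) m D) :
    x * koszulElt m D o ∈ suppSub hD (fun c a => c ≠ a) := by
  refine mul_koszulElt_mem hD ho ?_ (mem_suppSub_true hD x)
  rintro c a t - hc - rfl
  have := (hc.2.2 t).1
  rw [Pi.sub_apply, Pi.single_eq_same] at this
  omega

theorem range_koszulDiff_zero (v : Vert (n + 1) (pyramid (n + 1) m)) :
    LinearMap.range (koszulDiff m D hD (co_mem v) 0) = LinearMap.ker (koszulAug m D v) := by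
  ext x
  rw [LinearMap.mem_ker, koszulAug_eq_zero_iff hD]
  constructor
  · rintro ⟨y, rfl⟩
    refine suppSub_mono hD (mul_koszulElt_mem_ne hD (co_mem v) y.1) ?_
    rintro c a - h ⟨rfl, rfl⟩
    exact h rfl
  · intro hx
    have hx0 := (mem_levelMod_iff hD).1 x.2
    have h := homotopy_mul_add (l := 0) hD (co_mem v) (x := x.1) (suppSub_mono hD
      (suppSub_inf hD hx0 hx) fun c a _ h =>
        ⟨h.1, fun hc => h.2 ⟨hc, (mem_boxLevel_zero (co_mem v)).1 h.1⟩⟩)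
    -- No point of the cuboid has fewer boxes than `o`, so the differential vanishes on level 0.
    have h0 : x.1 * koszulElt m D (co v) = 0 := by
      refine eq_zero_of_mem_suppSub hD (S := fun _ _ => False)
        (mul_koszulElt_mem hD (co_mem v) ?_ hx0) fun _ _ _ => id
      rintro c a t ha - hb
      have h1 := Finset.sum_le_sum fun s (_ : s ∈ Finset.univ) => (hb s).1
      rw [sum_sub_single, (mem_boxLevel_zero (co_mem v)).1 ha] at h1
      omega
    rw [h0, map_zero, add_zero] at h
    exact ⟨⟨_, h.2⟩, Subtype.ext h.1⟩

theorem range_koszulDiff_succ (ho : o ∈ Part n ((m : ℤ) - 1)) (t : ℕ) :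
    LinearMap.range (koszulDiff m D hD ho (t + 1)) = LinearMap.ker (koszulDiff m D hD ho t) := by
  ext x
  rw [LinearMap.mem_ker]
  constructor
  · rintro ⟨y, rfl⟩
    exact Subtype.ext (mul_koszulElt_sq hD ho y.1)
  · intro hx
    have h0 : x.1 * koszulElt m D o = 0 := congrArg Subtype.val hx
    have h := homotopy_mul_add (l := t + 1) hD ho (x := x.1) (suppSub_mono hD
      -- At a positive level `c` has more boxes than `o`.
      ((mem_levelMod_iff hD).1 x.2) fun c a hc ha => ⟨ha, by
        rintro rfl
        have h1 := hc.sum_le.1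
        have h2 := ((mem_boxLevel ho).1 ha).2
        push_cast at h2
        omega⟩)
    rw [h0, map_zero, add_zero] at h
    exact ⟨⟨_, h.2⟩, Subtype.ext h.1⟩

variable (m D) in
/-- The Koszul complex of a vertex is a minimal resolution of its simple module. -/
def koszulResolution (v : Vert (n + 1) (pyramid (n + 1) m)) :
    MinimalResolution (pyramidRel (n + 1) m D) v where
  P t := levelMod m D (co v) t
  projective t := levelMod_projective hD t
  deg t l := levelDeg hD (co v) t l
  isInternal t := levelDeg_isInternal hD (co_mem v) t
  smul_mem t l l' x y hx hy := by
    refine (mem_levelDeg hD).2 ?_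
    refine mul_mem_suppSub hD (degreePart_le hD l hx) ((mem_levelDeg hD).1 hy) fun c b a _ _ h1 h2 => ?_
    rw [h1, h2]
    push_cast
    ring
  aug := koszulAug m D v
  d t := koszulDiff m D hD (co_mem v) t
  aug_deg l hl y hy := by
    refine (koszulAug_eq_zero_iff hD y).2 (suppSub_mono hD ((mem_levelDeg hD).1 hy) ?_)
    rintro c a - h ⟨rfl, -⟩
    omega
  d_deg t l y hy := (mem_levelDeg hD).2
    (mul_koszulElt_mem hD (co_mem v) (fun _ _ _ h _ _ => h) ((mem_levelDeg hD).1 hy))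
  aug_surjective := koszulAug_surjective hD v
  exact_zero := range_koszulDiff_zero hD v
  exact_succ t := range_koszulDiff_succ hD (co_mem v) t
  minimal_zero := by
    rw [← range_koszulDiff_zero hD v]
    rintro _ ⟨y, rfl⟩
    exact mem_radSubmodule hD _ (mul_koszulElt_mem_ne hD (co_mem v) y.1)
  minimal_succ t := by
    rw [← range_koszulDiff_succ hD (co_mem v) t]
    rintro _ ⟨y, rfl⟩
    exact mem_radSubmodule hD _ (mul_koszulElt_mem_ne hD (co_mem v) y.1)

/-- The Koszul complex is linear at every level. The cuboid has no points at distance `m`, so the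
term at level `m` is zero and by exactness so is the kernel at level `m - 1`; the condition on its
degree holds trivially. -/
theorem isAlmostKoszul (hm : 2 ≤ m) (hD : IsTwist (pyramid (n + 1) m) D) :
    IsAlmostKoszul (pyramidRel (n + 1) m D) (n + 1) ((m - 1 : ℕ) : ℕ∞) := by
  refine ⟨fun l hl => degreePart_eq_bot hD hl, fun v => ⟨koszulResolution m D hD v,
    fun t _ => span_levelDeg hD (co_mem v) t, fun t ht => ?_⟩⟩
  obtain rfl : t = m - 1 := by exact_mod_cast ht
  -- With `m - 1 = l + 1` the kernel in question is that of the differential from level `l + 1` to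
  -- level `l`.
  obtain ⟨l, rfl⟩ : ∃ l, m = l + 2 := ⟨m - 2, by omega⟩
  intro x hx
  change x ∈ LinearMap.ker (koszulDiff (l + 2) D hD (co_mem v) l) at hx
  rw [← range_koszulDiff_succ] at hx
  obtain ⟨y, rfl⟩ := hx
  have hy : y = 0 := by
    refine Subtype.ext (eq_zero_of_mem_suppSub hD ((mem_levelMod_iff hD).1 y.2) ?_)
    intro c a _ ha
    obtain ⟨hb, hs⟩ := (mem_boxLevel (co_mem v)).1 ha
    have := hb.sum_le (co_mem v)
    push_cast at this hs
    omega
  rw [hy, map_zero]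
  exact AddSubgroup.zero_mem _

theorem isTranslationAlgebra (hm : 2 ≤ m) (hD : IsTwist (pyramid (n + 1) m) D) :
    IsTranslationAlgebra (pyramidRel (n + 1) m D) n :=
  ⟨⟨_, _, _, isTranslationQuiver hm hD⟩, _, isAlmostKoszul hm hD⟩

end Resolution

end

end CubicPyramid

/-! ### The three statements of the theorem -/

theorem mainTheorem4 {k : Type u} [Field k] (n m : ℕ) (hn : 1 ≤ n) (hm : 3 ≤ m)
    (d : Fin (n + 1) → Fin (n + 1) → (Fin n → ℤ) → k)
    (hd : CubicPyramid.IsTwist (CubicPyramid.pyramid n m) d) :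
    (∀ t : ℤ, ∃ φ : CubicPyramid.TruncAlg n m d t →ₙₐ[k] CubicPyramid.NextAlg n m d,
      Function.Bijective φ ∧
      (∀ i : Fin (n + 1) → ℤ,
        φ (CubicPyramid.IdealQuot.mk k (CubicPyramid.truncRel n m d t)
            (CubicPyramid.idemAt (n + 1) (CubicPyramid.completion n m t) i)) =
          CubicPyramid.IdealQuot.mk k
            (CubicPyramid.pyramidRel (n + 1) m (CubicPyramid.liftScalars d))
            (CubicPyramid.idemAt (n + 1) (CubicPyramid.pyramid (n + 1) m)
              (CubicPyramid.shiftLast (1 - t) i))) ∧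
      (∀ (s : Fin (n + 1)) (i : Fin (n + 1) → ℤ),
        φ (CubicPyramid.IdealQuot.mk k (CubicPyramid.truncRel n m d t)
            (CubicPyramid.arrowAt (n + 1) (CubicPyramid.completion n m t) s i)) =
          CubicPyramid.IdealQuot.mk k
            (CubicPyramid.pyramidRel (n + 1) m (CubicPyramid.liftScalars d))
            (CubicPyramid.arrowAt (n + 1) (CubicPyramid.pyramid (n + 1) m) s
              (CubicPyramid.shiftLast (1 - t) i)))) ∧
    (∀ t : ℤ, ∃ φ : CubicPyramid.NextAlg n m d →ₙₐ[k] CubicPyramid.SmashQuot n m d t,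
      Function.Bijective φ ∧
      (∀ i : Fin (n + 1) → ℤ,
        φ (CubicPyramid.IdealQuot.mk k
            (CubicPyramid.pyramidRel (n + 1) m (CubicPyramid.liftScalars d))
            (CubicPyramid.idemAt (n + 1) (CubicPyramid.pyramid (n + 1) m) i)) =
          CubicPyramid.IdealQuot.mk k (CubicPyramid.outsideIdempotents n m d t)
            (CubicPyramid.Smash.of (CubicPyramid.stableGrading n m d)
              (i (Fin.last n) + (t - 1))
              (CubicPyramid.IdealQuot.mk k (CubicPyramid.stableRel n m d)
                (CubicPyramid.idemAt (n + 1) (CubicPyramid.pyramid n m) (Fin.init i))))) ∧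
      (∀ (s : Fin (n + 1)) (i : Fin (n + 1) → ℤ),
        φ (CubicPyramid.IdealQuot.mk k
            (CubicPyramid.pyramidRel (n + 1) m (CubicPyramid.liftScalars d))
            (CubicPyramid.arrowAt (n + 1) (CubicPyramid.pyramid (n + 1) m) s i)) =
          CubicPyramid.IdealQuot.mk k (CubicPyramid.outsideIdempotents n m d t)
            (CubicPyramid.Smash.of (CubicPyramid.stableGrading n m d)
              (i (Fin.last n) + (t - 1))
              (CubicPyramid.IdealQuot.mk k (CubicPyramid.stableRel n m d)
                (CubicPyramid.arrowAt (n + 1) (CubicPyramid.pyramid n m) s (Fin.init i)))))) ∧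
    CubicPyramid.IsTranslationAlgebra
      (CubicPyramid.pyramidRel (n + 1) m (CubicPyramid.liftScalars d)) n ∧
    CubicPyramid.IsAlmostKoszul
      (CubicPyramid.pyramidRel (n + 1) m (CubicPyramid.liftScalars d)) (n + 1)
      ((m - 1 : ℕ) : ℕ∞) := by
  have hD := hd.liftScalars hn
  refine ⟨CubicPyramid.exists_trunc_iso d hn, fun t => ?_,
    CubicPyramid.isTranslationAlgebra (by omega) hD, CubicPyramid.isAlmostKoszul (by omega) hD⟩
  obtain ⟨φ, hφ, h1, h2⟩ := CubicPyramid.exists_smash_iso hn d t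
  refine ⟨φ, hφ, fun i => (h1 i).trans ?_, fun s i => (h2 s i).trans ?_⟩
  · rw [CubicPyramid.smashIdem, CubicPyramid.init_add_single_last, Pi.add_apply,
      Pi.single_eq_same]
  · rw [CubicPyramid.smashArrow, CubicPyramid.init_add_single_last, Pi.add_apply,
      Pi.single_eq_same]
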